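/- Let $(I,H)$ be a finite oriented graph without loops; an arrow $h\in H$ goes from $h_0$ to $h_1\neq h_0$. Assume that $H$ carries an involution $h\mapsto\bar h$ without fixed points such that $\bar h_0=h_1$, and a map $\varepsilon:H\to\{1,-1\}$ with $\varepsilon(\bar h)=-\varepsilon(h)$. Let $(V_i)_{i\in I}$, $(D_i)_{i\in I}$ be finite dimensional complex vector spaces, $v_i=\dim V_i$, and let $$S=\bigoplus_{h\in H}\mathrm{Hom}(V_{h_0},V_{h_1})\oplus\bigoplus_{i\in I}\mathrm{Hom}(D_i,V_i)\oplus\bigoplus_{i\in I}\mathrm{Hom}(V_i,D_i),$$ with elements $s=(B,\gamma,\delta)$. The group $G_v=\prod_{i\in I} GL(V_i)$ acts on $S$ by $g\cdot(B_h,\gamma_i,\delta_i)=(g_{h_1}B_hg_{h_0}^{-1},g_i\gamma_i,\delta_ig_i^{-1})$. Let $\mathbb C[S]$ be the algebra of polynomial functions on $S$. For $m\in\mathbb Z^I$ let $\chi_m(g)=\prod_i\det(g_i)^{m_i}$, write $\chi=\chi_m$, and let $\mathbb C[S]_{\chi,1}=\{f\in\mathbb C[S] : f(gs)=\chi(g)f(s)\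 \text{for all } g\in G_v,\ s\in S\}$. **Paths.** A path is a word of composable arrows; there is also an empty path at each vertex. A $b$-path is a word of composable letters which are arrows or loop letters, with one loop letter at every vertex; empty words are allowed. At $s\in S$ a $b$-path from $i$ to $j$ evaluates to the element of $\mathrm{Hom}(V_i,V_j)$ obtained by composing $B_h$ for every arrow $h$ and $\gamma_k\delta_k$ for every loop letter at $k$; empty words evaluate to the identity. The path algebra (resp. $b$-path algebra) is the complex vector space spanned by the paths (resp. $b$-paths), multiplied by concatenation; its elements of type $(i,j)$ are the linear combinations of paths (resp. $b$-paths) from $i$ to $j$, and are evaluated linearly. **Data.** A $\chi$-data $\Delta$ consists of integers $m_i^{\pm}\ge 0$ ($i\in I$) with $m_i^+-m_i^-=m_i$ and integers $m^{\pm}\ge0$ such that $\sum_i m_i^+v_i+m^+=\sum_i m_i^-v_i+m^-$; vectors $a_l\in D_{I(a_l)}$ ($1\le l\le m^-$) and linear forms $b_l\in D_{I(b_l)}^*$ ($1\le l\le m^+$), where $I(a_l),I(b_l)\in I$; and elements of the $b$-path algebra $\alpha^{i,h}_{j,k}$ of type $(i,j)$, $\alpha^{i,h}_{l'}$ of type $(i,I(b_{l'}))$,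 $\alpha^{l}_{j,k}$ of type $(I(a_l),j)$ and $\alpha^l_{l'}$ of type $(I(a_l),I(b_{l'}))$, for $i,j\in I$, $1\le h\le m_i^-$, $1\le k\le m_j^+$, $1\le l\le m^-$, $1\le l'\le m^+$. Put $$Y=\bigoplus_{i\in I}\bigoplus_{h=1}^{m_i^-}V_i\oplus\bigoplus_{l=1}^{m^-}\mathbb C_{a_l},\qquad Z=\bigoplus_{j\in I}\bigoplus_{k=1}^{m_j^+}V_j\oplus\bigoplus_{l'=1}^{m^+}\mathbb C_{b_{l'}},$$ where $\mathbb C_{a_l}$ and $\mathbb C_{b_{l'}}$ are copies of $\mathbb C$, and let $\Psi_\Delta(s):Y\to Z$ be the linear map with blocks $\alpha^{i,h}_{j,k}(s)$ from the $h$-th copy of $V_i$ to the $k$-th copy of $V_j$; $b_{l'}\delta_{I(b_{l'})}\alpha^{i,h}_{l'}(s)$ from the $h$-th copy of $V_i$ to $\mathbb C_{b_{l'}}$; $1\mapsto\alpha^l_{j,k}(s)\gamma_{I(a_l)}(a_l)$ from $\mathbb C_{a_l}$ to the $k$-th copy of $V_j$; and $1\mapsto b_{l'}\bigl(\delta_{I(b_{l'})}\alpha^l_{l'}(s)\gamma_{I(a_l)}(a_l)\bigr)$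 from $\mathbb C_{a_l}$ to $\mathbb C_{b_{l'}}$. Since $\dim Y=\dim Z$, one can fix an isomorphism $e_\Delta:Z\to Y$ and set $f_\Delta(s)=\det(e_\Delta\circ\Psi_\Delta(s))$; another choice of $e_\Delta$ multiplies $f_\Delta$ by a nonzero constant. The data $\Delta$ is called $\chi$-good if 1. $m_i^++m_i^-=|m_i|$ for all $i$; 2. $\alpha^l_{l'}=0$ for all $l,l'$; 3. all the elements $\alpha^*_*$ lie in the path algebra; 4. $\#\{(j,k):\alpha^{i,h}_{j,k}\ne0\}+\#\{l':\alpha^{i,h}_{l'}\neq0\}\le v_i$ for all $i,h$; 5. $\#\{(i,h):\alpha^{i,h}_{j,k}\ne0\}+\#\{l:\alpha^{l}_{j,k}\neq0\}\le v_j$ for all $j,k$; 6. for every $l'$ there is at most one pair $(i,h)$ with $\alpha^{i,h}_{l'}\ne0$; 7. for every $l$ there is at most one pair $(j,k)$ with $\alpha^{l}_{j,k}\ne0$. **Proposition.** For every $m\in\mathbb Z^I$ and every choice of the isomorphisms $e_\Delta$, the functions $f_\Delta$, with $\Delta$ running over the $\chi_m$-good data, generate $\mathbb C[S]_{\chi_m,1}$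 as a module over the ring of invariants $\mathbb C[S]^{G_v}$; that is, the $\mathbb C[S]^{G_v}$-submodule of $\mathbb C[S]$ spanned by them is equal to $\mathbb C[S]_{\chi_m,1}$. -/

import Mathlib

noncomputable section

namespace QuiverVariety

universe uI uH uV uD

/-- A finite (when `I`, `H` are finite) oriented graph with vertices `I` and arrows `H`, without
loops, with an orientation reversing involution `bar` and a sign `ε : H → {±1}` which is
anti-invariant under `bar`. An arrow `h` goes from `src h = h₀` to `tgt h = h₁`. -/
structure DoubleQuiver (I : Type uI) (H : Type uH) where
  src : H → I
  tgt : H → I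
  src_ne_tgt : ∀ h, src h ≠ tgt h
  bar : H → H
  bar_bar : ∀ h, bar (bar h) = h
  bar_ne : ∀ h, bar h ≠ h
  src_bar : ∀ h, src (bar h) = tgt h
  ε : H → ℤˣ
  ε_bar : ∀ h, ε (bar h) = -ε h

/-- `b`-paths from `i` to `j`: words whose letters are the arrows of the graph and, for every
vertex `k`, one additional letter (a loop at `k`, written `k¹`; its powers are `kʳ`).
A new letter is appended at the target, so that words are read from right to left. -/
inductive BPath {I : Type uI} {H : Type uH} (Q : DoubleQuiver I H) : I → I → Type (max uI uH)
  | nil (i : I) : BPath Q i i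
  | arrow {i : I} (h : H) (p : BPath Q i (Q.src h)) : BPath Q i (Q.tgt h)
  | loop {i j : I} (p : BPath Q i j) : BPath Q i j

/-- The `b`-paths without loop letters are the paths of the graph. -/
def BPath.IsPath {I : Type uI} {H : Type uH} {Q : DoubleQuiver I H} :
    {i j : I} → BPath Q i j → Prop
  | _, _, .nil _ => True
  | _, _, .arrow _ p => p.IsPath
  | _, _, .loop _ => False

/-- The elements of type `(i, j)` of the `b`-path algebra: the vector space of formal complex
linear combinations of `b`-paths with source `i` and target `j`. -/
abbrev BPathAlg {I : Type uI} {H : Type uH} (Q : DoubleQuiver I H) (i j : I) :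
    Type (max uI uH) :=
  BPath Q i j →₀ ℂ

/-- Membership in the path algebra, the span of the paths inside the `b`-path algebra. -/
def BPathAlg.InPathAlg {I : Type uI} {H : Type uH} {Q : DoubleQuiver I H} {i j : I}
    (x : BPathAlg Q i j) : Prop :=
  x ∈ Submodule.span ℂ {y : BPathAlg Q i j | ∃ p : BPath Q i j, p.IsPath ∧ y = Finsupp.single p 1}

section Space

variable {I : Type uI} {H : Type uH} (Q : DoubleQuiver I H)
  (V : I → Type uV) [∀ i, AddCommGroup (V i)] [∀ i, Module ℂ (V i)]
  (D : I → Type uD) [∀ i, AddCommGroup (D i)] [∀ i, Module ℂ (D i)]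

/-- The space `S` of triples `(B, γ, δ)` with `B h : V (h₀) → V (h₁)`, `γ i : D i → V i` and
`δ i : V i → D i`. -/
abbrev Rep : Type (max uI uH uV uD) :=
  ((h : H) → V (Q.src h) →ₗ[ℂ] V (Q.tgt h)) ×
    ((i : I) → D i →ₗ[ℂ] V i) × ((i : I) → V i →ₗ[ℂ] D i)

/-- The group `G_v = ∏ GL(V i)`. -/
abbrev GV : Type (max uI uV) := (i : I) → V i ≃ₗ[ℂ] V i

variable {V} in
/-- The character `χ_m = ∏ det(g i) ^ (m i)` of `G_v`. -/
def chi [Fintype I] (m : I → ℤ) : GV V →* ℂˣ where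
  toFun g := ∏ i, LinearEquiv.det (g i) ^ m i
  map_one' := by simp
  map_mul' g g' := by simp [mul_zpow, Finset.prod_mul_distrib]

variable {Q V D} in
/-- The action of `G_v` on `S`. -/
def act (g : GV V) (s : Rep Q V D) : Rep Q V D :=
  (fun h => (g (Q.tgt h)).toLinearMap ∘ₗ s.1 h ∘ₗ (g (Q.src h)).symm.toLinearMap,
    fun i => (g i).toLinearMap ∘ₗ s.2.1 i,
    fun i => s.2.2 i ∘ₗ (g i).symm.toLinearMap)

/-- The algebra `ℂ[S]` of polynomial functions on `S`: it is generated by the linear forms. -/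
def polyFun : Subalgebra ℂ (Rep Q V D → ℂ) :=
  Algebra.adjoin ℂ (Set.range fun φ : Module.Dual ℂ (Rep Q V D) => (φ : Rep Q V D → ℂ))

/-- The algebra `ℂ[S]^{G_v}` of invariant polynomial functions. -/
def invariants : Subalgebra ℂ (Rep Q V D → ℂ) where
  carrier := {f | f ∈ polyFun Q V D ∧ ∀ (g : GV V) (s : Rep Q V D), f (act g s) = f s}
  mul_mem' := fun ha hb => ⟨mul_mem ha.1 hb.1, fun g s => by
    simp only [Pi.mul_apply, ha.2 g s, hb.2 g s]⟩
  add_mem' := fun ha hb => ⟨add_mem ha.1 hb.1, fun g s => by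
    simp only [Pi.add_apply, ha.2 g s, hb.2 g s]⟩
  algebraMap_mem' := fun r => ⟨Subalgebra.algebraMap_mem _ r, fun _ _ => rfl⟩

/-- `ℂ[S]_{χ,n}`: the polynomial functions `f` with `f (g s) = χ(g)ⁿ f(s)`, as a module over the
invariants. -/
def semiInvariants (χ : GV V →* ℂˣ) (n : ℕ) :
    Submodule (invariants Q V D) (Rep Q V D → ℂ) where
  carrier := {f | f ∈ polyFun Q V D ∧
    ∀ (g : GV V) (s : Rep Q V D), f (act g s) = ((χ g : ℂˣ) : ℂ) ^ n * f s}
  zero_mem' := ⟨zero_mem _, fun g s => by simp⟩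
  add_mem' := fun ha hb => ⟨add_mem ha.1 hb.1, fun g s => by
    simp only [Pi.add_apply, ha.2 g s, hb.2 g s, mul_add]⟩
  smul_mem' := fun c f hf => ⟨mul_mem c.2.1 hf.1, fun g s => by
    have h1 : (c • f) (act g s) = c.1 (act g s) * f (act g s) := rfl
    have h2 : (c • f) s = c.1 s * f s := rfl
    rw [h1, h2, c.2.2 g s, hf.2 g s]; ring⟩

variable {Q V D}

/-- Evaluation of a `b`-path at a point of `S`: an arrow `h` acts by `B h`, a loop letter at `k`
by `γ k ∘ δ k`, and an empty path by the identity. -/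
def BPath.eval (s : Rep Q V D) : {i j : I} → BPath Q i j → (V i →ₗ[ℂ] V j)
  | _, _, .nil _ => LinearMap.id
  | _, _, .arrow h p => s.1 h ∘ₗ p.eval s
  | _, j, .loop p => (s.2.1 j ∘ₗ s.2.2 j) ∘ₗ p.eval s

/-- Evaluation of elements of type `(i, j)` of the `b`-path algebra, by linearity. -/
def BPathAlg.eval (s : Rep Q V D) {i j : I} (x : BPathAlg Q i j) : V i →ₗ[ℂ] V j :=
  x.sum fun p c => c • p.eval s

end Space

section Data

variable {I : Type uI} {H : Type uH} [Fintype I] (Q : DoubleQuiver I H)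
  (V : I → Type uV) [∀ i, AddCommGroup (V i)] [∀ i, Module ℂ (V i)]
  (D : I → Type uD) [∀ i, AddCommGroup (D i)] [∀ i, Module ℂ (D i)]

/-- A `χ_m`-data `Δ`. Here `mPos i = m_i⁺`, `mNeg i = m_i⁻`, `nPos = m⁺`, `nNeg = m⁻`;
`a l` is a vector of `D (Ia l)` and `b l` a linear form on `D (Ib l)`. -/
structure ChiData (m : I → ℤ) where
  mPos : I → ℕ
  mNeg : I → ℕ
  mPos_sub_mNeg : ∀ i, (mPos i : ℤ) - (mNeg i : ℤ) = m i
  nPos : ℕ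
  nNeg : ℕ
  balance : ∑ i, mPos i * Module.finrank ℂ (V i) + nPos =
    ∑ i, mNeg i * Module.finrank ℂ (V i) + nNeg
  Ia : Fin nNeg → I
  a : (l : Fin nNeg) → D (Ia l)
  Ib : Fin nPos → I
  b : (l : Fin nPos) → Module.Dual ℂ (D (Ib l))
  αVV : (p : Σ i, Fin (mNeg i)) → (q : Σ j, Fin (mPos j)) → BPathAlg Q p.1 q.1
  αVb : (p : Σ i, Fin (mNeg i)) → (l : Fin nPos) → BPathAlg Q p.1 (Ib l)
  αaV : (l : Fin nNeg) → (q : Σ j, Fin (mPos j)) → BPathAlg Q (Ia l) q.1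
  αab : (l : Fin nNeg) → (l' : Fin nPos) → BPathAlg Q (Ia l) (Ib l')

variable {Q V D} {m : I → ℤ}

namespace ChiData

/-- `Y`, the direct sum of `m_i⁻` copies of every `V i` and of `m⁻` lines. -/
abbrev Y (Δ : ChiData Q V D m) : Type (max uI uV) :=
  ((p : Σ i, Fin (Δ.mNeg i)) → V p.1) × (Fin Δ.nNeg → ℂ)

/-- `Z`, the direct sum of `m_i⁺` copies of every `V i` and of `m⁺` lines. -/
abbrev Z (Δ : ChiData Q V D m) : Type (max uI uV) :=
  ((q : Σ j, Fin (Δ.mPos j)) → V q.1) × (Fin Δ.nPos → ℂ)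

/-- The linear map `Ψ_Δ(s) : Y → Z`, given by its blocks. -/
def Ψ (Δ : ChiData Q V D m) (s : Rep Q V D) : Δ.Y →ₗ[ℂ] Δ.Z where
  toFun y :=
    (fun q => ∑ p, (Δ.αVV p q).eval s (y.1 p) +
        ∑ l, y.2 l • (Δ.αaV l q).eval s (s.2.1 (Δ.Ia l) (Δ.a l)),
      fun l' => ∑ p, Δ.b l' (s.2.2 (Δ.Ib l') ((Δ.αVb p l').eval s (y.1 p))) +
        ∑ l, y.2 l * Δ.b l' (s.2.2 (Δ.Ib l')
          ((Δ.αab l l').eval s (s.2.1 (Δ.Ia l) (Δ.a l)))))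
  map_add' y y' := by
    ext <;> simp [add_smul, add_mul, Finset.sum_add_distrib] <;> abel
  map_smul' c y := by
    ext <;> simp [Finset.smul_sum, Finset.mul_sum, mul_add, mul_smul, mul_assoc]

/-- The function `f_Δ(s) = det Ψ_Δ(s)`. The determinant of a linear map between two spaces of
equal dimension depends on an identification `e` of the two, and only through a nonzero factor. -/
def f (Δ : ChiData Q V D m) (e : Δ.Z ≃ₗ[ℂ] Δ.Y) (s : Rep Q V D) : ℂ :=
  LinearMap.det (e.toLinearMap ∘ₗ Δ.Ψ s)

/-- Identifications as used in `f` exist for every data. -/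
theorem nonempty_equiv [∀ i, FiniteDimensional ℂ (V i)] (Δ : ChiData Q V D m) :
    Nonempty (Δ.Z ≃ₗ[ℂ] Δ.Y) := by
  refine ⟨LinearEquiv.ofFinrankEq _ _ ?_⟩
  have key : ∀ k : I → ℕ, Module.finrank ℂ ((p : Σ i, Fin (k i)) → V p.1) =
      ∑ i, k i * Module.finrank ℂ (V i) := by
    intro k
    rw [Module.finrank_pi_fintype, Fintype.sum_sigma]
    exact Finset.sum_congr rfl fun i _ => by
      change ∑ _ : Fin (k i), Module.finrank ℂ (V i) = _
      rw [Finset.sum_const, Finset.card_univ, Fintype.card_fin, smul_eq_mul]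
  rw [Module.finrank_prod, Module.finrank_prod, key, key]
  simpa using Δ.balance

/-- `χ_m`-good data. -/
structure IsGood (Δ : ChiData Q V D m) : Prop where
  mPos_add_mNeg : ∀ i, Δ.mPos i + Δ.mNeg i = (m i).natAbs
  αab_eq_zero : ∀ l l', Δ.αab l l' = 0
  path_VV : ∀ p q, (Δ.αVV p q).InPathAlg
  path_Vb : ∀ p l, (Δ.αVb p l).InPathAlg
  path_aV : ∀ l q, (Δ.αaV l q).InPathAlg
  path_ab : ∀ l l', (Δ.αab l l').InPathAlg
  card_source : ∀ p, {q | Δ.αVV p q ≠ 0}.ncard + {l | Δ.αVb p l ≠ 0}.ncard ≤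
    Module.finrank ℂ (V p.1)
  card_target : ∀ q, {p | Δ.αVV p q ≠ 0}.ncard + {l | Δ.αaV l q ≠ 0}.ncard ≤
    Module.finrank ℂ (V q.1)
  unique_source : ∀ l p p', Δ.αVb p l ≠ 0 → Δ.αVb p' l ≠ 0 → p = p'
  unique_target : ∀ l q q', Δ.αaV l q ≠ 0 → Δ.αaV l q' ≠ 0 → q = q'

end ChiData

end Data

end QuiverVariety

end

noncomputable section

set_option linter.unusedSectionVars false

namespace QuiverVariety

open Equiv (Perm)

/-! ### Polarization of multilinear maps -/

section Polarization

variable {E : Type*} [Fintype E] [DecidableEq E]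

/-! The determinants are semi-invariant because `Ψ` intertwines the actions of the group on `Y` and
`Z`, and they are polynomial because the entries of `Ψ` are (`ChiData.f_act`,
`ChiData.f_mem_polyFun`). The content is the converse.

Scaling the point separates the homogeneous parts of a semi-invariant, and in characteristic zero
each part is the restriction to the diagonal of a semi-invariant multilinear form. A point is the
sum of its arrows, of the columns of γ and of the rows of δ, so the form becomes a sum of forms in
operators, vectors and covectors.

To remove the character, multiply such a form by determinants of auxiliary frames: m_i⁻ frames of
vectors and m_i⁺ frames of covectors of V_i (`framedForm`). The product is invariant, hence by the
first fundamental theorem (`exists_contraction_coefficients`) a combination of full contractions. A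
closed cycle of operators contributes the trace of a path, which is invariant. An open chain
contributes the pairing of a covector with a vector through a path (`colored_contraction_eq`). Rows
of δ and columns of γ are ends of chains, so no loop letter ever appears. Substituting for the
frames the standard bases, permuted within each copy of V_i, and summing with signs gives back a
nonzero multiple of the original form; each contraction becomes an alternating sum, over
permutations preserving the copies, of products of pairings.

It remains to write this alternating sum by good data. A chain from γ to δ is itself an invariant
and splits off (`framed_sum_mem_goodSpan`). The other chains match rows (basis covectors, rows of δ)
with columns (basis vectors, columns of γ). For a set S of rows, let the blocks of a data be the
sums of the paths of the chains in S. In the alternating sum over S of the resulting determinants,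
inclusion-exclusion keeps the terms using every chain exactly once, and this is the required sum
(`sum_neg_one_pow_smul_clustered_det`). The data are good since every basis vector and every line
lies on a single chain: at most v_i nonzero blocks meet a copy of V_i, and at most one meets a line
(`goodData_isGood`). -/

/-- Inclusion-exclusion: the alternating sum over subsets `S` of the sum over maps into `S` is the
sum over permutations. -/
theorem sum_neg_one_pow_card_compl_smul_sum_piFinset {M : Type*} [AddCommGroup M]
    (F : (E → E) → M) :
    ∑ S : Finset E, (-1 : ℤ) ^ Sᶜ.card • ∑ ν ∈ Fintype.piFinset (fun _ : E => S), F ν =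
      ∑ ν : Perm E, F ν := by
  have h1 : ∀ ν : E → E, ∑ S : Finset E, (if ν ∈ Fintype.piFinset (fun _ : E => S) then
      (-1 : ℤ) ^ Sᶜ.card else 0) = if Function.Surjective ν then 1 else 0 := by
    intro ν
    -- After passing to complements, the admissible sets are the subsets of the complement of the
    -- image of `ν`; their alternating sum vanishes unless `ν` is surjective.
    rw [← Equiv.sum_comp (Function.Involutive.toPerm _ (compl_involutive (α := Finset E)))]
    simp only [Function.Involutive.coe_toPerm, compl_compl]
    rw [← Finset.sum_filter]
    have h2 : (Finset.univ.filter fun S : Finset E => ν ∈ Fintype.piFinset fun _ : E => Sᶜ) =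
        ((Finset.univ.image ν)ᶜ).powerset := by
      ext S
      simp only [Finset.mem_filter, Finset.mem_univ, true_and, Fintype.mem_piFinset,
        Finset.mem_compl, Finset.mem_powerset, Finset.subset_iff, Finset.mem_image, not_exists]
      exact ⟨fun h x hx e he => h e (he ▸ hx), fun h e he => h he e rfl⟩
    rw [h2, Finset.sum_powerset_neg_one_pow_card]
    congr 1
    rw [Finset.compl_eq_empty_iff, Finset.eq_univ_iff_forall]
    simp [Function.Surjective]
  have h3 : ∑ S : Finset E, (-1 : ℤ) ^ Sᶜ.card • ∑ ν ∈ Fintype.piFinset (fun _ : E => S), F ν =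
      ∑ S : Finset E, ∑ ν : E → E, (if ν ∈ Fintype.piFinset (fun _ : E => S) then
        (-1 : ℤ) ^ Sᶜ.card else 0) • F ν := by
    refine Finset.sum_congr rfl fun S _ => ?_
    rw [Finset.smul_sum]
    simp only [ite_smul, zero_smul]
    rw [← Finset.sum_filter]
    exact Finset.sum_congr (by ext; simp) fun _ _ => rfl
  rw [h3, Finset.sum_comm]
  simp_rw [← Finset.sum_smul, h1, ite_smul, one_smul, zero_smul]
  rw [← Finset.sum_filter]
  symm
  refine Finset.sum_bij (fun (ν : Perm E) _ => (ν : E → E)) (fun ν _ => by simp [ν.surjective])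
    (fun a _ b _ h => DFunLike.coe_injective h) (fun ν hν => ?_) (fun _ _ => rfl)
  have hs : Function.Surjective ν := by simpa using hν
  exact ⟨Equiv.ofBijective ν (Finite.injective_iff_bijective.1
    (Finite.injective_iff_surjective.2 hs)), by simp, rfl⟩

variable {R M M' : Type*} [CommRing R] [AddCommGroup M] [Module R M] [AddCommGroup M'] [Module R M']

/-- Polarization of a multilinear map along a square array of vectors. -/
theorem sum_perm_multilinear (φ : MultilinearMap R (fun _ : E => M) M') (a : E → E → M) :
    ∑ ν : Perm E, φ (fun e => a e (ν e)) =
      ∑ S : Finset E, (-1 : ℤ) ^ Sᶜ.card • φ (fun e => ∑ b ∈ S, a e b) := by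
  rw [← sum_neg_one_pow_card_compl_smul_sum_piFinset (fun ν => φ (fun e => a e (ν e)))]
  refine Finset.sum_congr rfl fun S _ => ?_
  rw [MultilinearMap.map_sum_finset]

/-- A multilinear map which vanishes on the diagonal of a submodule is killed by symmetrization
there. -/
theorem sum_perm_eq_zero_of_diagonal (φ : MultilinearMap R (fun _ : E => M) M')
    (W : Submodule R M) (h : ∀ x ∈ W, φ (fun _ => x) = 0) (a : E → M) (ha : ∀ e, a e ∈ W) :
    ∑ ν : Perm E, φ (fun e => a (ν e)) = 0 := by
  rw [sum_perm_multilinear φ fun _ b => a b]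
  refine Finset.sum_eq_zero fun S _ => ?_
  rw [h _ (W.sum_mem fun b _ => ha b), smul_zero]

end Polarization

/-! ### First fundamental theorem for block diagonal matrices, by a double commutant argument -/

/-- Orthogonal projections onto a subspace commute with the operators which preserve the subspace
together with their adjoints. -/
theorem exists_orthogonal_projection {ι : Type*} [Fintype ι] (A : Submodule ℂ (ι → ℂ)) :
    ∃ P : (ι → ℂ) →ₗ[ℂ] (ι → ℂ), (∀ x, P x ∈ A) ∧ (∀ x ∈ A, P x = x) ∧
      ∀ a b : (ι → ℂ) →ₗ[ℂ] (ι → ℂ),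
        (∀ x y, ∑ i, star (x i) * a y i = ∑ i, star (b x i) * y i) →
        (∀ x ∈ A, a x ∈ A) → (∀ x ∈ A, b x ∈ A) → ∀ x, P (a x) = a (P x) := by
  let w : EuclideanSpace ℂ ι ≃ₗ[ℂ] (ι → ℂ) := WithLp.linearEquiv 2 ℂ (ι → ℂ)
  let A' : Submodule ℂ (EuclideanSpace ℂ ι) := A.comap w.toLinearMap
  have hin : ∀ x y : EuclideanSpace ℂ ι, inner ℂ x y = ∑ i, star (w x i) * w y i := by
    intro x y
    rw [PiLp.inner_apply]
    refine Finset.sum_congr rfl fun i _ => ?_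
    rw [RCLike.inner_apply']
    rfl
  refine ⟨w.toLinearMap ∘ₗ A'.starProjection.toLinearMap ∘ₗ w.symm.toLinearMap, fun x => ?_,
    fun x hx => ?_, fun a b hab ha hb x => ?_⟩
  · exact A'.starProjection_apply_mem (w.symm x)
  · have : A'.starProjection (w.symm x) = w.symm x :=
      Submodule.starProjection_eq_self_iff.2 (by simpa [A'] using hx)
    simp [this]
  · have hx : w.symm x - A'.starProjection (w.symm x) ∈ A'ᗮ :=
      A'.sub_starProjection_mem_orthogonal _
    -- The vector `a (P x)` lies in `A`, and `a (x - P x)` is orthogonal to `A` because the adjoint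
    -- `b` maps `A` to itself.
    have key : A'.starProjection (w.symm (a x)) =
        w.symm (a (w (A'.starProjection (w.symm x)))) := by
      refine Submodule.eq_starProjection_of_mem_orthogonal ?_ ?_
      · have := ha _ (A'.starProjection_apply_mem (w.symm x))
        simpa [A'] using this
      · rw [Submodule.mem_orthogonal] at hx ⊢
        intro u hu
        have h1 := hx (w.symm (b (w u))) (by simpa [A'] using hb _ hu)
        rw [hin] at h1 ⊢
        rw [← map_sub, LinearEquiv.apply_symm_apply]
        rw [LinearEquiv.apply_symm_apply, ← hab] at h1
        rw [← h1, ← map_sub]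
        simp
    simp [key]

section FFT

variable {N C E : Type*} [Fintype N] [DecidableEq N] [DecidableEq C]
  [Fintype E] [DecidableEq E]

/-- A multilinear form on matrices in terms of its values on matrix units. -/
theorem multilinear_matrix_expand (Θ : MultilinearMap ℂ (fun _ : E => Matrix N N ℂ) ℂ)
    (X : E → Matrix N N ℂ) :
    Θ X = ∑ l : E → N, ∑ k : E → N,
      (∏ e, X e (k e) (l e)) * Θ fun e => Matrix.single (k e) (l e) 1 := by
  have h1 : Θ X = Θ fun e => ∑ p : N × N, X e p.2 p.1 • Matrix.single p.2 p.1 1 := by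
    congr 1
    ext1 e
    conv_lhs => rw [Matrix.matrix_eq_sum_single (X e)]
    rw [Fintype.sum_prod_type, Finset.sum_comm]
    simp
  rw [h1, MultilinearMap.map_sum, ← Fintype.sum_prod_type',
    ← (Equiv.arrowProdEquivProdArrow E (fun _ => N) (fun _ => N)).sum_comp]
  refine Finset.sum_congr rfl fun p _ => ?_
  rw [MultilinearMap.map_smul_univ]
  rfl

/-- If a multilinear form intertwines left and right multiplication by block diagonal units, then
it does so for all block diagonal matrices. -/
theorem multilinear_mul_comm_of_units (c : N → C)
    (Θ : MultilinearMap ℂ (fun _ : E => Matrix N N ℂ) ℂ)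
    (h : ∀ g : Matrix N N ℂ, IsUnit g → (∀ k l, c k ≠ c l → g k l = 0) →
      ∀ Y : E → Matrix N N ℂ, (Θ fun e => g * Y e) = Θ fun e => Y e * g)
    (g : Matrix N N ℂ) (hg : ∀ k l, c k ≠ c l → g k l = 0) (Y : E → Matrix N N ℂ) :
    (Θ fun e => g * Y e) = Θ fun e => Y e * g := by
  -- Density of the units along the line `t • 1 + g`: the defect of the identity is a polynomial in
  -- `t`, to be shown zero and evaluated at `t = 0`.
  obtain ⟨p, hp⟩ : ∃ p : Polynomial ℂ, ∀ t : ℂ, p.eval t =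
      (Θ fun e => (t • 1 + g) * Y e) - Θ fun e => Y e * (t • 1 + g) := by
    refine ⟨∑ S : Finset E, Polynomial.C ((Θ (S.piecewise Y fun e => g * Y e)) -
      Θ (S.piecewise Y fun e => Y e * g)) * Polynomial.X ^ S.card, fun t => ?_⟩
    have e1 : (fun e => (t • 1 + g) * Y e) = (fun e => t • Y e) + fun e => g * Y e := by
      ext1 e; simp [add_mul]
    have e2 : (fun e => Y e * (t • 1 + g)) = (fun e => t • Y e) + fun e => Y e * g := by
      ext1 e; simp [mul_add]
    have e3 : ∀ (S : Finset E) (Z : E → Matrix N N ℂ),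
        Θ (S.piecewise (fun e => t • Y e) Z) = t ^ S.card * Θ (S.piecewise Y Z) := by
      intro S Z
      have := Θ.map_piecewise_smul (fun _ => t) (S.piecewise Y Z) S
      rw [Finset.prod_const, smul_eq_mul] at this
      rw [← this]
      congr 1
      ext1 e
      by_cases he : e ∈ S <;> simp [he]
    rw [e1, e2, MultilinearMap.map_add_univ, MultilinearMap.map_add_univ,
      ← Finset.sum_sub_distrib, Polynomial.eval_finsetSum]
    refine Finset.sum_congr rfl fun S _ => ?_
    simp only [e3, Polynomial.eval_mul, Polynomial.eval_C, Polynomial.eval_pow, Polynomial.eval_X]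
    ring
  -- Where the characteristic polynomial of `-g` does not vanish, `t • 1 + g` is a unit, so `p`
  -- vanishes there.
  have hq : p * (-g).charpoly = 0 := by
    refine Polynomial.funext fun t => ?_
    rw [Polynomial.eval_mul, Polynomial.eval_zero, mul_eq_zero]
    by_cases ht : ((-g).charpoly).eval t = 0
    · exact Or.inr ht
    · left
      rw [hp, sub_eq_zero]
      refine h _ ?_ ?_ Y
      · rw [Matrix.isUnit_iff_isUnit_det, isUnit_iff_ne_zero]
        rw [Matrix.eval_charpoly] at ht
        convert ht using 2
        rw [sub_neg_eq_add, Matrix.scalar_apply, ← Matrix.smul_one_eq_diagonal]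
      · intro k l hkl
        have : k ≠ l := fun h => hkl (h ▸ rfl)
        simp [hg k l hkl, this]
  have hp0 : p = 0 := (mul_eq_zero.1 hq).resolve_right (Matrix.charpoly_monic _).ne_zero
  have := hp 0
  simp only [hp0, Polynomial.eval_zero, zero_smul, zero_add] at this
  exact sub_eq_zero.1 this.symm

/-- The tensor coefficients of a multilinear form intertwining block diagonal matrices commute with
every symmetric colour preserving matrix on the multi-indices. -/
theorem tensor_commute (c : N → C) (Θ : MultilinearMap ℂ (fun _ : E => Matrix N N ℂ) ℂ)
    (h : ∀ g : Matrix N N ℂ, (∀ k l, c k ≠ c l → g k l = 0) →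
      ∀ Y : E → Matrix N N ℂ, (Θ fun e => g * Y e) = Θ fun e => Y e * g)
    (A : (E → N) → (E → N) → ℂ) (hA : ∀ (σ : Perm E) l k, A (l ∘ σ) (k ∘ σ) = A l k)
    (hc : ∀ l k, c ∘ l ≠ c ∘ k → A l k = 0) (l k : E → N) :
    ∑ r, A r k * Θ (fun e => Matrix.single (r e) (l e) 1) =
      ∑ r, A l r * Θ (fun e => Matrix.single (k e) (r e) 1) := by
  -- The identity with one and the same block diagonal `g` in all slots is polarized to different
  -- matrix units in the slots; equality of colours makes these units block diagonal.
  have pol : ∀ p q : E → N, c ∘ p = c ∘ q → ∀ Y : E → Matrix N N ℂ,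
      ∑ ν : Perm E, (Θ fun e => Matrix.single (p (ν e)) (q (ν e)) 1 * Y e) =
        ∑ ν : Perm E, Θ fun e => Y e * Matrix.single (p (ν e)) (q (ν e)) 1 := by
    intro p q hpq Y
    let W : Submodule ℂ (Matrix N N ℂ) :=
      { carrier := {g | ∀ k l, c k ≠ c l → g k l = 0}
        add_mem' := fun {a b} ha hb k l hkl => by simp [ha k l hkl, hb k l hkl]
        zero_mem' := fun _ _ _ => rfl
        smul_mem' := fun t a ha k l hkl => by simp [ha k l hkl] }
    have := sum_perm_eq_zero_of_diagonal
      (Θ.compLinearMap (fun e => LinearMap.mulRight ℂ (Y e)) -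
        Θ.compLinearMap (fun e => LinearMap.mulLeft ℂ (Y e))) W
      (fun g hg => by simpa [sub_eq_zero] using h g hg Y)
      (fun e => Matrix.single (p e) (q e) 1) (fun e k l hkl => by
        rw [Matrix.single_apply_of_ne]
        rintro ⟨rfl, rfl⟩
        exact hkl (congrFun hpq e))
    simpa [sub_eq_zero] using this
  let T : (E → N) → (E → N) → ℂ := fun l k => Θ fun e => Matrix.single (k e) (l e) 1
  -- both sides are averages over permutations
  have hL : ∑ p, ∑ q, A p q * ∑ ν : Perm E, (Θ fun e => Matrix.single (p (ν e)) (q (ν e)) 1 *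
      Matrix.single (k e) (l e) 1) = (Fintype.card (Perm E) : ℂ) * ∑ r, A r k * T l r := by
    have : ∀ ν : Perm E, ∑ p, ∑ q, A p q * (Θ fun e => Matrix.single (p (ν e)) (q (ν e)) 1 *
        Matrix.single (k e) (l e) (1 : ℂ)) = ∑ r, A r k * T l r := by
      intro ν
      rw [← (ν.arrowCongr (Equiv.refl N)).sum_comp]
      refine Finset.sum_congr rfl fun r _ => ?_
      rw [← (ν.arrowCongr (Equiv.refl N)).sum_comp, Finset.sum_eq_single k]
      · have e1 : A ((ν.arrowCongr (Equiv.refl N)) r) ((ν.arrowCongr (Equiv.refl N)) k) = A r k :=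
          hA ν.symm r k
        rw [e1]
        simp [T]
      · intro q _ hq
        obtain ⟨e, he⟩ := Function.ne_iff.1 hq
        rw [Θ.map_coord_zero e, mul_zero]
        simp [he]
      · simp
    simp_rw [Finset.mul_sum]
    rw [Finset.sum_congr rfl fun p _ => Finset.sum_comm, Finset.sum_comm,
      Finset.sum_congr rfl fun ν _ => this ν]
    simp [Finset.mul_sum]
  have hR : ∑ p, ∑ q, A p q * ∑ ν : Perm E, (Θ fun e => Matrix.single (k e) (l e) 1 *
      Matrix.single (p (ν e)) (q (ν e)) 1) = (Fintype.card (Perm E) : ℂ) * ∑ r, A l r * T r k := by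
    have : ∀ ν : Perm E, ∑ p, ∑ q, A p q * (Θ fun e => Matrix.single (k e) (l e) (1 : ℂ) *
        Matrix.single (p (ν e)) (q (ν e)) 1) = ∑ r, A l r * T r k := by
      intro ν
      rw [Finset.sum_comm, ← (ν.arrowCongr (Equiv.refl N)).sum_comp]
      refine Finset.sum_congr rfl fun r _ => ?_
      rw [← (ν.arrowCongr (Equiv.refl N)).sum_comp, Finset.sum_eq_single l]
      · have e1 : A ((ν.arrowCongr (Equiv.refl N)) l) ((ν.arrowCongr (Equiv.refl N)) r) = A l r :=
          hA ν.symm l r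
        rw [e1]
        simp [T]
      · intro q _ hq
        obtain ⟨e, he⟩ := Function.ne_iff.1 hq
        rw [Θ.map_coord_zero e, mul_zero]
        simp [he.symm]
      · simp
    simp_rw [Finset.mul_sum]
    rw [Finset.sum_congr rfl fun p _ => Finset.sum_comm, Finset.sum_comm,
      Finset.sum_congr rfl fun ν _ => this ν]
    simp [Finset.mul_sum]
  have hLR : (Fintype.card (Perm E) : ℂ) * ∑ r, A r k * T l r =
      (Fintype.card (Perm E) : ℂ) * ∑ r, A l r * T r k := by
    rw [← hL, ← hR]
    refine Finset.sum_congr rfl fun p _ => Finset.sum_congr rfl fun q _ => ?_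
    -- Colour preservation of `A` discards exactly the pairs to which `pol` does not apply.
    by_cases hpq : c ∘ p = c ∘ q
    · rw [pol p q hpq]
    · rw [hc p q hpq, zero_mul, zero_mul]
  exact mul_left_cancel₀ (Nat.cast_ne_zero.2 Fintype.card_ne_zero) hLR

/-- First fundamental theorem: a multilinear form on matrices which intertwines left and right
multiplication by block diagonal units is a combination of the contractions along permutations
with prescribed colours. -/
theorem exists_contraction_coefficients [Fintype C] (c : N → C)
    (Θ : MultilinearMap ℂ (fun _ : E => Matrix N N ℂ) ℂ)
    (h : ∀ g : Matrix N N ℂ, IsUnit g → (∀ k l, c k ≠ c l → g k l = 0) →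
      ∀ Y : E → Matrix N N ℂ, (Θ fun e => g * Y e) = Θ fun e => Y e * g) :
    ∃ a : Perm E → (E → C) → ℂ, ∀ X : E → Matrix N N ℂ,
      Θ X = ∑ σ, ∑ κ, a σ κ * ∑ k : E → N,
        if c ∘ k = κ then ∏ e, X e (k e) (k (σ e)) else 0 := by
  have hT := tensor_commute c Θ (multilinear_mul_comm_of_units c Θ h)
  let K := E → N
  let T : K × K → ℂ := fun x => Θ fun e => Matrix.single (x.2 e) (x.1 e) 1
  -- Seen as a matrix on multi-indices, `R (σ, κ)` is the projection to the colours `κ` followed by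
  -- the permutation `σ` of tensor factors. The theorem says that the coefficient matrix `T` is a
  -- combination of these.
  let R : Perm E × (E → C) → K × K → ℂ := fun p x =>
    if c ∘ x.2 = p.2 ∧ x.1 = x.2 ∘ p.1 then 1 else 0
  let 𝒜 : Submodule ℂ (K × K → ℂ) := Submodule.span ℂ (Set.range R)
  suffices hmem : T ∈ 𝒜 by
    obtain ⟨a, ha⟩ := (Submodule.mem_span_range_iff_exists_fun ℂ).1 hmem
    refine ⟨fun σ κ => a (σ, κ), fun X => ?_⟩
    rw [multilinear_matrix_expand]
    have h1 : ∀ l k : K, (Θ fun e => Matrix.single (k e) (l e) 1) =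
        ∑ σ, ∑ κ, a (σ, κ) * if c ∘ k = κ ∧ l = k ∘ σ then 1 else 0 := by
      intro l k
      have := congrFun ha (l, k)
      refine (show _ = T (l, k) from rfl).trans ?_
      rw [← this, Finset.sum_apply, Fintype.sum_prod_type]
      rfl
    simp_rw [h1, Finset.mul_sum]
    rw [Finset.sum_congr rfl fun l _ => Finset.sum_comm, Finset.sum_comm]
    refine Finset.sum_congr rfl fun σ _ => ?_
    rw [Finset.sum_congr rfl fun l _ => Finset.sum_comm, Finset.sum_comm]
    refine Finset.sum_congr rfl fun κ _ => ?_
    rw [Finset.sum_comm]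
    refine Finset.sum_congr rfl fun k _ => ?_
    by_cases hk : c ∘ k = κ
    · simp only [hk, true_and, if_true]
      rw [Finset.sum_eq_single (k ∘ σ)]
      · simp [mul_comm]
      · intro b _ hb
        simp [hb]
      · simp
    · simp [hk]
  -- Double commutant argument: `𝒜` is stable under left multiplication by permutations and colour
  -- projections and under their adjoints, so `P` commutes with these. Hence the column blocks of
  -- `P` are symmetric and colour preserving, and `T` commutes with them.
  obtain ⟨P, hP1, hP2, hP3⟩ := exists_orthogonal_projection 𝒜
  -- the two families of generators of `𝒜`, acting on the left
  let U : Perm E → (K × K → ℂ) →ₗ[ℂ] (K × K → ℂ) := fun σ =>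
    LinearMap.funLeft ℂ ℂ fun x => (x.1 ∘ σ, x.2)
  let V : (E → C) → (K × K → ℂ) →ₗ[ℂ] (K × K → ℂ) := fun κ =>
    { toFun := fun x y => if c ∘ y.1 = κ then x y else 0
      map_add' := fun x y => by ext z; by_cases hz : c ∘ z.1 = κ <;> simp [hz]
      map_smul' := fun t x => by ext z; by_cases hz : c ∘ z.1 = κ <;> simp [hz] }
  have hU𝒜 : ∀ σ, ∀ x ∈ 𝒜, U σ x ∈ 𝒜 := by
    intro σ x hx
    refine (Submodule.span_le (p := 𝒜.comap (U σ))).2 ?_ hx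
    rintro _ ⟨⟨τ, κ⟩, rfl⟩
    refine Submodule.subset_span ⟨(τ * σ⁻¹, κ), ?_⟩
    ext ⟨l, k⟩
    simp only [R, U, LinearMap.funLeft_apply]
    congr 2
    refine propext ⟨?_, ?_⟩
    · rintro rfl; ext e; simp
    · intro hh
      have : l = (l ∘ σ) ∘ ⇑σ⁻¹ := by ext e; simp
      rw [this, hh]; rfl
  have hV𝒜 : ∀ κ, ∀ x ∈ 𝒜, V κ x ∈ 𝒜 := by
    intro κ x hx
    refine (Submodule.span_le (p := 𝒜.comap (V κ))).2 ?_ hx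
    rintro _ ⟨⟨τ, κ'⟩, rfl⟩
    by_cases hκ : κ' ∘ τ = κ
    · refine Submodule.subset_span ⟨(τ, κ'), ?_⟩
      ext ⟨l, k⟩
      simp only [R, V, LinearMap.coe_mk, AddHom.coe_mk]
      by_cases h1 : c ∘ k = κ' ∧ l = k ∘ τ
      · have : c ∘ l = κ := by rw [h1.2, ← hκ, ← h1.1]; rfl
        simp [this]
      · simp [h1]
    · have : V κ (R (τ, κ')) = 0 := by
        ext ⟨l, k⟩
        simp only [R, V, LinearMap.coe_mk, AddHom.coe_mk, Pi.zero_apply]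
        by_cases h1 : c ∘ k = κ' ∧ l = k ∘ τ
        · have : c ∘ l ≠ κ := by
            rintro rfl; exact hκ (by rw [h1.2, ← h1.1]; rfl)
          simp [this]
        · simp [h1]
      simp [this]
  have hPU : ∀ σ x, P (U σ x) = U σ (P x) := by
    intro σ
    refine hP3 (U σ) (U σ⁻¹) (fun x y => ?_) (hU𝒜 σ) (hU𝒜 σ⁻¹)
    rw [← ((σ.arrowCongr (Equiv.refl N)).prodCongr (Equiv.refl K)).sum_comp]
    refine Finset.sum_congr rfl fun z _ => ?_
    congr 1
    change y _ = y _
    congr 1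
    refine Prod.ext ?_ rfl
    ext i
    simp
  have hPV : ∀ κ x, P (V κ x) = V κ (P x) := by
    intro κ
    refine hP3 (V κ) (V κ) (fun x y => ?_) (hV𝒜 κ) (hV𝒜 κ)
    refine Finset.sum_congr rfl fun z _ => ?_
    simp only [V, LinearMap.coe_mk, AddHom.coe_mk]
    split_ifs <;> simp
  -- the column blocks of `P`
  let S : K → K → K × K → ℂ := fun k j => Pi.single (k, j) 1
  let A : K → K → K → K → ℂ := fun j j' l k => P (S k j') (l, j)
  have hAσ : ∀ j j' (σ : Perm E) l k, A j j' (l ∘ σ) (k ∘ σ) = A j j' l k := by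
    intro j j' σ l k
    have h1 : S k j' = U σ (S (k ∘ σ) j') := by
      ext ⟨x, y⟩
      simp only [S, U, LinearMap.funLeft_apply, Pi.single_apply, Prod.mk.injEq]
      congr 2
      exact propext ⟨fun hh => by rw [hh], fun hh => σ.surjective.injective_comp_right hh⟩
    simp only [A]
    rw [h1, hPU]
    rfl
  have hAc : ∀ j j' l k, c ∘ l ≠ c ∘ k → A j j' l k = 0 := by
    intro j j' l k hlk
    have h1 : S k j' = V (c ∘ k) (S k j') := by
      ext ⟨x, y⟩
      simp only [S, V, LinearMap.coe_mk, AddHom.coe_mk, Pi.single_apply, Prod.mk.injEq]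
      by_cases hx : x = k <;> simp [hx]
    simp only [A]
    rw [h1, hPV]
    simp [V, hlk]
  have hone : P (∑ k, S k k) = ∑ k, S k k := by
    refine hP2 _ ?_
    have : ∑ k, S k k = ∑ κ : E → C, R (1, κ) := by
      ext ⟨l, k⟩
      simp only [Finset.sum_apply, S, R, Pi.single_apply, Prod.mk.injEq]
      by_cases hlk : l = k
      · subst hlk
        rw [Finset.sum_eq_single l (fun b _ hb => by simp [Ne.symm hb]) (by simp),
          Finset.sum_eq_single (c ∘ l) (fun b _ hb => by simp [Ne.symm hb]) (by simp)]
        simp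
      · rw [Finset.sum_eq_zero, Finset.sum_eq_zero]
        · intro κ _; simp [hlk]
        · intro x _
          rw [if_neg]
          rintro ⟨rfl, rfl⟩
          exact hlk rfl
    rw [this]
    exact Submodule.sum_mem _ fun κ _ => Submodule.subset_span ⟨_, rfl⟩
  -- As the blocks of `P` commute with `T`, the value `P T` is the product of `T` with the image
  -- under `P` of the identity matrix, which `P` fixes.
  have hTP : P T = T := by
    have hTS : T = ∑ k, ∑ l, T (l, k) • S l k := by
      ext ⟨l, k⟩
      simp only [Finset.sum_apply, Pi.smul_apply, S, Pi.single_apply, Prod.mk.injEq, smul_eq_mul]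
      rw [Finset.sum_eq_single k (fun b _ hb => by simp [Ne.symm hb]) (by simp),
        Finset.sum_eq_single l (fun b _ hb => by simp [Ne.symm hb]) (by simp)]
      simp
    ext ⟨l, j⟩
    conv_lhs => rw [hTS]
    have h1 : P (∑ k, ∑ l, T (l, k) • S l k) (l, j) = ∑ k, ∑ r, A j k l r * T (r, k) := by
      simp only [map_sum, map_smul, Finset.sum_apply, Pi.smul_apply, smul_eq_mul, A]
      exact Finset.sum_congr rfl fun _ _ => Finset.sum_congr rfl fun _ _ => mul_comm _ _
    have h2 : ∀ k, ∑ r, A j k l r * T (r, k) = ∑ r, A j k r k * T (l, r) :=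
      fun k => (hT (A j k) (hAσ j k) (hAc j k) l k).symm
    have h3 : ∀ r, ∑ k, A j k r k = if r = j then 1 else 0 := by
      intro r
      have := congrFun hone (r, j)
      rw [map_sum, Finset.sum_apply, Finset.sum_apply] at this
      simp only [A]
      rw [this]
      simp only [S, Pi.single_apply, Prod.mk.injEq]
      by_cases hrj : r = j
      · subst hrj
        rw [Finset.sum_eq_single r (fun b _ hb => by simp [Ne.symm hb]) (by simp)]
        simp
      · rw [Finset.sum_eq_zero, if_neg hrj]
        intro x _
        rw [if_neg]
        rintro ⟨rfl, rfl⟩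
        exact hrj rfl
    rw [h1, Finset.sum_congr rfl fun k _ => h2 k, Finset.sum_comm]
    simp_rw [← Finset.sum_mul, h3, ite_mul, one_mul, zero_mul]
    simp
  rw [← hTP]
  exact hP1 T

end FFT

/-! ### Contractions of matrices along permutations -/

section Contraction

variable {N E E' : Type*} [Fintype N] [Fintype E] [Fintype E']

/-- The full contraction of a family of matrices along a permutation: the column index of the
matrix at `e` is paired with the row index of the matrix at `σ e`. -/
def contraction [DecidableEq E] (σ : Perm E) (Y : E → Matrix N N ℂ) : ℂ :=
  ∑ k : E → N, ∏ e, Y e (k e) (k (σ e))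

theorem contraction_permCongr [DecidableEq E] [DecidableEq E'] (ε : E ≃ E') (σ : Perm E)
    (Y : E → Matrix N N ℂ) :
    contraction (ε.permCongr σ) (Y ∘ ε.symm) = contraction σ Y := by
  unfold contraction
  rw [← (ε.arrowCongr (Equiv.refl N)).sum_comp]
  refine Finset.sum_congr rfl fun k _ => ?_
  rw [← ε.prod_comp]
  simp

variable [DecidableEq E]

/-- A fixed point of the permutation pairs the row and the column index of one matrix, so it splits
off as a trace. -/
theorem contraction_option_of_fixed (σ : Perm (Option E)) (hσ : σ none = none)
    (Y : Option E → Matrix N N ℂ) :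
    contraction σ Y = (Y none).trace * contraction (Equiv.removeNone σ) (Y ∘ some) := by
  have hs : ∀ e, σ (some e) = some (Equiv.removeNone σ e) := by
    intro e
    refine (Equiv.removeNone_some σ ?_).symm
    refine Option.ne_none_iff_exists'.1 fun h => ?_
    simpa using σ.injective (h.trans hσ.symm)
  unfold contraction
  rw [← (Equiv.piOptionEquivProd (β := fun _ : Option E => N)).symm.sum_comp,
    Fintype.sum_prod_type, Matrix.trace, Finset.sum_mul]
  refine Finset.sum_congr rfl fun n _ => ?_
  rw [Finset.mul_sum]
  refine Finset.sum_congr rfl fun k _ => ?_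
  rw [Fintype.prod_option]
  simp [hσ, hs, Equiv.piOptionEquivProd]

/-- The only factors involving the index at `none` are the matrices at `p` and at `none`; summing
over it multiplies them, and `p` inherits the successor of `none`. -/
theorem contraction_option_of_pred (σ : Perm (Option E)) (p : E) (hp : σ (some p) = none)
    (Y : Option E → Matrix N N ℂ) :
    contraction σ Y = contraction (Equiv.removeNone σ)
      (Function.update (Y ∘ some) p (Y (some p) * Y none)) := by
  have hs : ∀ e, e ≠ p → σ (some e) = some (Equiv.removeNone σ e) := by
    intro e he
    refine (Equiv.removeNone_some σ ?_).symm
    refine Option.ne_none_iff_exists'.1 fun h => he ?_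
    simpa using σ.injective (h.trans hp.symm)
  have hn : σ none = some (Equiv.removeNone σ p) := (Equiv.removeNone_none σ hp).symm
  unfold contraction
  rw [← (Equiv.piOptionEquivProd (β := fun _ : Option E => N)).symm.sum_comp,
    Fintype.sum_prod_type, Finset.sum_comm]
  refine Finset.sum_congr rfl fun k _ => ?_
  rw [← Finset.mul_prod_erase _ _ (Finset.mem_univ p), Function.update_self, Matrix.mul_apply,
    Finset.sum_mul]
  refine Finset.sum_congr rfl fun n _ => ?_
  rw [Fintype.prod_option, ← Finset.mul_prod_erase _ _ (Finset.mem_univ p), ← mul_assoc]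
  congr 1
  · simp [hn, hp, Equiv.piOptionEquivProd, mul_comm]
  · refine Finset.prod_congr rfl fun e he => ?_
    have he' := Finset.ne_of_mem_erase he
    simp [hs e he', Function.update_of_ne he', Equiv.piOptionEquivProd]

/-- Prescribing the colours of the indices amounts to inserting colour projections. -/
theorem sum_colored_eq_contraction {C : Type*} [DecidableEq C] [DecidableEq N] (c : N → C)
    (κ : E → C) (σ : Perm E) (X : E → Matrix N N ℂ) :
    (∑ k : E → N, if c ∘ k = κ then ∏ e, X e (k e) (k (σ e)) else 0) =
      contraction σ fun e => X e * Matrix.diagonal fun n => if c n = κ (σ e) then 1 else 0 := by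
  unfold contraction
  refine Finset.sum_congr rfl fun k _ => ?_
  simp only [Matrix.mul_diagonal]
  split_ifs with h
  · refine Finset.prod_congr rfl fun e _ => ?_
    have : c (k (σ e)) = κ (σ e) := congrFun h (σ e)
    simp [this]
  · obtain ⟨e, he⟩ := Function.ne_iff.1 h
    -- The index at `e` is the column index of the matrix at `σ⁻¹ e`, where the inserted projection
    -- kills the term.
    refine (Finset.prod_eq_zero (Finset.mem_univ (σ⁻¹ e)) ?_).symm
    rw [if_neg, mul_zero]
    simpa using he

end Contraction

/-! ### Operators, vectors and covectors as matrices with one additional index -/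

section Items

variable {N : Type*}

/-- A matrix extended by zero to the indices with one additional element. -/
def opMatrix (M : Matrix N N ℂ) : Matrix (Option N) (Option N) ℂ :=
  fun x y => x.elim 0 fun k => y.elim 0 fun l => M k l

/-- A vector as the column with the additional index. -/
def colMatrix (u : N → ℂ) : Matrix (Option N) (Option N) ℂ :=
  fun x y => x.elim 0 fun k => y.elim (u k) fun _ => 0

/-- A covector as the row with the additional index. -/
def rowMatrix (w : N → ℂ) : Matrix (Option N) (Option N) ℂ :=
  fun x y => x.elim (y.elim 0 w) fun _ => 0

variable [Fintype N]

theorem opMatrix_mul_opMatrix (M M' : Matrix N N ℂ) :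
    opMatrix M * opMatrix M' = opMatrix (M * M') := by
  ext (_ | k) (_ | l) <;> simp [Matrix.mul_apply, opMatrix]

/-- The column index of a vector is the additional one, on which operators vanish: in a nonzero
contraction no operator follows a vector. -/
theorem colMatrix_mul_opMatrix (u : N → ℂ) (M : Matrix N N ℂ) :
    colMatrix u * opMatrix M = 0 := by
  ext (_ | k) (_ | l) <;> simp [Matrix.mul_apply, opMatrix, colMatrix]

theorem rowMatrix_mul_opMatrix (w : N → ℂ) (M : Matrix N N ℂ) :
    rowMatrix w * opMatrix M = rowMatrix (Matrix.vecMul w M) := by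
  ext (_ | k) (_ | l) <;>
    simp [Matrix.mul_apply, opMatrix, rowMatrix, Matrix.vecMul, dotProduct]

theorem trace_opMatrix (M : Matrix N N ℂ) : (opMatrix M).trace = M.trace := by
  simp [Matrix.trace, opMatrix]

variable {A B : Type*} [Fintype A] [Fintype B] [DecidableEq A] [DecidableEq B]

/-- The contraction of vectors and covectors is a product of pairings or vanishes identically. -/
theorem contraction_col_row (σ : Perm (A ⊕ B)) :
    (∃ β : B ≃ A, ∀ (t : A → ℂ) (u : A → N → ℂ) (w : B → N → ℂ),
      contraction σ (Sum.elim (fun a => t a • colMatrix (u a)) fun b => rowMatrix (w b)) =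
        (∏ a, t a) * ∏ b, w b ⬝ᵥ u (β b)) ∨
    ∀ (t : A → ℂ) (u : A → N → ℂ) (w : B → N → ℂ),
      contraction σ (Sum.elim (fun a => t a • colMatrix (u a)) fun b => rowMatrix (w b)) = 0 := by
  -- A vector following a vector would need one index to be both additional (a column index) and
  -- ordinary (a row index); dually for two covectors below.
  by_cases HA : ∃ a a', σ (.inl a) = .inl a'
  · right
    obtain ⟨a, a', h⟩ := HA
    intro t u w
    refine Finset.sum_eq_zero fun k _ => ?_
    cases hk : k (.inl a') with
    | none => exact Finset.prod_eq_zero (Finset.mem_univ (.inl a')) (by simp [hk, colMatrix])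
    | some n =>
      refine Finset.prod_eq_zero (Finset.mem_univ (.inl a)) ?_
      cases k (.inl a) <;> simp [h, hk, colMatrix]
  by_cases HB : ∃ b b', σ (.inr b) = .inr b'
  · right
    obtain ⟨b, b', h⟩ := HB
    intro t u w
    refine Finset.sum_eq_zero fun k _ => ?_
    cases hk : k (.inr b') with
    | none =>
      refine Finset.prod_eq_zero (Finset.mem_univ (.inr b)) ?_
      cases k (.inr b) <;> simp [h, hk, rowMatrix]
    | some n => exact Finset.prod_eq_zero (Finset.mem_univ (.inr b')) (by simp [hk, rowMatrix])
  left
  have hA : ∀ a, ∃ b, σ (.inl a) = .inr b := fun a => by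
    cases h : σ (.inl a) with
    | inl a' => exact absurd ⟨a, a', h⟩ HA
    | inr b => exact ⟨b, rfl⟩
  have hB : ∀ b, ∃ a, σ (.inr b) = .inl a := fun b => by
    cases h : σ (.inr b) with
    | inr b' => exact absurd ⟨b, b', h⟩ HB
    | inl a => exact ⟨a, rfl⟩
  choose fa hfa using hA
  choose fb hfb using hB
  have hinj : Function.Injective fb := fun b b' h =>
    Sum.inr_injective (σ.injective ((hfb b).trans ((congrArg _ h).trans (hfb b').symm)))
  have hsurj : Function.Surjective fb := fun a => by
    cases h : σ.symm (.inl a) with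
    | inl a' => exact absurd ⟨a', a, by rw [← h, Equiv.apply_symm_apply]⟩ HA
    | inr b => exact ⟨b, Sum.inl_injective (by rw [← hfb, ← h, Equiv.apply_symm_apply])⟩
  let β : B ≃ A := Equiv.ofBijective fb ⟨hinj, hsurj⟩
  refine ⟨β, fun t u w => ?_⟩
  unfold contraction
  -- Nonzero terms have an ordinary index at every vector and the additional index at every
  -- covector, so only the ordinary indices `n` of the vectors are summed.
  rw [← Fintype.sum_of_injective (fun n : A → N => (Sum.elim (fun a => some (n a)) fun _ => none :
      A ⊕ B → Option N)) ?_ (fun n => (∏ a, t a * u a (n a)) * ∏ b, w b (n (β b))) _ ?_ ?_]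
  · have h1 : ∀ n : A → N, (∏ a, t a * u a (n a)) * ∏ b, w b (n (β b)) =
        (∏ a, t a) * ∏ b, w b (n (β b)) * u (β b) (n (β b)) := by
      intro n
      rw [Finset.prod_mul_distrib, Finset.prod_mul_distrib, β.prod_comp fun a => u a (n a)]
      ring
    simp_rw [h1, ← Finset.mul_sum, dotProduct, Finset.prod_univ_sum, Fintype.piFinset_univ]
    congr 1
    exact (β.symm.arrowCongr (Equiv.refl N)).sum_comp
      fun n : B → N => ∏ b, w b (n b) * u (β b) (n b)
  · intro n n' h
    ext a
    simpa using congrFun h (.inl a)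
  · intro k hk
    by_contra hne
    refine hk ?_
    replace hne := Finset.prod_ne_zero_iff.1 hne
    have h1 : ∀ b, k (.inr b) = none := by
      intro b
      have := hne (.inr b) (Finset.mem_univ _)
      cases h : k (.inr b) with
      | none => rfl
      | some n => simp [h, rowMatrix] at this
    have h2 : ∀ a, ∃ n, k (.inl a) = some n := by
      intro a
      have := hne (.inl a) (Finset.mem_univ _)
      cases h : k (.inl a) with
      | none => simp [h, colMatrix] at this
      | some n => exact ⟨n, rfl⟩
    choose n hn using h2
    exact ⟨n, by ext1 (a | b) <;> simp [hn, h1]⟩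
  · intro n
    rw [Fintype.prod_sum_type]
    simp only [Sum.elim_inl, Sum.elim_inr, hfa, hfb]
    have hβ : ∀ b, β b = fb b := fun _ => rfl
    simp [colMatrix, rowMatrix, hβ]

/-- Moving the additional element of a summand out of a sum. -/
def optionSumEquiv (α R : Type*) : Option α ⊕ R ≃ Option (α ⊕ R) where
  toFun x := x.elim (fun o => o.map Sum.inl) fun r => some (Sum.inr r)
  invFun x := x.elim (Sum.inl none) fun y => y.map some id
  left_inv := by rintro ((_ | a) | r) <;> rfl
  right_inv := by rintro (_ | (a | r)) <;> rfl

/-- The operators in a contraction can be absorbed into traces and into the covectors. -/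
theorem contraction_eliminate {S : Type*} (𝒲 : Set (S → Matrix N N ℂ))
    (hmul : ∀ W ∈ 𝒲, ∀ W' ∈ 𝒲, (fun s => W s * W' s) ∈ 𝒲) (𝓘 : Subalgebra ℂ (S → ℂ))
    (htr : ∀ W ∈ 𝒲, (fun s => (W s).trace) ∈ 𝓘) (Op : Type) [Finite Op] :
    ∀ [Fintype Op] [DecidableEq Op] (σ : Perm (Op ⊕ (A ⊕ B))) (Y : Op → S → Matrix N N ℂ) (_ : ∀ o, Y o ∈ 𝒲)
      (W : B → S → Matrix N N ℂ) (_ : ∀ b, W b ∈ 𝒲),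
      ∃ q ∈ 𝓘, ∃ (σ' : Perm (A ⊕ B)) (W' : B → S → Matrix N N ℂ), (∀ b, W' b ∈ 𝒲) ∧
        ∀ s (t : A → ℂ) (u : A → N → ℂ) (w : B → N → ℂ),
          contraction σ (Sum.elim (fun o => opMatrix (Y o s)) (Sum.elim
            (fun a => t a • colMatrix (u a)) fun b => rowMatrix (Matrix.vecMul (w b) (W b s)))) =
          q s * contraction σ' (Sum.elim (fun a => t a • colMatrix (u a))
            fun b => rowMatrix (Matrix.vecMul (w b) (W' b s))) := by
  induction Op using Finite.induction_empty_option with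
  | @of_equiv α β ε ih =>
    intro _ _ σ Y hY W hW
    classical
    let : Fintype α := Fintype.ofEquiv β ε.symm
    obtain ⟨q, hq, σ', W', hW', h⟩ := ih ((ε.symm.sumCongr (Equiv.refl (A ⊕ B))).permCongr σ)
      (Y ∘ ε) (fun o => hY _) W hW
    refine ⟨q, hq, σ', W', hW', fun s t u w => ?_⟩
    rw [← h, ← contraction_permCongr (ε.symm.sumCongr (Equiv.refl (A ⊕ B))) σ]
    congr 1
    ext1 (o | r) <;> rfl
  | h_empty =>
    intro _ _ σ Y hY W hW
    refine ⟨1, 𝓘.one_mem, (Equiv.emptySum PEmpty (A ⊕ B)).permCongr σ, W, hW, fun s t u w => ?_⟩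
    rw [← contraction_permCongr (Equiv.emptySum PEmpty (A ⊕ B)) σ, Pi.one_apply, one_mul]
    rfl
  | @h_option α _ ih =>
    intro _ _ σ Y hY W hW
    classical
    set σ₂ := (optionSumEquiv α (A ⊕ B)).permCongr σ with hσ₂
    have key : ∀ (s : S) (t : A → ℂ) (u : A → N → ℂ) (w : B → N → ℂ), contraction σ (Sum.elim (fun o => opMatrix (Y o s)) (Sum.elim
        (fun a => t a • colMatrix (u a)) fun b => rowMatrix (Matrix.vecMul (w b) (W b s)))) =
        contraction σ₂ (fun x => x.elim (opMatrix (Y none s)) (Sum.elim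
          (fun o => opMatrix (Y (some o) s)) (Sum.elim
          (fun a => t a • colMatrix (u a)) fun b => rowMatrix (Matrix.vecMul (w b) (W b s))))) := by
      intro s t u w
      rw [← contraction_permCongr (optionSumEquiv α (A ⊕ B)) σ]
      congr 1
      ext1 (_ | (o | r)) <;> rfl
    -- The operator at `none` is removed according to its predecessor: itself (a trace), an operator
    -- (a product), a vector (zero), or a covector (absorbed).
    cases hp : σ₂.symm none with
    | none =>
      obtain ⟨q, hq, σ', W', hW', h⟩ := ih (Equiv.removeNone σ₂) (fun o => Y (some o))
        (fun o => hY _) W hW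
      refine ⟨_, 𝓘.mul_mem (htr _ (hY none)) hq, σ', W', hW', fun s t u w => ?_⟩
      rw [key, contraction_option_of_fixed σ₂ (σ₂.symm_apply_eq.1 hp).symm]
      rw [Pi.mul_apply, mul_assoc, ← h s t u w]
      simp only [Option.elim_none, trace_opMatrix]
      rfl
    | some x =>
      have hx : σ₂ (some x) = none := by rw [← hp, Equiv.apply_symm_apply]
      rcases x with o | a | b
      · obtain ⟨q, hq, σ', W', hW', h⟩ := ih (Equiv.removeNone σ₂)
          (Function.update (fun o => Y (some o)) o fun s => Y (some o) s * Y none s)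
          (fun o' => by
            by_cases ho : o' = o
            · subst ho; simpa using hmul _ (hY _) _ (hY _)
            · simpa [ho] using hY _) W hW
        refine ⟨q, hq, σ', W', hW', fun s t u w => ?_⟩
        rw [key, contraction_option_of_pred σ₂ _ hx, ← h]
        congr 1
        ext1 (o' | r)
        · by_cases ho : o' = o
          · subst ho; simp [opMatrix_mul_opMatrix]
          · simp [ho]
        · simp
      · refine ⟨0, 𝓘.zero_mem, 1, W, hW, fun s t u w => ?_⟩
        rw [key, contraction_option_of_pred σ₂ _ hx, Pi.zero_apply, zero_mul]
        refine Finset.sum_eq_zero fun k _ =>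
          Finset.prod_eq_zero (Finset.mem_univ (.inr (.inl a))) ?_
        simp [colMatrix_mul_opMatrix]
      · obtain ⟨q, hq, σ', W', hW', h⟩ := ih (Equiv.removeNone σ₂) (fun o => Y (some o))
          (fun o => hY _) (Function.update W b fun s => W b s * Y none s)
          (fun b' => by
            by_cases hb : b' = b
            · subst hb; simpa using hmul _ (hW _) _ (hY _)
            · simpa [hb] using hW _)
        refine ⟨q, hq, σ', W', hW', fun s t u w => ?_⟩
        rw [key, contraction_option_of_pred σ₂ _ hx, ← h]
        congr 1
        ext1 (o' | a | b')
        · simp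
        · simp
        · by_cases hb : b' = b
          · subst hb; simp [rowMatrix_mul_opMatrix]
          · simp [hb]

variable {I : Type*} [DecidableEq I] [DecidableEq N]

/-- The projection to the indices of a given colour, zero for the additional colour. -/
def colorProj (c : N → I) (x : Option I) : Matrix N N ℂ :=
  Matrix.diagonal fun n => if some (c n) = x then 1 else 0

/-- A coloured contraction of operators, vectors and covectors is the product of a scalar function
and of pairings, or vanishes identically. -/
theorem colored_contraction_eq {S : Type*} (c : N → I) (𝒲 : Set (S → Matrix N N ℂ))
    (hmul : ∀ W ∈ 𝒲, ∀ W' ∈ 𝒲, (fun s => W s * W' s) ∈ 𝒲)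
    (hproj : ∀ x, (fun _ => colorProj c x) ∈ 𝒲) (𝓘 : Subalgebra ℂ (S → ℂ))
    (htr : ∀ W ∈ 𝒲, (fun s => (W s).trace) ∈ 𝓘) {Op : Type} [Fintype Op] [DecidableEq Op]
    (Y : Op → S → Matrix N N ℂ) (hY : ∀ o, Y o ∈ 𝒲) (σ : Perm (Op ⊕ (A ⊕ B)))
    (κ : Op ⊕ (A ⊕ B) → Option I) :
    (∀ s (u : A → N → ℂ) (w : B → N → ℂ), (∑ k : Op ⊕ (A ⊕ B) → Option N,
      if Option.map c ∘ k = κ then ∏ e, Sum.elim (fun o => opMatrix (Y o s)) (Sum.elim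
        (fun a => colMatrix (u a)) fun b => rowMatrix (w b)) e (k e) (k (σ e)) else 0) = 0) ∨
    ∃ q ∈ 𝓘, ∃ (β : B ≃ A) (W : B → S → Matrix N N ℂ), (∀ b, W b ∈ 𝒲) ∧
      ∀ s (u : A → N → ℂ) (w : B → N → ℂ), (∑ k : Op ⊕ (A ⊕ B) → Option N,
        if Option.map c ∘ k = κ then ∏ e, Sum.elim (fun o => opMatrix (Y o s)) (Sum.elim
          (fun a => colMatrix (u a)) fun b => rowMatrix (w b)) e (k e) (k (σ e)) else 0) =
        q s * ∏ b, w b ⬝ᵥ Matrix.mulVec (W b s) (u (β b)) := by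
  -- The column index of a vector is the additional one, of colour `none`; there the inserted colour
  -- projection reduces to this scalar.
  let t : A → ℂ := fun a => if κ (σ (.inr (.inl a))) = none then 1 else 0
  obtain ⟨q, hq, σ', W, hW, h⟩ := contraction_eliminate (A := A) (B := B) 𝒲 hmul 𝓘 htr Op σ
    (fun o s => Y o s * colorProj c (κ (σ (.inl o)))) (fun o => hmul _ (hY o) _ (hproj _))
    (fun b _ => colorProj c (κ (σ (.inr (.inr b))))) (fun b => hproj _)
  have key : ∀ s (u : A → N → ℂ) (w : B → N → ℂ), (∑ k : Op ⊕ (A ⊕ B) → Option N,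
      if Option.map c ∘ k = κ then ∏ e, Sum.elim (fun o => opMatrix (Y o s)) (Sum.elim
        (fun a => colMatrix (u a)) fun b => rowMatrix (w b)) e (k e) (k (σ e)) else 0) =
      q s * contraction σ' (Sum.elim (fun a => t a • colMatrix (u a))
        fun b => rowMatrix (Matrix.vecMul (w b) (W b s))) := by
    intro s u w
    rw [sum_colored_eq_contraction, ← h]
    congr 1
    ext1 (o | a | b)
    · ext (_ | k) (_ | l) <;> simp [opMatrix, colorProj]
    · by_cases hx : κ (σ (.inr (.inl a))) = none
      · ext (_ | k) (_ | l) <;> simp [colMatrix, t, hx]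
      · ext (_ | k) (_ | l) <;> simp [colMatrix, t, hx, Ne.symm hx]
    · ext (_ | k) (_ | l) <;> simp [rowMatrix, colorProj, Matrix.vecMul_diagonal]
  rcases contraction_col_row (N := N) σ' with ⟨β, hβ⟩ | h0
  · right
    refine ⟨fun s => (∏ a, t a) * q s, ?_, β, W, hW, fun s u w => ?_⟩
    · exact 𝓘.smul_mem hq (∏ a, t a)
    · rw [key, hβ]
      simp only [← Matrix.dotProduct_mulVec]
      ring
  · left
    intro s u w
    rw [key, h0, mul_zero]

end Items

/-! ### The determinants are semi-invariant polynomials -/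

section Easy

universe uI uH uV uD

variable {I : Type uI} {H : Type uH} {Q : DoubleQuiver I H}
  {V : I → Type uV} [∀ i, AddCommGroup (V i)] [∀ i, Module ℂ (V i)]
  {D : I → Type uD} [∀ i, AddCommGroup (D i)] [∀ i, Module ℂ (D i)]

theorem BPath.eval_act (g : GV V) (s : Rep Q V D) {i j : I} (p : BPath Q i j) :
    p.eval (act g s) = (g j).toLinearMap ∘ₗ p.eval s ∘ₗ (g i).symm.toLinearMap := by
  induction p with
  | nil => ext x; simp [BPath.eval]
  | arrow h p ih => rw [BPath.eval, ih]; ext x; simp [BPath.eval, act]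
  | loop p ih => rw [BPath.eval, ih]; ext x; simp [BPath.eval, act]

namespace BPathAlg

variable (s : Rep Q V D) {i j k : I}

theorem eval_eq_linearCombination (x : BPathAlg Q i j) :
    x.eval s = Finsupp.linearCombination ℂ (fun p : BPath Q i j => p.eval s) x := rfl

@[simp] theorem eval_zero : (0 : BPathAlg Q i j).eval s = 0 := by
  simp [eval_eq_linearCombination]

theorem eval_add (x y : BPathAlg Q i j) : (x + y).eval s = x.eval s + y.eval s := by
  simp [eval_eq_linearCombination]

theorem eval_smul (c : ℂ) (x : BPathAlg Q i j) : (c • x).eval s = c • x.eval s := by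
  simp [eval_eq_linearCombination]

theorem eval_single (p : BPath Q i j) : eval s (Finsupp.single p 1) = p.eval s := by
  simp [eval_eq_linearCombination]

theorem eval_sum {ι : Type*} (t : Finset ι) (x : ι → BPathAlg Q i j) :
    (∑ a ∈ t, x a).eval s = ∑ a ∈ t, (x a).eval s := by
  simp [eval_eq_linearCombination]

theorem eval_act (g : GV V) (x : BPathAlg Q i j) :
    x.eval (act g s) = (g j).toLinearMap ∘ₗ x.eval s ∘ₗ (g i).symm.toLinearMap := by
  induction x using Finsupp.induction_linear with
  | zero => simp
  | add x y hx hy => rw [eval_add, hx, hy, eval_add]; ext; simp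
  | single p c =>
    rw [← mul_one c, ← smul_eq_mul, ← Finsupp.smul_single, eval_smul, eval_smul, eval_single,
      eval_single, BPath.eval_act]
    ext; simp

end BPathAlg

/-- Families of linear maps with polynomial matrix coefficients. -/
def IsPolyHom {X Y : Type*} [AddCommGroup X] [Module ℂ X] [AddCommGroup Y] [Module ℂ Y]
    (F : Rep Q V D → X →ₗ[ℂ] Y) : Prop :=
  ∀ (w : Module.Dual ℂ Y) (u : X), (fun s => w (F s u)) ∈ polyFun Q V D

theorem dual_mem_polyFun (φ : Module.Dual ℂ (Rep Q V D)) :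
    (φ : Rep Q V D → ℂ) ∈ polyFun Q V D :=
  Algebra.subset_adjoin ⟨φ, rfl⟩

theorem IsPolyHom.comp {X Y Z : Type*} [AddCommGroup X] [Module ℂ X] [AddCommGroup Y] [Module ℂ Y]
    [AddCommGroup Z] [Module ℂ Z] [FiniteDimensional ℂ Y] {F : Rep Q V D → X →ₗ[ℂ] Y}
    {G : Rep Q V D → Y →ₗ[ℂ] Z} (hG : IsPolyHom G) (hF : IsPolyHom F) :
    IsPolyHom fun s => G s ∘ₗ F s := by
  intro w u
  let b := Module.finBasis ℂ Y
  have : (fun s => w ((G s ∘ₗ F s) u)) =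
      ∑ r, (fun s => b.coord r (F s u)) * fun s => w (G s (b r)) := by
    ext s
    conv_lhs => rw [LinearMap.comp_apply, ← b.sum_repr (F s u)]
    rw [map_sum, map_sum, Finset.sum_apply]
    simp
  rw [this]
  exact Subalgebra.sum_mem _ fun r _ => mul_mem (hF _ _) (hG _ _)

theorem isPolyHom_of_linear {X Y : Type*} [AddCommGroup X] [Module ℂ X] [AddCommGroup Y]
    [Module ℂ Y] (F : Rep Q V D →ₗ[ℂ] X →ₗ[ℂ] Y) : IsPolyHom fun s => F s := by
  intro w u
  exact dual_mem_polyFun (w ∘ₗ (LinearMap.applyₗ u) ∘ₗ F)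

theorem isPolyHom_arrow (h : H) : IsPolyHom fun s : Rep Q V D => s.1 h :=
  isPolyHom_of_linear
    { toFun := fun s => s.1 h, map_add' := fun _ _ => rfl, map_smul' := fun _ _ => rfl }

theorem isPolyHom_gamma (i : I) : IsPolyHom fun s : Rep Q V D => s.2.1 i :=
  isPolyHom_of_linear
    { toFun := fun s => s.2.1 i, map_add' := fun _ _ => rfl, map_smul' := fun _ _ => rfl }

theorem isPolyHom_delta (i : I) : IsPolyHom fun s : Rep Q V D => s.2.2 i :=
  isPolyHom_of_linear
    { toFun := fun s => s.2.2 i, map_add' := fun _ _ => rfl, map_smul' := fun _ _ => rfl }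

theorem isPolyHom_const {X Y : Type*} [AddCommGroup X] [Module ℂ X] [AddCommGroup Y]
    [Module ℂ Y] (F : X →ₗ[ℂ] Y) : IsPolyHom fun _ : Rep Q V D => F :=
  fun w u => Subalgebra.algebraMap_mem _ (w (F u))

variable [∀ i, FiniteDimensional ℂ (V i)] [∀ i, FiniteDimensional ℂ (D i)]

theorem isPolyHom_path {i j : I} (p : BPath Q i j) : IsPolyHom fun s : Rep Q V D => p.eval s := by
  induction p with
  | nil => simpa only [BPath.eval] using isPolyHom_const _
  | arrow h p ih => simpa only [BPath.eval] using (isPolyHom_arrow h).comp ih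
  | loop p ih =>
    simpa only [BPath.eval] using ((isPolyHom_gamma _).comp (isPolyHom_delta _)).comp ih

theorem isPolyHom_pathAlg {i j : I} (x : BPathAlg Q i j) :
    IsPolyHom fun s : Rep Q V D => x.eval s := by
  intro w u
  induction x using Finsupp.induction_linear with
  | zero =>
    have : (fun s : Rep Q V D => w ((0 : BPathAlg Q i j).eval s u)) = 0 := by ext s; simp
    exact this ▸ (polyFun Q V D).zero_mem
  | add x y hx hy =>
    have : (fun s : Rep Q V D => w (BPathAlg.eval s (x + y) u)) =
        (fun s => w (BPathAlg.eval s x u)) + fun s => w (BPathAlg.eval s y u) := by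
      ext s; simp [BPathAlg.eval_add]
    rw [this]
    exact add_mem hx hy
  | single p c =>
    have : (fun s : Rep Q V D => w (BPathAlg.eval s (Finsupp.single p c) u)) =
        c • fun s : Rep Q V D => w (p.eval s u) := by
      ext s; simp [BPathAlg.eval_eq_linearCombination]
    rw [this]
    exact Subalgebra.smul_mem _ (isPolyHom_path p w u) c

namespace ChiData

variable [Fintype I] {m : I → ℤ} (Δ : ChiData Q V D m)

/-- The standard basis of the space `Y`. -/
def basisY : Module.Basis ((Σ p : Σ i, Fin (Δ.mNeg i), Fin (Module.finrank ℂ (V p.1))) ⊕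
    Fin Δ.nNeg) ℂ Δ.Y :=
  (Pi.basis fun p : Σ i, Fin (Δ.mNeg i) => Module.finBasis ℂ (V p.1)).prod (Pi.basisFun ℂ _)

/-- The standard basis of the space `Z`. -/
def basisZ : Module.Basis ((Σ q : Σ j, Fin (Δ.mPos j), Fin (Module.finrank ℂ (V q.1))) ⊕
    Fin Δ.nPos) ℂ Δ.Z :=
  (Pi.basis fun q : Σ j, Fin (Δ.mPos j) => Module.finBasis ℂ (V q.1)).prod (Pi.basisFun ℂ _)

/-- The matrix of `Ψ_Δ(s)` in the standard bases. -/
def matrixΨ (s : Rep Q V D) :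
    Matrix ((Σ q : Σ j, Fin (Δ.mPos j), Fin (Module.finrank ℂ (V q.1))) ⊕ Fin Δ.nPos)
      ((Σ p : Σ i, Fin (Δ.mNeg i), Fin (Module.finrank ℂ (V p.1))) ⊕ Fin Δ.nNeg) ℂ :=
  Matrix.fromBlocks
    (fun q p => (Module.finBasis ℂ (V q.1.1)).coord q.2
      ((Δ.αVV p.1 q.1).eval s (Module.finBasis ℂ (V p.1.1) p.2)))
    (fun q l => (Module.finBasis ℂ (V q.1.1)).coord q.2
      ((Δ.αaV l q.1).eval s (s.2.1 (Δ.Ia l) (Δ.a l))))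
    (fun l' p => Δ.b l' (s.2.2 (Δ.Ib l') ((Δ.αVb p.1 l').eval s
      (Module.finBasis ℂ (V p.1.1) p.2))))
    (fun l' l => Δ.b l' (s.2.2 (Δ.Ib l') ((Δ.αab l l').eval s (s.2.1 (Δ.Ia l) (Δ.a l)))))

theorem sum_apply_single {ι : Type*} [Fintype ι] [DecidableEq ι] {X : ι → Type*}
    [∀ p, AddCommGroup (X p)] {M : Type*} [AddCommGroup M] (F : (p : ι) → X p → M)
    (hF : ∀ p, F p 0 = 0) (p : ι) (x : X p) : ∑ p', F p' (Pi.single p x p') = F p x := by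
  rw [Finset.sum_eq_single p]
  · simp
  · intro p' _ hp'
    rw [Pi.single_eq_of_ne hp', hF]
  · simp

theorem toMatrix_Ψ [DecidableEq I] (s : Rep Q V D) :
    LinearMap.toMatrix Δ.basisY Δ.basisZ (Δ.Ψ s) = Δ.matrixΨ s := by
  ext (⟨q, r⟩ | l') (⟨p, r'⟩ | l)
  · rw [LinearMap.toMatrix_apply]
    have h1 : Δ.basisY (.inl ⟨p, r'⟩) = (Pi.single p (Module.finBasis ℂ (V p.1) r'), 0) := by
      simp [basisY]
    rw [h1]
    have := sum_apply_single (fun p x => (Δ.αVV p q).eval s x) (fun p => map_zero _) p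
      (Module.finBasis ℂ (V p.1) r')
    simp [basisZ, matrixΨ, Ψ, this]
    rfl
  · rw [LinearMap.toMatrix_apply]
    have h1 : Δ.basisY (.inr l) = (0, Pi.single l 1) := by
      simp [basisY]
    rw [h1]
    simp [basisZ, matrixΨ, Ψ, Pi.single_apply]
    rfl
  · rw [LinearMap.toMatrix_apply]
    have h1 : Δ.basisY (.inl ⟨p, r'⟩) = (Pi.single p (Module.finBasis ℂ (V p.1) r'), 0) := by
      simp [basisY]
    rw [h1]
    have := sum_apply_single (fun p x => Δ.b l' (s.2.2 (Δ.Ib l') ((Δ.αVb p l').eval s x)))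
      (fun p => by simp) p (Module.finBasis ℂ (V p.1) r')
    simp [basisZ, matrixΨ, Ψ, this]
    rfl
  · rw [LinearMap.toMatrix_apply]
    have h1 : Δ.basisY (.inr l) = (0, Pi.single l 1) := by
      simp [basisY]
    rw [h1]
    simp [basisZ, matrixΨ, Ψ, Pi.single_apply]
    rfl

theorem matrixΨ_mem_polyFun (x y) : (fun s => Δ.matrixΨ s x y) ∈ polyFun Q V D := by
  rcases x with q | l' <;> rcases y with p | l
  · exact isPolyHom_pathAlg (Δ.αVV p.1 q.1) ((Module.finBasis ℂ (V q.1.1)).coord q.2) _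
  · exact (isPolyHom_pathAlg (Δ.αaV l q.1)).comp (isPolyHom_gamma _)
      ((Module.finBasis ℂ (V q.1.1)).coord q.2) _
  · exact (isPolyHom_delta _).comp (isPolyHom_pathAlg (Δ.αVb p.1 l')) _ _
  · exact ((isPolyHom_delta _).comp (isPolyHom_pathAlg (Δ.αab l l'))).comp (isPolyHom_gamma _) _ _

/-- In fixed bases the entries of `Ψ` are polynomial and those of `e` are constant; the Leibniz
formula then expresses the determinant. -/
theorem f_mem_polyFun (e : Δ.Z ≃ₗ[ℂ] Δ.Y) : Δ.f e ∈ polyFun Q V D := by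
  classical
  have h1 : Δ.f e = ∑ σ : Equiv.Perm _, (Equiv.Perm.sign σ : ℤ) • ∏ y,
      ∑ x, (algebraMap ℂ (Rep Q V D → ℂ)
        (LinearMap.toMatrix Δ.basisZ Δ.basisY e.toLinearMap (σ y) x)) *
        fun s => Δ.matrixΨ s x y := by
    ext s
    rw [f, ← LinearMap.det_toMatrix Δ.basisY, LinearMap.toMatrix_comp Δ.basisY Δ.basisZ,
      toMatrix_Ψ, Matrix.det_apply, Finset.sum_apply]
    refine Finset.sum_congr rfl fun σ _ => ?_
    simp [Finset.prod_apply, Matrix.mul_apply, Units.smul_def]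
  rw [h1]
  refine Subalgebra.sum_mem _ fun σ _ => zsmul_mem (Subalgebra.prod_mem _ fun y _ =>
    Subalgebra.sum_mem _ fun x _ => mul_mem (Subalgebra.algebraMap_mem _ _) ?_) _
  exact Δ.matrixΨ_mem_polyFun x y

theorem det_blockDiagonal' {ι : Type*} [Fintype ι] [DecidableEq ι] {n : ι → Type*}
    [∀ p, Fintype (n p)] [∀ p, DecidableEq (n p)] (M : (p : ι) → Matrix (n p) (n p) ℂ) :
    (Matrix.blockDiagonal' M).det = ∏ p, (M p).det := by
  -- An arbitrary order turns block diagonal into block triangular, for which the determinant is a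
  -- product over the blocks.
  let : LinearOrder ι := LinearOrder.lift' (Fintype.equivFin ι) (Fintype.equivFin ι).injective
  rw [(Matrix.blockTriangular_blockDiagonal' M).det_fintype]
  refine Finset.prod_congr rfl fun p _ => ?_
  rw [← Matrix.det_reindex_self (Equiv.sigmaSubtype p)]
  congr 1
  ext r r'
  simp [Matrix.toSquareBlock, Matrix.toSquareBlockProp, Equiv.sigmaSubtype]

theorem det_pi_comp_proj {ι : Type*} [Fintype ι] {X : ι → Type*} [∀ p, AddCommGroup (X p)]
    [∀ p, Module ℂ (X p)] [∀ p, FiniteDimensional ℂ (X p)] (F : (p : ι) → X p →ₗ[ℂ] X p) :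
    LinearMap.det (LinearMap.pi fun p => F p ∘ₗ LinearMap.proj p) =
      ∏ p, LinearMap.det (F p) := by
  classical
  let b := fun p => Module.finBasis ℂ (X p)
  have : LinearMap.toMatrix (Pi.basis b) (Pi.basis b)
      (LinearMap.pi fun p => F p ∘ₗ LinearMap.proj p) =
      Matrix.blockDiagonal' fun p => LinearMap.toMatrix (b p) (b p) (F p) := by
    ext ⟨p, r⟩ ⟨p', r'⟩
    rw [LinearMap.toMatrix_apply]
    by_cases h : p = p'
    · subst h
      simp [Matrix.blockDiagonal'_apply_eq, LinearMap.toMatrix_apply]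
    · simp [Matrix.blockDiagonal'_apply_ne _ _ _ h, Pi.single_eq_of_ne h]
  rw [← LinearMap.det_toMatrix (Pi.basis b), this, det_blockDiagonal']
  simp

theorem det_copies (k : I → ℕ) (n : ℕ) (g : GV V) :
    LinearMap.det (((LinearEquiv.piCongrRight fun p : Σ i, Fin (k i) => g p.1).prodCongr
      (LinearEquiv.refl ℂ (Fin n → ℂ))).toLinearMap) =
      ((∏ i, LinearEquiv.det (g i) ^ k i : ℂˣ) : ℂ) := by
  have h1 : ((LinearEquiv.piCongrRight fun p : Σ i, Fin (k i) => g p.1).prodCongr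
      (LinearEquiv.refl ℂ (Fin n → ℂ))).toLinearMap =
      (LinearMap.pi fun p : Σ i, Fin (k i) => (g p.1).toLinearMap ∘ₗ LinearMap.proj p).prodMap
        LinearMap.id := by
    ext <;> simp
  rw [h1, LinearMap.det_prodMap, LinearMap.det_id, mul_one, det_pi_comp_proj, Fintype.prod_sigma]
  simp only [Units.coe_prod, Units.val_pow_eq_pow_val, LinearEquiv.coe_det]
  refine Finset.prod_congr rfl fun i _ => ?_
  change ∏ _ : Fin (k i), LinearMap.det (g i).toLinearMap = _
  simp

/-- With the group acting trivially on the lines of `Y` and `Z`, `Ψ` is equivariant; the quotient of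
the determinants on `Z` and `Y` is ∏ det(g_i)^(m_i⁺ - m_i⁻), which is the character. -/
theorem f_act (e : Δ.Z ≃ₗ[ℂ] Δ.Y) (g : GV V) (s : Rep Q V D) :
    Δ.f e (act g s) = ((chi m g : ℂˣ) : ℂ) * Δ.f e s := by
  let gY : Δ.Y ≃ₗ[ℂ] Δ.Y := (LinearEquiv.piCongrRight fun p => g p.1).prodCongr
    (LinearEquiv.refl ℂ _)
  let gZ : Δ.Z ≃ₗ[ℂ] Δ.Z := (LinearEquiv.piCongrRight fun p => g p.1).prodCongr
    (LinearEquiv.refl ℂ _)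
  have h1 : Δ.Ψ (act g s) ∘ₗ gY.toLinearMap = gZ.toLinearMap ∘ₗ Δ.Ψ s := by
    refine LinearMap.ext fun y => Prod.ext (funext fun q => ?_) (funext fun l' => ?_)
    · simp [Ψ, gY, gZ, BPathAlg.eval_act]
      simp [act]
    · simp [Ψ, gY, gZ, BPathAlg.eval_act]
      simp [act]
  have h2 : (e.toLinearMap ∘ₗ Δ.Ψ (act g s)) ∘ₗ gY.toLinearMap =
      (e.toLinearMap ∘ₗ gZ.toLinearMap ∘ₗ e.symm.toLinearMap) ∘ₗ (e.toLinearMap ∘ₗ Δ.Ψ s) := by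
    rw [LinearMap.comp_assoc, h1]
    ext <;> simp
  have h3 := congrArg LinearMap.det h2
  rw [LinearMap.det_comp, LinearMap.det_comp, LinearMap.det_conj] at h3
  have hY : LinearMap.det gY.toLinearMap = _ := det_copies Δ.mNeg Δ.nNeg g
  have hZ : LinearMap.det gZ.toLinearMap = _ := det_copies Δ.mPos Δ.nPos g
  rw [hY, hZ] at h3
  have h4 : (chi m g) * ∏ i, LinearEquiv.det (g i) ^ Δ.mNeg i =
      ∏ i, LinearEquiv.det (g i) ^ Δ.mPos i := by
    simp only [chi, MonoidHom.coe_mk, OneHom.coe_mk]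
    rw [← Finset.prod_mul_distrib]
    refine Finset.prod_congr rfl fun i _ => ?_
    rw [← Δ.mPos_sub_mNeg i, zpow_sub]
    simp
  rw [← h4, Units.val_mul] at h3
  refine mul_right_cancel₀ (Units.ne_zero (∏ i, LinearEquiv.det (g i) ^ Δ.mNeg i)) ?_
  rw [f, f, h3]
  ring

theorem f_mem_semiInvariants (e : Δ.Z ≃ₗ[ℂ] Δ.Y) :
    Δ.f e ∈ semiInvariants Q V D (chi m) 1 :=
  ⟨Δ.f_mem_polyFun e, fun g s => by rw [pow_one]; exact Δ.f_act e g s⟩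

/-- Two identifications change the determinant by a nonzero constant. -/
theorem exists_f_eq_smul (e e' : Δ.Z ≃ₗ[ℂ] Δ.Y) : ∃ c : ℂ, Δ.f e' = c • Δ.f e := by
  refine ⟨LinearMap.det (e'.toLinearMap ∘ₗ e.symm.toLinearMap), ?_⟩
  ext s
  rw [Pi.smul_apply, smul_eq_mul, f, f, ← LinearMap.det_comp]
  congr 1
  ext <;> simp

end ChiData

end Easy

/-! ### Inclusion-exclusion for clustered determinants -/

section Determinant

variable {A B X Y : Type*} [Fintype A] [Fintype B] [DecidableEq A] [DecidableEq B]
  [DecidableEq X] [DecidableEq Y]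

/-- The multilinear part of a determinant with clustered rows and columns is an alternating sum
over the cluster preserving permutations of the rows and of the columns. -/
theorem sum_neg_one_pow_smul_clustered_det (β : B ≃ A) (cB : B → X) (cA : A → Y)
    (L : B → B → A → ℂ) :
    ∑ S : Finset B, (-1 : ℤ) ^ Sᶜ.card • ∑ π : Perm A, (Perm.sign π : ℤ) • ∏ b,
      ∑ b' ∈ S, (if cB b' = cB b ∧ cA (β b') = cA (π (β b)) then L b' b (π (β b)) else 0) =
    ∑ τA : Perm A, ∑ τB : Perm B, ((Perm.sign τA : ℤ) * (Perm.sign τB : ℤ)) • ∏ b,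
      if cB b = cB (τB b) ∧ cA (β b) = cA (τA (β b)) then L b (τB b) (τA (β b)) else 0 := by
  -- For fixed `π` the alternating sum polarizes the product: every summand `b'` is used exactly
  -- once, along a permutation `ν`.
  have h1 : ∀ π : Perm A, ∑ S : Finset B, (-1 : ℤ) ^ Sᶜ.card • ∏ b, ∑ b' ∈ S,
      (if cB b' = cB b ∧ cA (β b') = cA (π (β b)) then L b' b (π (β b)) else 0) =
      ∑ ν : Perm B, ∏ b, if cB (ν b) = cB b ∧ cA (β (ν b)) = cA (π (β b)) then
        L (ν b) b (π (β b)) else 0 := by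
    intro π
    simpa using (sum_perm_multilinear (MultilinearMap.mkPiAlgebra ℂ B ℂ) fun b b' =>
      if cB b' = cB b ∧ cA (β b') = cA (π (β b)) then L b' b (π (β b)) else 0).symm
  simp_rw [Finset.smul_sum]
  rw [Finset.sum_comm]
  simp_rw [smul_comm ((-1 : ℤ) ^ _), ← Finset.smul_sum, h1, Finset.smul_sum]
  rw [Finset.sum_comm]
  have h2 : ∀ ν : Perm B, ∑ π : Perm A, (Perm.sign π : ℤ) • ∏ b,
      (if cB (ν b) = cB b ∧ cA (β (ν b)) = cA (π (β b)) then L (ν b) b (π (β b)) else 0) =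
      ∑ τA : Perm A, ((Perm.sign τA : ℤ) * (Perm.sign ν⁻¹ : ℤ)) • ∏ b,
        if cB b = cB (ν⁻¹ b) ∧ cA (β b) = cA (τA (β b)) then L b (ν⁻¹ b) (τA (β b)) else 0 := by
    intro ν
    -- Writing `π` as `τA` times the transport of `ν` through `β`, and `τB = ν⁻¹`, separates the
    -- permutations of columns and of rows and splits the sign.
    rw [← Equiv.sum_comp (Equiv.mulRight (β.permCongr ν))]
    refine Finset.sum_congr rfl fun τ _ => ?_
    congr 1
    · simp [Perm.sign_permCongr]
    · rw [← Equiv.prod_comp ν fun b => if cB b = cB (ν⁻¹ b) ∧ cA (β b) = cA (τ (β b)) then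
        L b (ν⁻¹ b) (τ (β b)) else 0]
      simp
  simp_rw [h2]
  rw [Finset.sum_comm]
  refine Finset.sum_congr rfl fun τ _ => ?_
  rw [← Equiv.sum_comp (Equiv.inv (Perm B))]
  simp

end Determinant

/-! ### Matrices with blocks in the path algebra, and the invariants they give -/

section Words

universe uI uH uV uD

variable {I : Type uI} {H : Type uH} {Q : DoubleQuiver I H}
  {V : I → Type uV} [∀ i, AddCommGroup (V i)] [∀ i, Module ℂ (V i)]
  {D : I → Type uD} [∀ i, AddCommGroup (D i)] [∀ i, Module ℂ (D i)]

theorem BPath.exists_comp {i j k : I} (q : BPath Q j k) (hq : q.IsPath) (p : BPath Q i j)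
    (hp : p.IsPath) : ∃ r : BPath Q i k, r.IsPath ∧
      ∀ s : Rep Q V D, r.eval s = q.eval s ∘ₗ p.eval s := by
  induction q with
  | nil => exact ⟨p, hp, fun s => by simp [BPath.eval]⟩
  | arrow h q ih =>
    obtain ⟨r, hr, h'⟩ := ih (by simpa [BPath.IsPath] using hq)
    exact ⟨.arrow h r, by simpa [BPath.IsPath] using hr, fun s => by
      rw [BPath.eval, h', BPath.eval, LinearMap.comp_assoc]⟩
  | loop q ih => simp [BPath.IsPath] at hq

namespace BPathAlg

theorem InPathAlg.zero {i j : I} : (0 : BPathAlg Q i j).InPathAlg := Submodule.zero_mem _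

theorem InPathAlg.sum {i j : I} {ι : Type*} (t : Finset ι) (x : ι → BPathAlg Q i j)
    (h : ∀ a ∈ t, (x a).InPathAlg) : BPathAlg.InPathAlg (∑ a ∈ t, x a) :=
  Submodule.sum_mem _ h

theorem inPathAlg_single {i j : I} (p : BPath Q i j) (hp : p.IsPath) :
    BPathAlg.InPathAlg (Finsupp.single p 1) :=
  Submodule.subset_span ⟨p, hp, rfl⟩

/-- Concatenation of paths, extended bilinearly; one element serves for all points. -/
theorem InPathAlg.exists_comp {i j k : I} {y : BPathAlg Q j k} (hy : y.InPathAlg)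
    {x : BPathAlg Q i j} (hx : x.InPathAlg) : ∃ z : BPathAlg Q i k, z.InPathAlg ∧
      ∀ s : Rep Q V D, z.eval s = y.eval s ∘ₗ x.eval s := by
  induction hy using Submodule.span_induction with
  | mem y hy =>
    obtain ⟨q, hq, rfl⟩ := hy
    induction hx using Submodule.span_induction with
    | mem x hx =>
      obtain ⟨p, hp, rfl⟩ := hx
      obtain ⟨r, hr, h⟩ := q.exists_comp (V := V) (D := D) hq p hp
      exact ⟨_, inPathAlg_single r hr, fun s => by simp only [eval_single, h]⟩
    | zero => exact ⟨0, InPathAlg.zero, fun s => by simp⟩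
    | add x x' _ _ h h' =>
      obtain ⟨z, hz, h⟩ := h
      obtain ⟨z', hz', h'⟩ := h'
      exact ⟨z + z', Submodule.add_mem _ hz hz', fun s => by
        rw [eval_add, eval_add, h, h', LinearMap.comp_add]⟩
    | smul c x _ h =>
      obtain ⟨z, hz, h⟩ := h
      exact ⟨c • z, Submodule.smul_mem _ _ hz, fun s => by
        rw [eval_smul, eval_smul, h, LinearMap.comp_smul]⟩
  | zero => exact ⟨0, InPathAlg.zero, fun s => by simp⟩
  | add x x' _ _ h h' =>
    obtain ⟨z, hz, h⟩ := h
    obtain ⟨z', hz', h'⟩ := h'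
    exact ⟨z + z', Submodule.add_mem _ hz hz', fun s => by
      rw [eval_add, eval_add, h, h', LinearMap.add_comp]⟩
  | smul c x _ h =>
    obtain ⟨z, hz, h⟩ := h
    exact ⟨c • z, Submodule.smul_mem _ _ hz, fun s => by
      rw [eval_smul, eval_smul, h, LinearMap.smul_comp]⟩

end BPathAlg

variable [∀ i, FiniteDimensional ℂ (V i)] [∀ i, FiniteDimensional ℂ (D i)]

/-- The indices of the standard basis of the sum of a family of vector spaces. -/
abbrev BasisIdx (U : I → Type*) [∀ i, AddCommGroup (U i)] [∀ i, Module ℂ (U i)] : Type uI :=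
  Σ i, Fin (Module.finrank ℂ (U i))

/-- The matrix on the sum of all `V i` of the values of a family of elements of the `b`-path
algebra. -/
def pathMatrix (W : ∀ i j, BPathAlg Q i j) (s : Rep Q V D) : Matrix (BasisIdx V) (BasisIdx V) ℂ :=
  fun x y => (Module.finBasis ℂ (V x.1)).coord x.2
    ((W y.1 x.1).eval s (Module.finBasis ℂ (V y.1) y.2))

variable (Q V D) in
/-- The matrix valued functions which come from the path algebra. -/
def pathMatrices : Set (Rep Q V D → Matrix (BasisIdx V) (BasisIdx V) ℂ) :=
  {M | ∃ W : ∀ i j, BPathAlg Q i j, (∀ i j, (W i j).InPathAlg) ∧ M = pathMatrix W}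

variable [DecidableEq I]

/-- The value of an arrow as a matrix on the sum of all `V i`. -/
def arrowMatrix (h : H) (s : Rep Q V D) : Matrix (BasisIdx V) (BasisIdx V) ℂ :=
  fun x y => (Module.finBasis ℂ (V x.1)).coord x.2 ((Pi.single (Q.tgt h) (s.1 h
    ((Pi.single y.1 (Module.finBasis ℂ (V y.1) y.2) : ∀ i, V i) (Q.src h))) : ∀ i, V i) x.1)

/-- The image under `γ` of a basis vector, as a vector in the sum of all `V i`. -/
def gammaVec (l : BasisIdx D) (s : Rep Q V D) : BasisIdx V → ℂ :=
  fun x => (Module.finBasis ℂ (V x.1)).coord x.2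
    ((Pi.single l.1 (s.2.1 l.1 (Module.finBasis ℂ (D l.1) l.2)) : ∀ i, V i) x.1)

/-- A coordinate of `δ`, as a covector on the sum of all `V i`. -/
def deltaVec (l : BasisIdx D) (s : Rep Q V D) : BasisIdx V → ℂ :=
  fun y => (Module.finBasis ℂ (D l.1)).coord l.2
    (s.2.2 l.1 ((Pi.single y.1 (Module.finBasis ℂ (V y.1) y.2) : ∀ i, V i) l.1))

theorem arrowMatrix_mem_pathMatrices (h : H) :
    (arrowMatrix h : Rep Q V D → _) ∈ pathMatrices Q V D := by
  have : ∀ i j, ∃ x : BPathAlg Q i j, x.InPathAlg ∧ ∀ (s : Rep Q V D) (v : V i), x.eval s v =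
      (Pi.single (Q.tgt h) (s.1 h ((Pi.single i v : ∀ i, V i) (Q.src h))) : ∀ i, V i) j := by
    intro i j
    by_cases hi : Q.src h = i
    · by_cases hj : Q.tgt h = j
      · subst hi hj
        refine ⟨_, BPathAlg.inPathAlg_single (.arrow h (.nil _)) ?_, fun s v => ?_⟩
        · simp [BPath.IsPath]
        · rw [BPathAlg.eval_single]
          simp [BPath.eval]
      · exact ⟨0, BPathAlg.InPathAlg.zero, fun s v => by
          rw [Pi.single_eq_of_ne (Ne.symm hj)]; simp⟩
    · exact ⟨0, BPathAlg.InPathAlg.zero, fun s v => by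
        rw [Pi.single_eq_of_ne (M := V) hi, map_zero]; simp⟩
  choose W hW hWs using this
  refine ⟨W, hW, ?_⟩
  ext s x y
  rw [arrowMatrix, pathMatrix, hWs]

variable [Fintype I]

/-- The projection to a vertex is its empty path; the additional colour gives zero. -/
theorem colorProj_mem_pathMatrices (c : Option I) :
    (fun _ => colorProj Sigma.fst c) ∈ pathMatrices Q V D := by
  have : ∀ i j, ∃ x : BPathAlg Q i j, x.InPathAlg ∧ ∀ (s : Rep Q V D) (v : V i), x.eval s v =
      if some i = c then (Pi.single i v : ∀ i, V i) j else 0 := by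
    intro i j
    by_cases hc : some i = c
    · by_cases hj : i = j
      · subst hj
        refine ⟨_, BPathAlg.inPathAlg_single (.nil i) ?_, fun s v => ?_⟩
        · simp [BPath.IsPath]
        · rw [BPathAlg.eval_single]
          simp [BPath.eval, hc]
      · exact ⟨0, BPathAlg.InPathAlg.zero, fun s v => by
          rw [Pi.single_eq_of_ne (Ne.symm hj)]; simp⟩
    · exact ⟨0, BPathAlg.InPathAlg.zero, fun s v => by simp [hc]⟩
  choose W hW hWs using this
  refine ⟨W, hW, ?_⟩
  ext s ⟨i, r⟩ ⟨j, r'⟩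
  simp only [pathMatrix, hWs, colorProj, Matrix.diagonal_apply]
  by_cases hij : i = j
  · subst hij
    by_cases hc : some i = c
    · simp [hc, Finsupp.single_apply, eq_comm]
    · simp [hc]
  · rw [Pi.single_eq_of_ne (M := V) hij]
    have : (⟨i, r⟩ : BasisIdx V) ≠ ⟨j, r'⟩ := fun h => hij (congrArg Sigma.fst h)
    simp [this]

/-- The matrix of a family of elements of the path algebra times the coordinates of a vector. -/
theorem pathMatrix_mulVec (W : ∀ i j, BPathAlg Q i j) (s : Rep Q V D) (v : ∀ i, V i)
    (x : BasisIdx V) :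
    Matrix.mulVec (pathMatrix W s) (fun y => (Module.finBasis ℂ (V y.1)).coord y.2 (v y.1)) x =
      (Module.finBasis ℂ (V x.1)).coord x.2 (∑ i, (W i x.1).eval s (v i)) := by
  simp only [Matrix.mulVec, dotProduct, pathMatrix]
  rw [Fintype.sum_sigma, map_sum]
  refine Finset.sum_congr rfl fun i _ => ?_
  conv_rhs => rw [← (Module.finBasis ℂ (V i)).sum_repr (v i), map_sum, map_sum]
  refine Finset.sum_congr rfl fun r _ => ?_
  rw [map_smul, map_smul, smul_eq_mul, mul_comm]
  rfl

theorem pathMatrices_mul (M : Rep Q V D → _) (hM : M ∈ pathMatrices Q V D)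
    (M' : Rep Q V D → _) (hM' : M' ∈ pathMatrices Q V D) :
    (fun s => M s * M' s) ∈ pathMatrices Q V D := by
  obtain ⟨W, hW, rfl⟩ := hM
  obtain ⟨W', hW', rfl⟩ := hM'
  choose Z hZ hZs using fun i j k => (hW j k).exists_comp (V := V) (D := D) (hW' i j)
  refine ⟨fun i k => ∑ j, Z i j k, fun i k => BPathAlg.InPathAlg.sum _ _ fun j _ => hZ i j k, ?_⟩
  ext s x y
  have := pathMatrix_mulVec W s (fun j => (W' y.1 j).eval s (Module.finBasis ℂ (V y.1) y.2)) x
  rw [Matrix.mul_apply]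
  refine this.trans ?_
  rw [pathMatrix, BPathAlg.eval_sum]
  simp [hZs]

theorem trace_pathMatrix (W : ∀ i j, BPathAlg Q i j) (s : Rep Q V D) :
    (pathMatrix W s).trace = ∑ i, LinearMap.trace ℂ (V i) ((W i i).eval s) := by
  rw [Matrix.trace, Fintype.sum_sigma]
  refine Finset.sum_congr rfl fun i _ => ?_
  rw [LinearMap.trace_eq_matrix_trace ℂ (Module.finBasis ℂ (V i)), Matrix.trace]
  refine Finset.sum_congr rfl fun r _ => ?_
  simp [LinearMap.toMatrix_apply, pathMatrix]

/-- Only the diagonal blocks count, and they change by conjugation under the group. -/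
theorem trace_mem_invariants (M : Rep Q V D → _) (hM : M ∈ pathMatrices Q V D) :
    (fun s => (M s).trace) ∈ invariants Q V D := by
  obtain ⟨W, -, rfl⟩ := hM
  constructor
  · have : (fun s : Rep Q V D => (pathMatrix W s).trace) =
        ∑ x : BasisIdx V, fun s => pathMatrix W s x x := by
      ext s; simp [Matrix.trace]
    rw [this]
    exact Subalgebra.sum_mem _ fun x _ => isPolyHom_pathAlg (W x.1 x.1)
      ((Module.finBasis ℂ (V x.1)).coord x.2) _
  · intro g s
    simp only [trace_pathMatrix]
    refine Finset.sum_congr rfl fun i _ => ?_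
    rw [BPathAlg.eval_act]
    exact LinearMap.trace_conj' ((W i i).eval s) (g i)

theorem pathMatrix_mulVec_gammaVec (W : ∀ i j, BPathAlg Q i j) (l : BasisIdx D) (s : Rep Q V D)
    (x : BasisIdx V) : Matrix.mulVec (pathMatrix W s) (gammaVec l s) x =
      (Module.finBasis ℂ (V x.1)).coord x.2 ((W l.1 x.1).eval s
        (s.2.1 l.1 (Module.finBasis ℂ (D l.1) l.2))) := by
  refine (pathMatrix_mulVec W s (Pi.single l.1 _) x).trans ?_
  rw [ChiData.sum_apply_single (fun i v => (W i x.1).eval s v) fun i => map_zero _]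

theorem deltaVec_dotProduct (l : BasisIdx D) (s : Rep Q V D) (v : ∀ i, V i) :
    (deltaVec l s ⬝ᵥ fun x => (Module.finBasis ℂ (V x.1)).coord x.2 (v x.1)) =
      (Module.finBasis ℂ (D l.1)).coord l.2 (s.2.2 l.1 (v l.1)) := by
  simp only [dotProduct, deltaVec]
  rw [Fintype.sum_sigma]
  have h : ∀ i, ∑ r, (Module.finBasis ℂ (D l.1)).coord l.2 (s.2.2 l.1
      ((Pi.single i (Module.finBasis ℂ (V i) r) : ∀ i, V i) l.1)) *
        (Module.finBasis ℂ (V i)).coord r (v i) = (Module.finBasis ℂ (D l.1)).coord l.2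
          (s.2.2 l.1 ((Pi.single i (v i) : ∀ i, V i) l.1)) := by
    intro i
    conv_rhs => rw [← (Module.finBasis ℂ (V i)).sum_repr (v i)]
    change _ = ((Module.finBasis ℂ (D l.1)).coord l.2 ∘ₗ s.2.2 l.1 ∘ₗ LinearMap.proj l.1 ∘ₗ
      LinearMap.single ℂ V i) _
    rw [map_sum]
    refine Finset.sum_congr rfl fun r _ => ?_
    rw [map_smul, smul_eq_mul, mul_comm]
    rfl
  simp_rw [h]
  rw [Finset.sum_eq_single l.1]
  · simp
  · intro i _ hi
    rw [Pi.single_eq_of_ne (M := V) (Ne.symm hi)]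
    simp
  · simp

theorem deltaVec_dotProduct_pathMatrix_gammaVec (W : ∀ i j, BPathAlg Q i j) (l l' : BasisIdx D)
    (s : Rep Q V D) : deltaVec l s ⬝ᵥ Matrix.mulVec (pathMatrix W s) (gammaVec l' s) =
      (Module.finBasis ℂ (D l.1)).coord l.2 (s.2.2 l.1 ((W l'.1 l.1).eval s
        (s.2.1 l'.1 (Module.finBasis ℂ (D l'.1) l'.2)))) := by
  rw [← deltaVec_dotProduct l s fun i => (W l'.1 i).eval s _]
  congr 1
  ext x
  rw [pathMatrix_mulVec_gammaVec]

theorem deltaVec_dotProduct_pathMatrix_single (W : ∀ i j, BPathAlg Q i j) (l : BasisIdx D)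
    (y : BasisIdx V) (s : Rep Q V D) :
    deltaVec l s ⬝ᵥ Matrix.mulVec (pathMatrix W s) (Pi.single y 1) =
      (Module.finBasis ℂ (D l.1)).coord l.2 (s.2.2 l.1 ((W y.1 l.1).eval s
        (Module.finBasis ℂ (V y.1) y.2))) := by
  rw [← deltaVec_dotProduct l s fun i => (W y.1 i).eval s _]
  congr 1
  ext x
  simp [pathMatrix]

/-- Both ends of δ ∘ path ∘ γ are in the spaces `D`, where the group does not act. This allows the
chains between two lines to be split off, so that good data can have zero line-to-line blocks. -/
theorem deltaVec_pathMatrix_gammaVec_mem_invariants (M : Rep Q V D → _)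
    (hM : M ∈ pathMatrices Q V D) (l l' : BasisIdx D) :
    (fun s => deltaVec l s ⬝ᵥ Matrix.mulVec (M s) (gammaVec l' s)) ∈ invariants Q V D := by
  obtain ⟨W, -, rfl⟩ := hM
  simp only [deltaVec_dotProduct_pathMatrix_gammaVec]
  constructor
  · exact ((isPolyHom_delta _).comp (isPolyHom_pathAlg (W l'.1 l.1))).comp (isPolyHom_gamma _)
      ((Module.finBasis ℂ (D l.1)).coord l.2) _
  · intro g s
    simp only [BPathAlg.eval_act]
    simp [act]

end Words

/-! ### Good data built from a matching of rows and columns -/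

section Good

universe uI uH uV uD

variable {I : Type uI} [Fintype I] [DecidableEq I] {H : Type uH} {Q : DoubleQuiver I H}
  {V : I → Type uV} [∀ i, AddCommGroup (V i)] [∀ i, Module ℂ (V i)]
  {D : I → Type uD} [∀ i, AddCommGroup (D i)] [∀ i, Module ℂ (D i)]

/-- The indices of the standard basis of `k i` copies of each `V i`. -/
abbrev FrameIdx (V : I → Type uV) [∀ i, AddCommGroup (V i)] [∀ i, Module ℂ (V i)] (k : I → ℕ) :
    Type uI :=
  Σ q : Σ i, Fin (k i), Fin (Module.finrank ℂ (V q.1))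

omit [DecidableEq I] in
theorem card_frameIdx (k : I → ℕ) :
    Fintype.card (FrameIdx V k) = ∑ i, k i * Module.finrank ℂ (V i) := by
  rw [Fintype.card_sigma, Fintype.sum_sigma]
  refine Finset.sum_congr rfl fun i _ => ?_
  change ∑ _ : Fin (k i), Fintype.card (Fin (Module.finrank ℂ (V i))) = _
  simp

/-- The summand to which a basis vector belongs. -/
abbrev cluster {ι X : Type*} {κ : ι → Type*} : (Sigma κ) ⊕ X → ι ⊕ X :=
  Sum.map Sigma.fst id

variable {m : I → ℤ} {np nn : ℕ} [∀ i, FiniteDimensional ℂ (V i)] [∀ i, FiniteDimensional ℂ (D i)]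

/-- The data attached to a bijection between rows and columns, to a path for every row and to a set
of rows which are switched on. -/
abbrev goodData (bb : Fin np → BasisIdx D) (aa : Fin nn → BasisIdx D)
    (β : FrameIdx V (fun i => (m i).toNat) ⊕ Fin np ≃ FrameIdx V (fun i => (-m i).toNat) ⊕ Fin nn)
    (W : FrameIdx V (fun i => (m i).toNat) ⊕ Fin np → ∀ i j, BPathAlg Q i j)
    (S : Finset (FrameIdx V (fun i => (m i).toNat) ⊕ Fin np)) : ChiData Q V D m where
  -- Positive and negative parts: the only choice with difference `m i` and sum `|m i|`.
  mPos i := (m i).toNat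
  mNeg i := (-m i).toNat
  mPos_sub_mNeg i := Int.toNat_sub_toNat_neg (m i)
  nPos := np
  nNeg := nn
  balance := by
    have h := Fintype.card_congr β
    rwa [Fintype.card_sum, Fintype.card_sum, card_frameIdx, card_frameIdx, Fintype.card_fin,
      Fintype.card_fin] at h
  Ia l := (aa l).1
  a l := Module.finBasis ℂ (D (aa l).1) (aa l).2
  Ib l := (bb l).1
  b l := (Module.finBasis ℂ (D (bb l).1)).coord (bb l).2
  αVV p q := ∑ b ∈ S, if cluster b = .inl q ∧ cluster (β b) = .inl p then W b p.1 q.1 else 0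
  αVb p l := ∑ b ∈ S, if cluster b = .inr l ∧ cluster (β b) = .inl p then W b p.1 (bb l).1 else 0
  αaV l q := ∑ b ∈ S, if cluster b = .inl q ∧ cluster (β b) = .inr l then W b (aa l).1 q.1 else 0
  αab _ _ := 0

variable (bb : Fin np → BasisIdx D) (aa : Fin nn → BasisIdx D)
  (β : FrameIdx V (fun i => (m i).toNat) ⊕ Fin np ≃ FrameIdx V (fun i => (-m i).toNat) ⊕ Fin nn)
  (W : FrameIdx V (fun i => (m i).toNat) ⊕ Fin np → ∀ i j, BPathAlg Q i j)

theorem exists_of_sum_ite_ne_zero {ι M : Type*} [AddCommMonoid M] (S : Finset ι) (p : ι → Prop)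
    [DecidablePred p] (x : ι → M) (h : (∑ b ∈ S, if p b then x b else 0) ≠ 0) : ∃ b, p b := by
  by_contra! hp
  exact h (Finset.sum_eq_zero fun b _ => if_neg (hp b))

theorem cluster_eq_inl {ι X : Type*} {κ : ι → Type*} {x : Sigma κ ⊕ X} {p : ι}
    (h : cluster x = .inl p) : ∃ r : κ p, x = .inl ⟨p, r⟩ := by
  rcases x with ⟨p', r⟩ | l
  · obtain rfl : p' = p := by simpa using h
    exact ⟨r, rfl⟩
  · simp at h

theorem cluster_eq_inr {ι X : Type*} {κ : ι → Type*} {x : Sigma κ ⊕ X} {l : X}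
    (h : cluster x = .inr l) : x = .inr l := by
  rcases x with ⟨p', r⟩ | l'
  · simp at h
  · simpa using h

/-- Used with `n` the dimension of one copy of some `V i`: each nonzero block meeting the copy is
witnessed by one of its `n` basis elements. -/
theorem ncard_add_ncard_le {X Y : Type*} {n : ℕ} (A : Set X) (B : Set Y) (F : Fin n → X ⊕ Y)
    (hA : ∀ x ∈ A, ∃ r, F r = .inl x) (hB : ∀ y ∈ B, ∃ r, F r = .inr y) :
    A.ncard + B.ncard ≤ n := by
  have hfin : (Set.range F).Finite := Set.finite_range F
  have hsub : Sum.inl '' A ∪ Sum.inr '' B ⊆ Set.range F := by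
    rintro _ (⟨x, hx, rfl⟩ | ⟨y, hy, rfl⟩)
    exacts [hA x hx, hB y hy]
  have h1 : (Sum.inl '' A ∪ Sum.inr '' B : Set (X ⊕ Y)).ncard = A.ncard + B.ncard := by
    rw [Set.ncard_union_eq ?_ (hfin.subset (Set.subset_union_left.trans hsub))
      (hfin.subset (Set.subset_union_right.trans hsub)),
      Set.ncard_image_of_injective _ Sum.inl_injective,
      Set.ncard_image_of_injective _ Sum.inr_injective]
    rw [Set.disjoint_left]
    rintro _ ⟨x, _, rfl⟩ ⟨y, _, h⟩
    cases h
  rw [← h1]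
  refine (Set.ncard_le_ncard hsub hfin).trans ?_
  rw [← Set.image_univ]
  refine (Set.ncard_image_le Set.finite_univ).trans ?_
  simp

/-- A nonzero block comes from a matched pair joining its two clusters. A copy of `V i` contains dim
`V i` basis elements and a line a single one, and `β` matches each of them once, which bounds the
nonzero blocks. -/
theorem goodData_isGood (hW : ∀ b i j, (W b i j).InPathAlg)
    (S : Finset (FrameIdx V (fun i => (m i).toNat) ⊕ Fin np)) : (goodData bb aa β W S).IsGood where
  mPos_add_mNeg i := by
    change (m i).toNat + (-m i).toNat = _
    omega
  αab_eq_zero _ _ := rfl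
  path_VV p q := BPathAlg.InPathAlg.sum _ _ fun b _ => by
    split_ifs
    exacts [hW _ _ _, BPathAlg.InPathAlg.zero]
  path_Vb p q := BPathAlg.InPathAlg.sum _ _ fun b _ => by
    split_ifs
    exacts [hW _ _ _, BPathAlg.InPathAlg.zero]
  path_aV p q := BPathAlg.InPathAlg.sum _ _ fun b _ => by
    split_ifs
    exacts [hW _ _ _, BPathAlg.InPathAlg.zero]
  path_ab _ _ := BPathAlg.InPathAlg.zero
  card_source p := by
    refine ncard_add_ncard_le _ _ (fun r => cluster (β.symm (.inl ⟨p, r⟩))) ?_ ?_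
    · intro q hq
      obtain ⟨b, hb, hb'⟩ := exists_of_sum_ite_ne_zero _ _ _ hq
      obtain ⟨r, hr⟩ := cluster_eq_inl hb'
      exact ⟨r, by rw [← hr, Equiv.symm_apply_apply, hb]⟩
    · intro l hl
      obtain ⟨b, hb, hb'⟩ := exists_of_sum_ite_ne_zero _ _ _ hl
      obtain ⟨r, hr⟩ := cluster_eq_inl hb'
      exact ⟨r, by rw [← hr, Equiv.symm_apply_apply, hb]⟩
  card_target q := by
    refine ncard_add_ncard_le _ _ (fun r => cluster (β (.inl ⟨q, r⟩))) ?_ ?_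
    · intro p hp
      obtain ⟨b, hb, hb'⟩ := exists_of_sum_ite_ne_zero _ _ _ hp
      obtain ⟨r, rfl⟩ := cluster_eq_inl hb
      exact ⟨r, hb'⟩
    · intro l hl
      obtain ⟨b, hb, hb'⟩ := exists_of_sum_ite_ne_zero _ _ _ hl
      obtain ⟨r, rfl⟩ := cluster_eq_inl hb
      exact ⟨r, hb'⟩
  unique_source l p p' hp hp' := by
    obtain ⟨b, hb, h1⟩ := exists_of_sum_ite_ne_zero _ _ _ hp
    obtain ⟨b', hb', h2⟩ := exists_of_sum_ite_ne_zero _ _ _ hp'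
    rw [cluster_eq_inr hb] at h1
    rw [cluster_eq_inr hb'] at h2
    exact Sum.inl_injective (h1.symm.trans h2)
  unique_target l q q' hq hq' := by
    obtain ⟨b, h1, hb⟩ := exists_of_sum_ite_ne_zero _ _ _ hq
    obtain ⟨b', h2, hb'⟩ := exists_of_sum_ite_ne_zero _ _ _ hq'
    rw [← β.injective ((cluster_eq_inr hb).trans (cluster_eq_inr hb').symm)] at h2
    exact Sum.inl_injective (h1.symm.trans h2)

/-- The covectors attached to rows: coordinates on the frames and coordinates of `δ`. -/
def rowVec {k : I → ℕ} {X : Type*} (bb : X → BasisIdx D) (s : Rep Q V D)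
    (b : FrameIdx V k ⊕ X) : BasisIdx V → ℂ :=
  b.elim (fun x => Pi.single (⟨x.1.1, x.2⟩ : BasisIdx V) (1 : ℂ)) fun l => deltaVec (bb l) s

/-- The vectors attached to columns: basis vectors and images under `γ`. -/
def colVec {k : I → ℕ} {X : Type*} (aa : X → BasisIdx D) (s : Rep Q V D)
    (a : FrameIdx V k ⊕ X) : BasisIdx V → ℂ :=
  a.elim (fun x => Pi.single (⟨x.1.1, x.2⟩ : BasisIdx V) (1 : ℂ)) fun l => gammaVec (aa l) s

/-- Since `β` matches no line with a line, the zero line-to-line block follows the same formula as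
the other blocks. -/
theorem matrixΨ_goodData (hβ : ∀ l' l, β (.inr l') ≠ .inr l)
    (S : Finset (FrameIdx V (fun i => (m i).toNat) ⊕ Fin np)) (s : Rep Q V D)
    (b : FrameIdx V (fun i => (m i).toNat) ⊕ Fin np)
    (a : FrameIdx V (fun i => (-m i).toNat) ⊕ Fin nn) :
    (goodData bb aa β W S).matrixΨ s b a = ∑ b' ∈ S,
      if cluster b' = cluster b ∧ cluster (β b') = cluster a then
        rowVec bb s b ⬝ᵥ Matrix.mulVec (pathMatrix (W b') s) (colVec aa s a) else 0 := by
  rcases b with q | l' <;> rcases a with p | l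
  · change (Module.finBasis ℂ (V q.1.1)).coord q.2 (BPathAlg.eval s (∑ b ∈ S, if cluster b = .inl q.1
      ∧ cluster (β b) = .inl p.1 then W b p.1.1 q.1.1 else 0) (Module.finBasis ℂ (V p.1.1) p.2)) = _
    rw [BPathAlg.eval_sum, LinearMap.sum_apply, map_sum]
    refine Finset.sum_congr rfl fun b _ => ?_
    by_cases h : cluster b = .inl q.1 ∧ cluster (β b) = .inl p.1
    · rw [if_pos h]
      refine Eq.trans ?_ (if_pos h).symm
      simp [rowVec, colVec, pathMatrix]
    · rw [if_neg h]
      refine Eq.trans ?_ (if_neg h).symm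
      simp
  · change (Module.finBasis ℂ (V q.1.1)).coord q.2 (BPathAlg.eval s (∑ b ∈ S, if cluster b = .inl q.1
      ∧ cluster (β b) = .inr l then W b (aa l).1 q.1.1 else 0)
        (s.2.1 (aa l).1 (Module.finBasis ℂ (D (aa l).1) (aa l).2))) = _
    rw [BPathAlg.eval_sum, LinearMap.sum_apply, map_sum]
    refine Finset.sum_congr rfl fun b _ => ?_
    by_cases h : cluster b = .inl q.1 ∧ cluster (β b) = .inr l
    · rw [if_pos h]
      refine Eq.trans ?_ (if_pos h).symm
      simp [rowVec, colVec, pathMatrix_mulVec_gammaVec]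
    · rw [if_neg h]
      refine Eq.trans ?_ (if_neg h).symm
      simp
  · change (Module.finBasis ℂ (D (bb l').1)).coord (bb l').2 (s.2.2 (bb l').1
      (BPathAlg.eval s (∑ b ∈ S, if cluster b = .inr l' ∧ cluster (β b) = .inl p.1 then
        W b p.1.1 (bb l').1 else 0) (Module.finBasis ℂ (V p.1.1) p.2))) = _
    rw [BPathAlg.eval_sum, LinearMap.sum_apply, map_sum, map_sum]
    refine Finset.sum_congr rfl fun b _ => ?_
    by_cases h : cluster b = .inr l' ∧ cluster (β b) = .inl p.1
    · rw [if_pos h]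
      refine Eq.trans ?_ (if_pos h).symm
      exact (deltaVec_dotProduct_pathMatrix_single (W b) (bb l') ⟨p.1.1, p.2⟩ s).symm
    · rw [if_neg h]
      refine Eq.trans ?_ (if_neg h).symm
      simp
  · rw [Finset.sum_eq_zero]
    · change (Module.finBasis ℂ (D (bb l').1)).coord (bb l').2 (s.2.2 (bb l').1
        (BPathAlg.eval s (0 : BPathAlg Q (aa l).1 (bb l').1) _)) = 0
      simp
    · intro b _
      rw [if_neg]
      rintro ⟨h1, h2⟩
      have h1 := cluster_eq_inr h1
      have h2 := cluster_eq_inr h2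
      exact hβ l' l (h1 ▸ h2)

/-- Identifying `Z` with `Y` by the bijection `β` of bases makes `f` the Leibniz sum of the matrix
with rows matched to columns by `β`. -/
theorem f_basis_equiv (Δ : ChiData Q V D m)
    (β : FrameIdx V Δ.mPos ⊕ Fin Δ.nPos ≃ FrameIdx V Δ.mNeg ⊕ Fin Δ.nNeg) (s : Rep Q V D) :
    Δ.f (Δ.basisZ.equiv Δ.basisY β) s = ∑ π : Perm (FrameIdx V Δ.mNeg ⊕ Fin Δ.nNeg),
      (Perm.sign π : ℤ) • ∏ b, Δ.matrixΨ s b (π (β b)) := by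
  have h1 : LinearMap.toMatrix Δ.basisY Δ.basisY
      ((Δ.basisZ.equiv Δ.basisY β).toLinearMap ∘ₗ Δ.Ψ s) =
      (Δ.matrixΨ s).submatrix β.symm id := by
    ext a a'
    rw [← ChiData.toMatrix_Ψ, LinearMap.toMatrix_apply, Matrix.submatrix_apply,
      LinearMap.toMatrix_apply, LinearMap.comp_apply]
    have : Δ.basisY.coord a ∘ₗ (Δ.basisZ.equiv Δ.basisY β).toLinearMap =
        Δ.basisZ.coord (β.symm a) := by
      refine Δ.basisZ.ext fun b => ?_
      simp [Finsupp.single_apply, Equiv.eq_symm_apply]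
    exact LinearMap.congr_fun this _
  rw [ChiData.f, ← LinearMap.det_toMatrix Δ.basisY, h1, ← Matrix.det_transpose, Matrix.det_apply]
  refine Finset.sum_congr rfl fun π _ => ?_
  rw [Units.smul_def]
  congr 1
  rw [← Equiv.prod_comp β]
  simp

theorem f_goodData (hβ : ∀ l' l, β (.inr l') ≠ .inr l)
    (S : Finset (FrameIdx V (fun i => (m i).toNat) ⊕ Fin np)) (s : Rep Q V D) :
    (goodData bb aa β W S).f ((goodData bb aa β W S).basisZ.equiv
      (goodData bb aa β W S).basisY β) s = ∑ π : Perm (FrameIdx V (fun i => (-m i).toNat) ⊕ Fin nn),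
        (Perm.sign π : ℤ) • ∏ b, ∑ b' ∈ S,
      if cluster b' = cluster b ∧ cluster (β b') = cluster (π (β b)) then
        rowVec bb s b ⬝ᵥ Matrix.mulVec (pathMatrix (W b') s) (colVec aa s (π (β b))) else 0 := by
  simp_rw [← matrixΨ_goodData bb aa β W hβ]
  exact f_basis_equiv (goodData bb aa β W S) β s

/-- The submodule spanned by the determinants of good data. -/
def goodSpan (e : (Δ : ChiData Q V D m) → Δ.Z ≃ₗ[ℂ] Δ.Y) :
    Submodule (invariants Q V D) (Rep Q V D → ℂ) :=
  Submodule.span (invariants Q V D) {F | ∃ Δ : ChiData Q V D m, Δ.IsGood ∧ F = Δ.f (e Δ)}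

omit [Fintype I] [∀ i, FiniteDimensional ℂ (V i)] [∀ i, FiniteDimensional ℂ (D i)]
  [DecidableEq I] in
theorem mul_mem_of_mem_invariants {P : Submodule (invariants Q V D) (Rep Q V D → ℂ)}
    {q f : Rep Q V D → ℂ} (hq : q ∈ invariants Q V D) (hf : f ∈ P) : (fun s => q s * f s) ∈ P :=
  P.smul_mem ⟨q, hq⟩ hf

omit [Fintype I] [∀ i, FiniteDimensional ℂ (V i)] [∀ i, FiniteDimensional ℂ (D i)]
  [DecidableEq I] in
theorem const_smul_mem {P : Submodule (invariants Q V D) (Rep Q V D → ℂ)}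
    (c : ℂ) {f : Rep Q V D → ℂ} (hf : f ∈ P) : c • f ∈ P :=
  P.smul_mem (algebraMap ℂ (invariants Q V D) c) hf

/-- By inclusion-exclusion this is an alternating sum, over the sets of rows switched on, of
determinants of good data; changing the identification to the prescribed `e` costs a constant. -/
theorem clustered_sum_mem_goodSpan (e : (Δ : ChiData Q V D m) → Δ.Z ≃ₗ[ℂ] Δ.Y)
    (hβ : ∀ l' l, β (.inr l') ≠ .inr l)
    (M : FrameIdx V (fun i => (m i).toNat) ⊕ Fin np → Rep Q V D → _)
    (hM : ∀ b, M b ∈ pathMatrices Q V D) :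
    (fun s => ∑ τA : Perm (FrameIdx V (fun i => (-m i).toNat) ⊕ Fin nn),
      ∑ τB : Perm (FrameIdx V (fun i => (m i).toNat) ⊕ Fin np),
        ((Perm.sign τA : ℤ) * (Perm.sign τB : ℤ)) • ∏ b,
          if cluster b = cluster (τB b) ∧ cluster (β b) = cluster (τA (β b)) then
            rowVec bb s (τB b) ⬝ᵥ Matrix.mulVec (M b s) (colVec aa s (τA (β b))) else 0) ∈
      goodSpan e := by
  choose W hW hMW using hM
  have h : ∀ s, _ = _ := fun s => sum_neg_one_pow_smul_clustered_det β cluster cluster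
    fun b' b a => rowVec bb s b ⬝ᵥ Matrix.mulVec (pathMatrix (W b') s) (colVec aa s a)
  simp_rw [hMW, ← h, ← f_goodData bb aa β W hβ]
  have : (fun s => ∑ S, (-1 : ℤ) ^ Sᶜ.card • (goodData bb aa β W S).f
      ((goodData bb aa β W S).basisZ.equiv (goodData bb aa β W S).basisY β) s) =
      ∑ S, (-1 : ℤ) ^ Sᶜ.card • (goodData bb aa β W S).f
      ((goodData bb aa β W S).basisZ.equiv (goodData bb aa β W S).basisY β) := by
    ext s
    simp [Finset.sum_apply]
  rw [this]
  refine Submodule.sum_mem _ fun S _ => zsmul_mem ?_ _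
  obtain ⟨c, hc⟩ := (goodData bb aa β W S).exists_f_eq_smul (e (goodData bb aa β W S))
    ((goodData bb aa β W S).basisZ.equiv (goodData bb aa β W S).basisY β)
  rw [hc]
  exact const_smul_mem c (Submodule.subset_span ⟨_, goodData_isGood bb aa β W hW S, rfl⟩)

end Good

/-! ### Cluster preserving permutations and restriction of matchings -/

section Clusters

/-- Cluster preserving permutations fix the elements which are their own cluster. -/
theorem sum_cluster_perm {ι X M : Type*} {κ : ι → Type*} [AddCommMonoid M] [DecidableEq ι]
    [DecidableEq X] [∀ i, DecidableEq (κ i)] [Fintype ι] [∀ i, Fintype (κ i)] [Fintype X]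
    (g : Perm (Sigma κ ⊕ X) → M) :
    (∑ τ : Perm (Sigma κ ⊕ X), if ∀ x, cluster x = cluster (τ x) then g τ else 0) =
      ∑ τ : Perm (Sigma κ), if ∀ x, x.1 = (τ x).1 then g (Equiv.sumCongr τ (Equiv.refl X)) else 0 := by
  rw [← Finset.sum_filter, ← Finset.sum_filter]
  symm
  refine Finset.sum_bij (fun τ _ => Equiv.sumCongr τ (Equiv.refl X)) (fun τ hτ => ?_)
    (fun τ _ τ' _ h => ?_) (fun τ hτ => ?_) (fun _ _ => rfl)
  · simp only [Finset.mem_filter, Finset.mem_univ, true_and] at hτ ⊢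
    rintro (x | x)
    · simpa using hτ x
    · simp
  · ext x : 1
    simpa using Equiv.congr_fun h (Sum.inl x)
  · simp only [Finset.mem_filter, Finset.mem_univ, true_and] at hτ
    have h1 : Set.MapsTo τ (Set.range Sum.inl) (Set.range Sum.inl) := by
      rintro _ ⟨x, rfl⟩
      obtain ⟨r, hr⟩ := cluster_eq_inl (p := x.1) (hτ (.inl x)).symm
      exact ⟨_, hr.symm⟩
    obtain ⟨⟨τ₁, τ₂⟩, rfl⟩ := Perm.mem_sumCongrHom_range_of_perm_mapsTo_inl h1
    refine ⟨τ₁, ?_, ?_⟩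
    · simp only [Finset.mem_filter, Finset.mem_univ, true_and]
      intro x
      simpa using hτ (.inl x)
    · have : τ₂ = 1 := by
        ext x
        simpa [eq_comm] using hτ (.inr x)
      rw [this]
      rfl

/-- A bijection between two sums restricts to the part which does not pair the right summands. -/
theorem exists_restricted_equiv {F F' B A : Type*} [Fintype F] [Fintype B] [Finite A]
    (β : F ⊕ B ≃ F' ⊕ A) :
    ∃ (np nn : ℕ) (ιB : Fin np → B) (ιA : Fin nn → A) (β' : F ⊕ Fin np ≃ F' ⊕ Fin nn)
      (C : Finset B), (∀ l' l, β' (.inr l') ≠ .inr l) ∧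
      (∀ x, Sum.map id ιA (β' x) = β (Sum.map id ιB x)) ∧
      (∀ b ∈ C, ∃ a, β (.inr b) = .inr a) ∧
      ∀ f : F ⊕ B → ℂ, ∏ b, f b = (∏ b ∈ C, f (.inr b)) * ∏ b, f (Sum.map id ιB b) := by
  classical
  cases nonempty_fintype A
  let PB : B → Prop := fun b => ∃ p, β (.inr b) = .inl p
  let PA : A → Prop := fun a => ∃ q, β.symm (.inr a) = .inl q
  let ιB : Fin (Fintype.card {b // PB b}) → B := fun l => ((Fintype.equivFin {b // PB b}).symm l).1
  let ιA : Fin (Fintype.card {a // PA a}) → A := fun l => ((Fintype.equivFin {a // PA a}).symm l).1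
  have hB : Function.Injective (Sum.map (id : F → F) ιB) := Function.injective_id.sumMap
    (Subtype.val_injective.comp (Equiv.injective _))
  have hA : Function.Injective (Sum.map (id : F' → F') ιA) := Function.injective_id.sumMap
    (Subtype.val_injective.comp (Equiv.injective _))
  have rB : ∀ b, Sum.inr b ∈ Set.range (Sum.map (id : F → F) ιB) ↔ PB b := by
    intro b
    constructor
    · rintro ⟨x | l, hx⟩
      · simp at hx
      · obtain rfl : ιB l = b := by simpa using hx
        exact ((Fintype.equivFin {b // PB b}).symm l).2
    · intro hb
      exact ⟨.inr (Fintype.equivFin {b // PB b} ⟨b, hb⟩), by simp [ιB]⟩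
  have rA : ∀ a, Sum.inr a ∈ Set.range (Sum.map (id : F' → F') ιA) ↔ PA a := by
    intro b
    constructor
    · rintro ⟨x | l, hx⟩
      · simp at hx
      · obtain rfl : ιA l = b := by simpa using hx
        exact ((Fintype.equivFin {b // PA b}).symm l).2
    · intro hb
      exact ⟨.inr (Fintype.equivFin {b // PA b} ⟨b, hb⟩), by simp [ιA]⟩
  have lB : ∀ q, Sum.inl q ∈ Set.range (Sum.map (id : F → F) ιB) := fun q => ⟨.inl q, rfl⟩
  have lA : ∀ q, Sum.inl q ∈ Set.range (Sum.map (id : F' → F') ιA) := fun q => ⟨.inl q, rfl⟩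
  -- The covectors and vectors retained are those matched with a frame element; `β` respects this
  -- choice on the two sides, hence restricts.
  have hR : ∀ x, x ∈ Set.range (Sum.map (id : F → F) ιB) ↔
      β x ∈ Set.range (Sum.map (id : F' → F') ιA) := by
    rintro (q | b)
    · refine iff_of_true (lB q) ?_
      rcases h : β (.inl q) with p | a
      · exact lA p
      · exact (rA a).2 ⟨q, by rw [← h, Equiv.symm_apply_apply]⟩
    · rw [rB]
      rcases h : β (.inr b) with p | a
      · exact iff_of_true ⟨p, h⟩ (lA p)
      · rw [rA]
        refine iff_of_false ?_ ?_
        · rintro ⟨p, hp⟩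
          rw [h] at hp
          cases hp
        · rintro ⟨q, hq⟩
          rw [← h, Equiv.symm_apply_apply] at hq
          cases hq
  let β' := ((Equiv.ofInjective _ hB).trans (β.subtypeEquiv hR)).trans (Equiv.ofInjective _ hA).symm
  have hβ' : ∀ x, Sum.map id ιA (β' x) = β (Sum.map id ιB x) := fun x =>
    Equiv.apply_ofInjective_symm hA _
  refine ⟨_, _, ιB, ιA, β', Finset.univ.filter fun b => ¬ PB b, ?_, hβ', ?_, ?_⟩
  · intro l' l h
    have h1 := hβ' (.inr l')
    obtain ⟨p, hp⟩ := ((Fintype.equivFin {b // PB b}).symm l').2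
    rw [h] at h1
    have h2 := h1.trans hp
    simp at h2
  · intro b hb
    rcases h : β (.inr b) with p | a
    · exact absurd ⟨p, h⟩ (Finset.mem_filter.1 hb).2
    · exact ⟨a, rfl⟩
  · intro f
    rw [Fintype.prod_sum_type, Fintype.prod_sum_type,
      ← Finset.prod_filter_mul_prod_filter_not Finset.univ PB fun b => f (.inr b),
      Finset.prod_subtype (p := PB) _ (by simp)]
    have : ∏ x : {b // PB b}, f (.inr x) = ∏ l, f (.inr (ιB l)) :=
      ((Fintype.equivFin {b // PB b}).symm.prod_comp fun x => f (.inr x.1)).symm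
    rw [this]
    simp only [Sum.map_inl, Sum.map_inr, id]
    ring

end Clusters

/-! ### Alternating sums over frames lie in the span of the good determinants -/

section Pairs

universe uI uH uV uD

variable {I : Type uI} [Fintype I] [DecidableEq I] {H : Type uH} {Q : DoubleQuiver I H}
  {V : I → Type uV} [∀ i, AddCommGroup (V i)] [∀ i, Module ℂ (V i)]
  {D : I → Type uD} [∀ i, AddCommGroup (D i)] [∀ i, Module ℂ (D i)]
  [∀ i, FiniteDimensional ℂ (V i)] [∀ i, FiniteDimensional ℂ (D i)] {m : I → ℤ}

/-- Lines are clusters of their own, so cluster preserving permutations are permutations of the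
frames, and the clustered sum takes this form. -/
theorem framed_sum_mem_goodSpan_aux (e : (Δ : ChiData Q V D m) → Δ.Z ≃ₗ[ℂ] Δ.Y) {np nn : ℕ}
    (bb : Fin np → BasisIdx D) (aa : Fin nn → BasisIdx D)
    (β : FrameIdx V (fun i => (m i).toNat) ⊕ Fin np ≃ FrameIdx V (fun i => (-m i).toNat) ⊕ Fin nn)
    (hβ : ∀ l' l, β (.inr l') ≠ .inr l)
    (M : FrameIdx V (fun i => (m i).toNat) ⊕ Fin np → Rep Q V D → _)
    (hM : ∀ b, M b ∈ pathMatrices Q V D) :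
    (fun s => ∑ τA : Perm (FrameIdx V fun i => (-m i).toNat), if ∀ x, x.1 = (τA x).1 then
      ∑ τB : Perm (FrameIdx V fun i => (m i).toNat), if ∀ x, x.1 = (τB x).1 then
        ((Perm.sign τA : ℤ) * (Perm.sign τB : ℤ)) • ∏ b,
          rowVec bb s (Equiv.sumCongr τB (Equiv.refl _) b) ⬝ᵥ Matrix.mulVec (M b s)
            (colVec aa s (Equiv.sumCongr τA (Equiv.refl _) (β b))) else 0 else 0) ∈
      goodSpan e := by
  convert clustered_sum_mem_goodSpan bb aa β e hβ M hM using 1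
  ext s
  have h1 := fun τA : Perm (FrameIdx V fun i => (-m i).toNat) => sum_cluster_perm
    fun τB : Perm (FrameIdx V (fun i => (m i).toNat) ⊕ Fin np) =>
      ((Perm.sign τA : ℤ) * (Perm.sign τB : ℤ)) • ∏ b,
          rowVec bb s (τB b) ⬝ᵥ Matrix.mulVec (M b s)
            (colVec aa s (Equiv.sumCongr τA (Equiv.refl _) (β b)))
  have h2 := sum_cluster_perm fun τA : Perm (FrameIdx V (fun i => (-m i).toNat) ⊕ Fin nn) =>
    ∑ τB : Perm (FrameIdx V (fun i => (m i).toNat) ⊕ Fin np), if ∀ x, cluster x = cluster (τB x) then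
      ((Perm.sign τA : ℤ) * (Perm.sign τB : ℤ)) • ∏ b,
          rowVec bb s (τB b) ⬝ᵥ Matrix.mulVec (M b s) (colVec aa s (τA (β b))) else 0
  simp only [Perm.sign_sumCongr, Equiv.Perm.sign_refl, mul_one] at h1 h2
  simp only [← h1, ← h2]
  refine Finset.sum_congr rfl fun τA _ => ?_
  have h3 : (∀ x, cluster x = cluster (τA x)) ↔ ∀ b, cluster (β b) = cluster (τA (β b)) :=
    β.forall_congr_right.symm
  simp only [Fintype.prod_ite_zero, forall_and, ← h3, smul_ite, smul_zero]
  by_cases hA : ∀ x, cluster x = cluster (τA x)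
  · simp only [eq_true hA, and_true, if_true]
  · simp only [eq_false hA, and_false, if_false, Finset.sum_const_zero]

/-- The covector-vector pairs of the matching do not see the frame permutations; they form a common
invariant factor, and what remains is a matching without such pairs. -/
theorem framed_sum_mem_goodSpan (e : (Δ : ChiData Q V D m) → Δ.Z ≃ₗ[ℂ] Δ.Y) {A B : Type*}
    [Fintype A] [Fintype B] (bb : B → BasisIdx D) (aa : A → BasisIdx D)
    (β : FrameIdx V (fun i => (m i).toNat) ⊕ B ≃ FrameIdx V (fun i => (-m i).toNat) ⊕ A)
    (M : FrameIdx V (fun i => (m i).toNat) ⊕ B → Rep Q V D → _)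
    (hM : ∀ b, M b ∈ pathMatrices Q V D) :
    (fun s => ∑ τA : Perm (FrameIdx V fun i => (-m i).toNat), if ∀ x, x.1 = (τA x).1 then
      ∑ τB : Perm (FrameIdx V fun i => (m i).toNat), if ∀ x, x.1 = (τB x).1 then
        ((Perm.sign τA : ℤ) * (Perm.sign τB : ℤ)) • ∏ b,
          rowVec bb s (Equiv.sumCongr τB (Equiv.refl _) b) ⬝ᵥ Matrix.mulVec (M b s)
            (colVec aa s (Equiv.sumCongr τA (Equiv.refl _) (β b))) else 0 else 0) ∈
      goodSpan e := by
  obtain ⟨np, nn, ιB, ιA, β', C, h1, h2, h3, h4⟩ := exists_restricted_equiv β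
  choose ρ hρ using h3
  have h5 := framed_sum_mem_goodSpan_aux e (bb ∘ ιB) (aa ∘ ιA) β' h1
    (fun b => M (Sum.map id ιB b)) fun b => hM _
  have h6 : (fun s => ∏ b ∈ C.attach, deltaVec (bb b.1) s ⬝ᵥ
      Matrix.mulVec (M (.inr b.1) s) (gammaVec (aa (ρ b.1 b.2)) s)) ∈ invariants Q V D := by
    have := Subalgebra.prod_mem (invariants Q V D) (t := C.attach) fun b _ =>
      deltaVec_pathMatrix_gammaVec_mem_invariants (M (.inr b.1)) (hM _) (bb b.1) (aa (ρ b.1 b.2))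
    convert this using 1
    ext s
    simp
  convert mul_mem_of_mem_invariants h6 h5 using 1
  ext s
  have hr : ∀ (τ : Perm (FrameIdx V fun i => (m i).toNat)) x,
      rowVec bb s (Equiv.sumCongr τ (Equiv.refl _) (Sum.map id ιB x)) =
      rowVec (bb ∘ ιB) s (Equiv.sumCongr τ (Equiv.refl _) x) := by
    rintro τ (x | l) <;> rfl
  have hc : ∀ (τ : Perm (FrameIdx V fun i => (-m i).toNat)) x,
      colVec aa s (Equiv.sumCongr τ (Equiv.refl _) (Sum.map id ιA x)) =
      colVec (aa ∘ ιA) s (Equiv.sumCongr τ (Equiv.refl _) x) := by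
    rintro τ (x | l) <;> rfl
  simp only [Finset.mul_sum, mul_ite, mul_zero]
  refine Finset.sum_congr rfl fun τA _ => ?_
  split_ifs with hA
  swap
  · rfl
  refine Finset.sum_congr rfl fun τB _ => ?_
  split_ifs with hB
  swap
  · rfl
  rw [h4, mul_smul_comm, ← Finset.prod_attach C]
  congr 2
  · refine Finset.prod_congr rfl fun b _ => ?_
    rw [hρ b.1 b.2]
    rfl
  · refine Finset.prod_congr rfl fun b _ => ?_
    rw [hr, ← h2, hc]

end Pairs

/-! ### Determinants of frames -/

section Frames

universe uI uV

variable {I : Type uI} [Fintype I] [DecidableEq I]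
  {V : I → Type uV} [∀ i, AddCommGroup (V i)] [∀ i, Module ℂ (V i)]

/-- The determinant of a family of vectors indexed by the basis of `k i` copies of each `V i`, each
vector being placed in one copy. -/
def frameDet (V : I → Type uV) [∀ i, AddCommGroup (V i)] [∀ i, Module ℂ (V i)] (k : I → ℕ) :
    MultilinearMap ℂ (fun _ : FrameIdx V k => BasisIdx V → ℂ) ℂ :=
  (Matrix.detRowAlternating (n := FrameIdx V k) (R := ℂ)).toMultilinearMap.compLinearMap fun p =>
    LinearMap.pi fun p' => if p.1 = p'.1 then
      LinearMap.proj (R := ℂ) (φ := fun _ : BasisIdx V => ℂ) (⟨p'.1.1, p'.2⟩ : BasisIdx V) else 0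

theorem frameDet_apply (k : I → ℕ) (v : FrameIdx V k → BasisIdx V → ℂ) :
    frameDet V k v =
      (Matrix.of fun p p' => if p.1 = p'.1 then v p ⟨p'.1.1, p'.2⟩ else 0).det := by
  change Matrix.det _ = _
  congr 1
  ext p p'
  rw [LinearMap.pi_apply, Matrix.of_apply]
  split_ifs <;> rfl

/-- A diagonal block of a matrix on the sum of all `V i`. -/
def vertexBlock (g : Matrix (BasisIdx V) (BasisIdx V) ℂ) (i : I) :
    Matrix (Fin (Module.finrank ℂ (V i))) (Fin (Module.finrank ℂ (V i))) ℂ :=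
  fun r r' => g ⟨i, r⟩ ⟨i, r'⟩

omit [DecidableEq I] in
theorem vertexBlock_transpose (g : Matrix (BasisIdx V) (BasisIdx V) ℂ) (i : I) :
    vertexBlock g.transpose i = (vertexBlock g i).transpose := rfl

theorem sum_vertexBlock {M : Type*} [AddCommMonoid M] (i : I) (f : BasisIdx V → M)
    (h : ∀ y, y.1 ≠ i → f y = 0) : ∑ y, f y = ∑ r, f ⟨i, r⟩ := by
  rw [Fintype.sum_sigma, Finset.sum_eq_single_of_mem i (Finset.mem_univ i)]
  intro j _ hj
  exact Finset.sum_eq_zero fun r _ => h _ hj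

/-- The matrix of the frame is multiplied by the block diagonal matrix with `k i` copies of the
block of `g` at each vertex `i`. -/
theorem frameDet_vecMul (k : I → ℕ) (g : Matrix (BasisIdx V) (BasisIdx V) ℂ)
    (hg : ∀ x y, x.1 ≠ y.1 → g x y = 0) (v : FrameIdx V k → BasisIdx V → ℂ) :
    frameDet V k (fun p => Matrix.vecMul (v p) g) =
      frameDet V k v * ∏ i, (vertexBlock g i).det ^ k i := by
  have h : ∏ i, (vertexBlock g i).det ^ k i = (Matrix.blockDiagonal'
      fun q : Σ i, Fin (k i) => vertexBlock g q.1).det := by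
    rw [ChiData.det_blockDiagonal', Fintype.prod_sigma]
    refine Finset.prod_congr rfl fun i _ => ?_
    change _ = ∏ _ : Fin (k i), (vertexBlock g i).det
    rw [Finset.prod_const, Finset.card_univ, Fintype.card_fin]
  rw [h, frameDet_apply, frameDet_apply, ← Matrix.det_mul]
  congr 1
  ext p p'
  rw [Matrix.mul_apply, Fintype.sum_sigma]
  rw [Finset.sum_eq_single_of_mem p'.1 (Finset.mem_univ _)]
  · by_cases hp : p.1 = p'.1
    · simp only [Matrix.of_apply, hp, if_true]
      rw [Matrix.vecMul, dotProduct, sum_vertexBlock p'.1.1]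
      · refine Finset.sum_congr rfl fun r _ => ?_
        congr 1
        exact (Matrix.blockDiagonal'_apply_eq
          (fun q : Σ i, Fin (k i) => vertexBlock g q.1) p'.1 r p'.2).symm
      · intro y hy
        rw [hg _ _ hy, mul_zero]
    · simp [hp]
  · intro q _ hq
    refine Finset.sum_eq_zero fun r _ => ?_
    exact mul_eq_zero_of_right _ (Matrix.blockDiagonal'_apply_ne _ _ _ hq)

/-- The frame is a permuted standard basis, and copies are preserved by `hτ`, so its matrix is a
permutation matrix. -/
theorem frameDet_single (k : I → ℕ) (τ : Perm (FrameIdx V k)) (hτ : ∀ x, x.1 = (τ x).1) :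
    frameDet V k (fun p => Pi.single ⟨(τ p).1.1, (τ p).2⟩ 1) = ((Perm.sign τ : ℤ) : ℂ) := by
  have := Matrix.det_permute τ (1 : Matrix (FrameIdx V k) (FrameIdx V k) ℂ)
  rw [Matrix.det_one, mul_one] at this
  rw [← this, frameDet_apply]
  congr 1
  ext p p'
  rw [Matrix.of_apply, Matrix.submatrix_apply, hτ p, id, Matrix.one_apply]
  generalize τ p = x
  obtain ⟨q, r⟩ := x
  obtain ⟨q', r'⟩ := p'
  by_cases h : q = q'
  · subst h
    by_cases hr : r = r'
    · subst hr
      simp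
    · rw [if_pos rfl, if_neg (by simpa using hr), Pi.single_eq_of_ne]
      simpa [eq_comm] using hr
  · rw [if_neg h, if_neg]
    intro h'
    exact h (congrArg Sigma.fst h')

end Frames

/-! ### Decomposition of a representation into arrows, columns of γ and rows of δ -/

section Blocks

universe uI uH uV uD

variable {I : Type uI} [Fintype I] [DecidableEq I] {H : Type uH} [DecidableEq H]
  {Q : DoubleQuiver I H}
  {V : I → Type uV} [∀ i, AddCommGroup (V i)] [∀ i, Module ℂ (V i)]
  {D : I → Type uD} [∀ i, AddCommGroup (D i)] [∀ i, Module ℂ (D i)]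
  [∀ i, FiniteDimensional ℂ (V i)] [∀ i, FiniteDimensional ℂ (D i)]

/-- A block of a matrix as a linear map. -/
def opBlock (i j : I) :
    Matrix (Option (BasisIdx V)) (Option (BasisIdx V)) ℂ →ₗ[ℂ] V i →ₗ[ℂ] V j :=
  (Matrix.toLin (Module.finBasis ℂ (V i)) (Module.finBasis ℂ (V j))).toLinearMap ∘ₗ
    { toFun X := fun r r' => X (some ⟨j, r⟩) (some ⟨i, r'⟩)
      map_add' _ _ := rfl
      map_smul' _ _ := rfl }

/-- A block of the last column as a vector. -/
def colBlock (i : I) : Matrix (Option (BasisIdx V)) (Option (BasisIdx V)) ℂ →ₗ[ℂ] V i :=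
  (Module.finBasis ℂ (V i)).equivFun.symm.toLinearMap ∘ₗ
    { toFun X := fun r => X (some ⟨i, r⟩) none
      map_add' _ _ := rfl
      map_smul' _ _ := rfl }

/-- A block of the last row as a linear form. -/
def rowBlock (i : I) :
    Matrix (Option (BasisIdx V)) (Option (BasisIdx V)) ℂ →ₗ[ℂ] Module.Dual ℂ (V i) :=
  ((Module.finBasis ℂ (V i)).constr ℂ).toLinearMap ∘ₗ
    { toFun X := fun r => X none (some ⟨i, r⟩)
      map_add' _ _ := rfl
      map_smul' _ _ := rfl }

variable (Q D) in
/-- The representation with a single arrow, or a single line in `γ` or `δ`, given by a matrix. -/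
def elementaryRep (t : H ⊕ (BasisIdx D ⊕ BasisIdx D)) :
    Matrix (Option (BasisIdx V)) (Option (BasisIdx V)) ℂ →ₗ[ℂ] Rep Q V D :=
  t.elim (fun h => LinearMap.inl ℂ _ _ ∘ₗ LinearMap.single ℂ _ h ∘ₗ opBlock (Q.src h) (Q.tgt h))
    (Sum.elim
      (fun l => LinearMap.inr ℂ _ _ ∘ₗ LinearMap.inl ℂ _ _ ∘ₗ LinearMap.single ℂ _ l.1 ∘ₗ
        LinearMap.smulRightₗ ((Module.finBasis ℂ (D l.1)).coord l.2) ∘ₗ colBlock l.1)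
      (fun l => LinearMap.inr ℂ _ _ ∘ₗ LinearMap.inr ℂ _ _ ∘ₗ LinearMap.single ℂ _ l.1 ∘ₗ
        LinearMap.smulRightₗ.flip (Module.finBasis ℂ (D l.1) l.2) ∘ₗ rowBlock l.1))

/-- The matrices attached to the arrows, to the columns of `γ` and to the rows of `δ`. -/
def letterMatrix (s : Rep Q V D) (t : H ⊕ (BasisIdx D ⊕ BasisIdx D)) :
    Matrix (Option (BasisIdx V)) (Option (BasisIdx V)) ℂ :=
  t.elim (fun h => opMatrix (arrowMatrix h s)) (Sum.elim (fun l => colMatrix (gammaVec l s))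
    fun l => rowMatrix (deltaVec l s))

theorem opBlock_apply_basis (i j : I) (X : Matrix (Option (BasisIdx V)) (Option (BasisIdx V)) ℂ)
    (r : Fin (Module.finrank ℂ (V i))) : opBlock i j X (Module.finBasis ℂ (V i) r) =
      ∑ r', X (some ⟨j, r'⟩) (some ⟨i, r⟩) • Module.finBasis ℂ (V j) r' := by
  rw [opBlock, LinearMap.comp_apply, LinearEquiv.coe_coe, Matrix.toLin_self]
  rfl

theorem colBlock_apply (i : I) (X : Matrix (Option (BasisIdx V)) (Option (BasisIdx V)) ℂ) :
    colBlock i X = ∑ r, X (some ⟨i, r⟩) none • Module.finBasis ℂ (V i) r :=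
  Module.Basis.equivFun_symm_apply _ _

theorem rowBlock_apply_basis (i : I) (X : Matrix (Option (BasisIdx V)) (Option (BasisIdx V)) ℂ)
    (r : Fin (Module.finrank ℂ (V i))) :
    rowBlock i X (Module.finBasis ℂ (V i) r) = X none (some ⟨i, r⟩) :=
  Module.Basis.constr_basis (S := ℂ) _ _ _

theorem elementaryRep_arrow (h : H) (X : Matrix (Option (BasisIdx V)) (Option (BasisIdx V)) ℂ) :
    elementaryRep Q D (.inl h) X = (Pi.single h (opBlock (Q.src h) (Q.tgt h) X), 0, 0) := rfl

theorem elementaryRep_gamma (l : BasisIdx D)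
    (X : Matrix (Option (BasisIdx V)) (Option (BasisIdx V)) ℂ) :
    elementaryRep Q D (.inr (.inl l)) X = (0, Pi.single l.1
      (((Module.finBasis ℂ (D l.1)).coord l.2).smulRight (colBlock l.1 X)), 0) := rfl

theorem elementaryRep_delta (l : BasisIdx D)
    (X : Matrix (Option (BasisIdx V)) (Option (BasisIdx V)) ℂ) :
    elementaryRep Q D (.inr (.inr l)) X = (0, 0, Pi.single l.1
      ((rowBlock l.1 X).smulRight (Module.finBasis ℂ (D l.1) l.2))) := rfl

theorem opBlock_arrowMatrix (h : H) (s : Rep Q V D) :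
    opBlock (Q.src h) (Q.tgt h) (opMatrix (arrowMatrix h s)) = s.1 h := by
  refine (Module.finBasis ℂ (V (Q.src h))).ext fun r => ?_
  rw [opBlock_apply_basis]
  simp only [opMatrix, arrowMatrix, Pi.single_eq_same, Option.elim_some]
  exact (Module.finBasis ℂ (V (Q.tgt h))).sum_repr _

theorem colBlock_gammaVec (l : BasisIdx D) (s : Rep Q V D) :
    colBlock l.1 (colMatrix (gammaVec l s)) = s.2.1 l.1 (Module.finBasis ℂ (D l.1) l.2) := by
  rw [colBlock_apply]
  simp only [colMatrix, gammaVec, Pi.single_eq_same, Option.elim_some, Option.elim_none]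
  exact (Module.finBasis ℂ (V l.1)).sum_repr _

theorem rowBlock_deltaVec (l : BasisIdx D) (s : Rep Q V D) :
    rowBlock l.1 (rowMatrix (deltaVec l s)) =
      (Module.finBasis ℂ (D l.1)).coord l.2 ∘ₗ s.2.2 l.1 := by
  refine (Module.finBasis ℂ (V l.1)).ext fun r => ?_
  rw [rowBlock_apply_basis]
  simp [rowMatrix, deltaVec]

theorem sum_sigma_pi_single {M : I → Type*} [∀ i, AddCommMonoid (M i)] {κ : I → Type*}
    [∀ i, Fintype (κ i)] (F : ∀ i, κ i → M i) :
    ∑ l : Sigma κ, (Pi.single l.1 (F l.1 l.2) : ∀ i, M i) = fun i => ∑ r, F i r := by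
  rw [Fintype.sum_sigma, ← Finset.univ_sum_single fun i => ∑ r, F i r]
  refine Finset.sum_congr rfl fun i _ => ?_
  exact (map_sum (AddMonoidHom.single M i) _ _).symm

/-- This expresses a point linearly by its letters, so a multilinear form at the point expands over
words in arrows, columns of γ and rows of δ. -/
theorem sum_elementaryRep_letterMatrix [Fintype H] (s : Rep Q V D) :
    ∑ t, elementaryRep Q D t (letterMatrix s t) = s := by
  rw [Fintype.sum_sum_type, Fintype.sum_sum_type]
  simp only [elementaryRep_arrow, elementaryRep_gamma, elementaryRep_delta, letterMatrix,
    Sum.elim_inl, Sum.elim_inr, opBlock_arrowMatrix, colBlock_gammaVec, rowBlock_deltaVec]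
  refine Prod.ext ?_ (Prod.ext ?_ ?_)
  · simp [Prod.fst_sum, Finset.univ_sum_single]
  · simp only [Prod.snd_add, Prod.fst_add, Prod.snd_sum, Prod.fst_sum, Finset.sum_const_zero,
      zero_add, add_zero]
    rw [sum_sigma_pi_single fun i r => ((Module.finBasis ℂ (D i)).coord r).smulRight
      (s.2.1 i (Module.finBasis ℂ (D i) r))]
    funext i
    refine LinearMap.ext fun v => ?_
    refine Eq.trans ?_ (congrArg (s.2.1 i) ((Module.finBasis ℂ (D i)).sum_repr v))
    simp only [map_sum, map_smul, LinearMap.sum_apply, LinearMap.smulRight_apply,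
      Module.Basis.coord_apply]
  · simp only [Prod.snd_add, Prod.snd_sum, Finset.sum_const_zero, zero_add]
    rw [sum_sigma_pi_single fun i r => ((Module.finBasis ℂ (D i)).coord r ∘ₗ s.2.2 i).smulRight
      (Module.finBasis ℂ (D i) r)]
    funext i
    refine LinearMap.ext fun v => ?_
    refine Eq.trans ?_ ((Module.finBasis ℂ (D i)).sum_repr (s.2.2 i v))
    simp only [LinearMap.sum_apply, LinearMap.smulRight_apply, LinearMap.comp_apply,
      Module.Basis.coord_apply]

section Equivariance

variable {g : Matrix (Option (BasisIdx V)) (Option (BasisIdx V)) ℂ}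
  (hg : ∀ x y, Option.map Sigma.fst x ≠ Option.map Sigma.fst y → g x y = 0)

include hg

/-- Colour preservation of `g` makes the corresponding block of a right inverse of `g` a right
inverse of the block. -/
theorem isUnit_det_vertexBlock (hu : IsUnit g) (i : I) :
    IsUnit (vertexBlock (g.submatrix some some) i).det := by
  obtain ⟨h, hh⟩ := hu.exists_right_inv
  refine Matrix.isUnit_det_of_right_inverse
    (B := vertexBlock (h.submatrix some some) i) (Matrix.ext fun r r' => ?_)
  have := congrFun (congrFun hh (some ⟨i, r⟩)) (some ⟨i, r'⟩)
  rw [Matrix.mul_apply, Fintype.sum_option, hg _ _ (by simp), zero_mul, zero_add,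
    sum_vertexBlock i] at this
  · refine this.trans ?_
    simp [Matrix.one_apply]
  · intro y hy
    rw [hg _ _ (by simpa using hy.symm), zero_mul]

theorem opBlock_mul (i j : I) (X : Matrix (Option (BasisIdx V)) (Option (BasisIdx V)) ℂ) :
    opBlock i j (g * X) = Matrix.toLin (Module.finBasis ℂ (V j)) (Module.finBasis ℂ (V j))
      (vertexBlock (g.submatrix some some) j) ∘ₗ opBlock i j X := by
  rw [opBlock, LinearMap.comp_apply, LinearMap.comp_apply, LinearEquiv.coe_coe,
    ← Matrix.toLin_mul]
  congr 1
  ext r r'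
  change (g * X) _ _ = _
  rw [Matrix.mul_apply, Fintype.sum_option, hg _ _ (by simp), zero_mul, zero_add,
    sum_vertexBlock j]
  · rfl
  · intro y hy
    rw [hg _ _ (by simpa using hy.symm), zero_mul]

theorem mul_opBlock (i j : I) (X : Matrix (Option (BasisIdx V)) (Option (BasisIdx V)) ℂ) :
    opBlock i j (X * g) = opBlock i j X ∘ₗ Matrix.toLin (Module.finBasis ℂ (V i))
      (Module.finBasis ℂ (V i)) (vertexBlock (g.submatrix some some) i) := by
  rw [opBlock, LinearMap.comp_apply, LinearMap.comp_apply, LinearEquiv.coe_coe,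
    ← Matrix.toLin_mul]
  congr 1
  ext r r'
  change (X * g) _ _ = _
  rw [Matrix.mul_apply, Fintype.sum_option, hg none _ (by simp), mul_zero, zero_add,
    sum_vertexBlock i]
  · rfl
  · intro y hy
    rw [hg _ _ (by simpa using hy), mul_zero]

theorem colBlock_mul (i : I) (X : Matrix (Option (BasisIdx V)) (Option (BasisIdx V)) ℂ) :
    colBlock i (g * X) = Matrix.toLin (Module.finBasis ℂ (V i)) (Module.finBasis ℂ (V i))
      (vertexBlock (g.submatrix some some) i) (colBlock i X) := by
  rw [colBlock_apply, colBlock_apply, map_sum]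
  simp only [map_smul, Matrix.toLin_self, Finset.smul_sum]
  rw [Finset.sum_comm]
  refine Finset.sum_congr rfl fun r _ => ?_
  rw [Matrix.mul_apply, Fintype.sum_option, hg _ _ (by simp), zero_mul, zero_add,
    sum_vertexBlock i, Finset.sum_smul]
  · refine Finset.sum_congr rfl fun r' _ => ?_
    rw [smul_smul, mul_comm]
    rfl
  · intro y hy
    rw [hg _ _ (by simpa using hy.symm), zero_mul]

theorem mul_colBlock (i : I) (X : Matrix (Option (BasisIdx V)) (Option (BasisIdx V)) ℂ) :
    colBlock i (X * g) = g none none • colBlock i X := by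
  rw [colBlock_apply, colBlock_apply, Finset.smul_sum]
  refine Finset.sum_congr rfl fun r _ => ?_
  rw [Matrix.mul_apply, Fintype.sum_option, Finset.sum_eq_zero, add_zero, smul_smul, mul_comm]
  intro y _
  rw [hg _ _ (by simp), mul_zero]

theorem rowBlock_mul (i : I) (X : Matrix (Option (BasisIdx V)) (Option (BasisIdx V)) ℂ) :
    rowBlock i (g * X) = g none none • rowBlock i X := by
  refine (Module.finBasis ℂ (V i)).ext fun r => ?_
  rw [LinearMap.smul_apply, rowBlock_apply_basis, rowBlock_apply_basis,
    Matrix.mul_apply, Fintype.sum_option, Finset.sum_eq_zero, add_zero, smul_eq_mul]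
  intro y _
  rw [hg _ _ (by simp), zero_mul]

theorem mul_rowBlock (i : I) (X : Matrix (Option (BasisIdx V)) (Option (BasisIdx V)) ℂ) :
    rowBlock i (X * g) = rowBlock i X ∘ₗ Matrix.toLin (Module.finBasis ℂ (V i))
      (Module.finBasis ℂ (V i)) (vertexBlock (g.submatrix some some) i) := by
  refine (Module.finBasis ℂ (V i)).ext fun r => ?_
  rw [LinearMap.comp_apply, Matrix.toLin_self, rowBlock_apply_basis, map_sum,
    Matrix.mul_apply, Fintype.sum_option, hg none _ (by simp), mul_zero, zero_add,
    sum_vertexBlock i]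
  · refine Finset.sum_congr rfl fun r' _ => ?_
    rw [map_smul, rowBlock_apply_basis, smul_eq_mul, mul_comm]
    rfl
  · intro y hy
    rw [hg _ _ (by simpa using hy), mul_zero]

/-- The group acts on matrices by conjugation with block diagonal matrices. -/
theorem act_elementaryRep (h1 : g none none = 1)
    (hb : ∀ i, IsUnit (vertexBlock (g.submatrix some some) i).det)
    (t : H ⊕ (BasisIdx D ⊕ BasisIdx D))
    (X : Matrix (Option (BasisIdx V)) (Option (BasisIdx V)) ℂ) :
    act (fun i => Matrix.toLinearEquiv (Module.finBasis ℂ (V i)) _ (hb i))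
      (elementaryRep Q D t (X * g)) = elementaryRep Q D t (g * X) := by
  set γ : GV V := fun i => Matrix.toLinearEquiv (Module.finBasis ℂ (V i)) _ (hb i) with hγ
  have hc : ∀ i, Matrix.toLin (Module.finBasis ℂ (V i)) (Module.finBasis ℂ (V i))
      (vertexBlock (g.submatrix some some) i) = (γ i).toLinearMap := fun i => rfl
  rcases t with h | l | l
  · rw [elementaryRep_arrow, elementaryRep_arrow, mul_opBlock hg, opBlock_mul hg, hc, hc]
    refine Prod.ext ?_ (Prod.ext ?_ ?_)
    · funext h'
      by_cases hh : h' = h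
      · subst hh
        ext v
        simp [act]
      · simp [act, Pi.single_eq_of_ne hh]
    · funext i
      simp [act]
    · funext i
      simp [act]
  · rw [elementaryRep_gamma, elementaryRep_gamma, mul_colBlock hg, colBlock_mul hg, hc, h1,
      one_smul]
    refine Prod.ext ?_ (Prod.ext ?_ ?_)
    · funext h'
      simp [act]
    · funext i
      by_cases hi : i = l.1
      · subst hi
        ext v
        simp [act]
      · simp [act, Pi.single_eq_of_ne hi]
    · funext i
      simp [act]
  · rw [elementaryRep_delta, elementaryRep_delta, mul_rowBlock hg, rowBlock_mul hg, hc, h1,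
      one_smul]
    refine Prod.ext ?_ (Prod.ext ?_ ?_)
    · funext h'
      simp [act]
    · funext i
      simp [act]
    · funext i
      by_cases hi : i = l.1
      · subst hi
        ext v
        simp [act]
      · simp [act, Pi.single_eq_of_ne hi]

end Equivariance

end Blocks

/-! ### Compensating the character by frames -/

section Framed

universe uI uH uV uD

variable {I : Type uI} [Fintype I] [DecidableEq I] {H : Type uH} [DecidableEq H]
  {Q : DoubleQuiver I H}
  {V : I → Type uV} [∀ i, AddCommGroup (V i)] [∀ i, Module ℂ (V i)]
  {D : I → Type uD} [∀ i, AddCommGroup (D i)] [∀ i, Module ℂ (D i)]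
  [∀ i, FiniteDimensional ℂ (V i)] [∀ i, FiniteDimensional ℂ (D i)] {m : I → ℤ}

/-- Moving two summands into the last two summands of a threefold sum. -/
def sumFrameEquiv (O A B F F' : Type*) :
    (O ⊕ (A ⊕ B)) ⊕ (F ⊕ F') ≃ O ⊕ ((F ⊕ A) ⊕ (F' ⊕ B)) where
  toFun := Sum.elim (Sum.map id (Sum.map .inr .inr)) fun x => .inr (Sum.map .inl .inl x)
  invFun := Sum.elim (fun o => .inl (.inl o)) (Sum.elim
    (Sum.elim (fun p => .inr (.inl p)) fun a => .inl (.inr (.inl a)))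
    (Sum.elim (fun p => .inr (.inr p)) fun a => .inl (.inr (.inr a))))
  left_inv := by rintro ((o | a | b) | p | q) <;> rfl
  right_inv := by rintro (o | (p | a) | q | b) <;> rfl

variable {O A B : Type*} (φ : MultilinearMap ℂ (fun _ : O ⊕ (A ⊕ B) => Rep Q V D) ℂ)
  (tO : O → H) (aa : A → BasisIdx D) (bb : B → BasisIdx D)

variable (V m) in
/-- The indices of a form on operators, vectors and covectors to which frames have been added. -/
abbrev FramedIdx (O A B : Type*) : Type _ :=
  O ⊕ ((FrameIdx V (fun i => (-m i).toNat) ⊕ A) ⊕ (FrameIdx V (fun i => (m i).toNat) ⊕ B))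

/-- The last column of a matrix. -/
def lastCol : Matrix (Option (BasisIdx V)) (Option (BasisIdx V)) ℂ →ₗ[ℂ] BasisIdx V → ℂ where
  toFun X := fun y => X (some y) none
  map_add' _ _ := rfl
  map_smul' _ _ := rfl

/-- The last row of a matrix. -/
def lastRow : Matrix (Option (BasisIdx V)) (Option (BasisIdx V)) ℂ →ₗ[ℂ] BasisIdx V → ℂ where
  toFun X := fun y => X none (some y)
  map_add' _ _ := rfl
  map_smul' _ _ := rfl

variable (m) in
/-- The invariant form obtained from a semi-invariant form by adding frames whose determinants
compensate for the character. -/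
def framedForm : MultilinearMap ℂ (fun _ : FramedIdx V m O A B =>
      Matrix (Option (BasisIdx V)) (Option (BasisIdx V)) ℂ) ℂ :=
  ((LinearMap.mul' ℂ ℂ).compMultilinearMap
    ((φ.compLinearMap fun x => elementaryRep Q D (Sum.map tO (Sum.map aa bb) x)).domCoprod
      ((LinearMap.mul' ℂ ℂ).compMultilinearMap
        (((frameDet V fun i => (-m i).toNat).compLinearMap fun _ => lastCol).domCoprod
          ((frameDet V fun i => (m i).toNat).compLinearMap fun _ => lastRow))))).domDomCongr (sumFrameEquiv O A B _ _)

theorem framedForm_apply (X : FramedIdx V m O A B →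
      Matrix (Option (BasisIdx V)) (Option (BasisIdx V)) ℂ) :
    framedForm m φ tO aa bb X =
      φ (fun x => elementaryRep Q D (Sum.map tO (Sum.map aa bb) x)
        (X (Sum.map id (Sum.map .inr .inr) x))) *
      (frameDet V (fun i => (-m i).toNat) (fun p => lastCol (X (.inr (.inl (.inl p))))) *
        frameDet V (fun i => (m i).toNat) (fun p => lastRow (X (.inr (.inr (.inl p)))))) :=
  rfl

variable (hφ : ∀ (g : GV V) x, φ (fun i => act g (x i)) = (chi m g : ℂˣ) * φ x)

/-- The negative part of `m` is moved to the other side as a determinant factor. -/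
theorem chi_mul_prod_det (g : Matrix (BasisIdx V) (BasisIdx V) ℂ)
    (hb : ∀ i, IsUnit (vertexBlock g i).det) :
    ((chi m (fun i => Matrix.toLinearEquiv (Module.finBasis ℂ (V i)) _ (hb i)) : ℂˣ) : ℂ) *
      ∏ i, (vertexBlock g i).det ^ (-m i).toNat = ∏ i, (vertexBlock g i).det ^ (m i).toNat := by
  have h : ((chi m (fun i => Matrix.toLinearEquiv (Module.finBasis ℂ (V i)) _ (hb i)) : ℂˣ) : ℂ) =
      ∏ i, (vertexBlock g i).det ^ m i := by
    simp only [chi, MonoidHom.coe_mk, OneHom.coe_mk, Units.coe_prod, Units.val_zpow_eq_zpow_val,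
      LinearEquiv.coe_det]
    refine Finset.prod_congr rfl fun i _ => ?_
    congr 1
    exact LinearMap.det_toLin _ _
  rw [h, ← Finset.prod_mul_distrib]
  refine Finset.prod_congr rfl fun i _ => ?_
  rw [← zpow_natCast, ← zpow_natCast, ← zpow_add₀ (hb i).ne_zero]
  congr 1
  omega

include hφ

/-- Passing from right to left multiplication by `g` multiplies the semi-invariant factor by the
character. Left multiplication multiplies the frames of vectors by the determinants to the powers
m_i⁻, right multiplication the frames of covectors to the powers m_i⁺, and these factors balance. -/
theorem framedForm_mul_comm_of_one (g : Matrix (Option (BasisIdx V)) (Option (BasisIdx V)) ℂ)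
    (hu : IsUnit g) (hg : ∀ x y, Option.map Sigma.fst x ≠ Option.map Sigma.fst y → g x y = 0)
    (h1 : g none none = 1) (Y : FramedIdx V m O A B →
        Matrix (Option (BasisIdx V)) (Option (BasisIdx V)) ℂ) :
    (framedForm m φ tO aa bb fun e => g * Y e) = framedForm m φ tO aa bb fun e => Y e * g := by
  have hb := isUnit_det_vertexBlock hg hu
  have hs : ∀ x y : BasisIdx V, x.1 ≠ y.1 → g.submatrix some some x y = 0 := fun x y h =>
    hg _ _ (by simpa using h)
  have hs' : ∀ x y : BasisIdx V, x.1 ≠ y.1 → (g.submatrix some some).transpose x y = 0 :=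
    fun x y h => hs _ _ h.symm
  have e1 : ∀ X, lastCol (g * X) =
      Matrix.vecMul (lastCol X) (g.submatrix some some).transpose := by
    intro X
    ext y
    change (g * X) (some y) none = _
    rw [Matrix.mul_apply, Fintype.sum_option, hg _ _ (by simp), zero_mul, zero_add,
      Matrix.vecMul, dotProduct]
    exact Finset.sum_congr rfl fun z _ => mul_comm _ _
  have e2 : ∀ X, lastRow (X * g) = Matrix.vecMul (lastRow X) (g.submatrix some some) := by
    intro X
    ext y
    change (X * g) none (some y) = _
    rw [Matrix.mul_apply, Fintype.sum_option, hg none _ (by simp), mul_zero, zero_add]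
    rfl
  have e3 : ∀ X, lastCol (X * g) = lastCol X := by
    intro X
    ext y
    change (X * g) (some y) none = X (some y) none
    rw [Matrix.mul_apply, Fintype.sum_option, h1, mul_one, Finset.sum_eq_zero, add_zero]
    intro z _
    rw [hg _ _ (by simp), mul_zero]
  have e4 : ∀ X, lastRow (g * X) = lastRow X := by
    intro X
    ext y
    change (g * X) none (some y) = X none (some y)
    rw [Matrix.mul_apply, Fintype.sum_option, h1, one_mul, Finset.sum_eq_zero, add_zero]
    intro z _
    rw [hg _ _ (by simp), zero_mul]
  rw [framedForm_apply, framedForm_apply]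
  simp only [e1, e2, e3, e4]
  rw [frameDet_vecMul _ _ hs', frameDet_vecMul _ _ hs]
  simp only [← act_elementaryRep hg h1 hb, vertexBlock_transpose, Matrix.det_transpose]
  rw [hφ, ← chi_mul_prod_det (m := m) _ hb]
  ring

theorem framedForm_mul_comm [Fintype O] [Fintype A] [Fintype B]
    (g : Matrix (Option (BasisIdx V)) (Option (BasisIdx V)) ℂ)
    (hu : IsUnit g) (hg : ∀ x y, Option.map Sigma.fst x ≠ Option.map Sigma.fst y → g x y = 0)
    (Y : FramedIdx V m O A B →
        Matrix (Option (BasisIdx V)) (Option (BasisIdx V)) ℂ) :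
    (framedForm m φ tO aa bb fun e => g * Y e) = framedForm m φ tO aa bb fun e => Y e * g := by
  have h0 : g none none ≠ 0 := by
    obtain ⟨h, hh⟩ := hu.exists_right_inv
    have := congrFun (congrFun hh none) none
    rw [Matrix.mul_apply, Fintype.sum_option, Finset.sum_eq_zero, add_zero] at this
    · exact left_ne_zero_of_mul_eq_one (this.trans (by simp))
    · intro y _
      rw [hg _ _ (by simp), zero_mul]
  -- Both sides are homogeneous of the same degree in `g`, so the entry at the additional index may
  -- be normalized to 1.
  obtain ⟨c, g', hc, h1, rfl⟩ : ∃ c g', c ≠ 0 ∧ g' none none = 1 ∧ g = c • g' :=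
    ⟨g none none, (g none none)⁻¹ • g, h0, inv_mul_cancel₀ h0, by
      rw [smul_smul, mul_inv_cancel₀ h0, one_smul]⟩
  have hu' : IsUnit g' := (isUnit_smul_iff (Units.mk0 c hc) g').1 hu
  have hg' : ∀ x y, Option.map Sigma.fst x ≠ Option.map Sigma.fst y → g' x y = 0 :=
    fun x y h => (mul_eq_zero.1 (hg x y h)).resolve_left hc
  have := framedForm_mul_comm_of_one φ tO aa bb hφ g' hu' hg' h1 Y
  simp only [Matrix.smul_mul, Matrix.mul_smul]
  rw [MultilinearMap.map_smul_univ (framedForm m φ tO aa bb) (fun _ => c) fun e => g' * Y e,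
    MultilinearMap.map_smul_univ (framedForm m φ tO aa bb) (fun _ => c) fun e => Y e * g', this]

omit hφ

theorem sum_ite_sum_ite {α α' M : Type*} [Fintype α] [Fintype α'] [AddCommMonoid M] (p : α → Prop)
    (p' : α' → Prop) [DecidablePred p] [DecidablePred p'] (f : α → α' → M) :
    (∑ x, if p x then ∑ y, if p' y then f x y else 0 else 0) =
      ∑ z ∈ Finset.univ.filter p ×ˢ Finset.univ.filter p', f z.1 z.2 := by
  rw [Finset.sum_product, Finset.sum_filter]
  simp_rw [Finset.sum_filter]

variable [Fintype A] [Fintype B] [DecidableEq A] [DecidableEq B]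

set_option synthInstance.maxSize 1000 in
/-- A semi-invariant form evaluated at arrows, columns and rows is generated by the determinants of
good data. -/
theorem multilinear_part_mem_goodSpan (e : (Δ : ChiData Q V D m) → Δ.Z ≃ₗ[ℂ] Δ.Y)
    {O : Type} [Fintype O] [DecidableEq O]
    (φ : MultilinearMap ℂ (fun _ : O ⊕ (A ⊕ B) => Rep Q V D) ℂ)
    (hφ : ∀ (g : GV V) x, φ (fun i => act g (x i)) = (chi m g : ℂˣ) * φ x)
    (tO : O → H) (aa : A → BasisIdx D) (bb : B → BasisIdx D) :
    (fun s => φ fun x => elementaryRep Q D (Sum.map tO (Sum.map aa bb) x)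
      (letterMatrix s (Sum.map tO (Sum.map aa bb) x))) ∈ goodSpan e := by
  obtain ⟨a, ha⟩ := exists_contraction_coefficients (E := FramedIdx V m O A B) (Option.map Sigma.fst)
    (framedForm m φ tO aa bb) (framedForm_mul_comm φ tO aa bb hφ)
  -- The frames are specialized to the standard bases, permuted by `τA` and `τB`; by `hX` the frame
  -- determinants then become the two signs.
  let X : Rep Q V D → Perm (FrameIdx V fun i => (-m i).toNat) →
      Perm (FrameIdx V fun i => (m i).toNat) → FramedIdx V m O A B →
        Matrix (Option (BasisIdx V)) (Option (BasisIdx V)) ℂ := fun s τA τB =>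
    Sum.elim (fun o => opMatrix (arrowMatrix (tO o) s)) (Sum.elim
      (fun x => colMatrix (colVec aa s (Equiv.sumCongr τA (Equiv.refl _) x)))
      fun x => rowMatrix (rowVec bb s (Equiv.sumCongr τB (Equiv.refl _) x)))
  have hX : ∀ s τA τB, (∀ x, x.1 = (τA x).1) → (∀ x, x.1 = (τB x).1) →
      framedForm m φ tO aa bb (X s τA τB) = (φ fun x => elementaryRep Q D
        (Sum.map tO (Sum.map aa bb) x) (letterMatrix s (Sum.map tO (Sum.map aa bb) x))) *
        (((Perm.sign τA : ℤ) : ℂ) * ((Perm.sign τB : ℤ) : ℂ)) := by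
    intro s τA τB hA hB
    rw [framedForm_apply, ← frameDet_single _ τA hA, ← frameDet_single _ τB hB]
    congr 2
    ext1 (o | a | b) <;> rfl
  let S := (Finset.univ.filter fun τ : Perm (FrameIdx V fun i => (-m i).toNat) =>
    ∀ x, x.1 = (τ x).1) ×ˢ Finset.univ.filter fun τ : Perm (FrameIdx V fun i => (m i).toNat) =>
    ∀ x, x.1 = (τ x).1
  have hS : (S.card : ℂ) ≠ 0 := by
    rw [Nat.cast_ne_zero, Finset.card_ne_zero]
    exact ⟨(1, 1), by simp [S]⟩
  -- For each coloured contraction, the signed sum over frame permutations is zero or an invariant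
  -- times a sum covered by `framed_sum_mem_goodSpan`.
  have hpart : ∀ (σ : Perm (FramedIdx V m O A B)) (κ : FramedIdx V m O A B → Option I),
      (fun s => ∑ τ ∈ S, ((Perm.sign τ.1 : ℤ) * (Perm.sign τ.2 : ℤ)) •
      ∑ k : FramedIdx V m O A B → Option (BasisIdx V), if Option.map Sigma.fst ∘ k = κ then
        ∏ x, X s τ.1 τ.2 x (k x) (k (σ x)) else 0) ∈ goodSpan e := by
    intro σ κ
    rcases colored_contraction_eq Sigma.fst (pathMatrices Q V D) pathMatrices_mul
      colorProj_mem_pathMatrices (invariants Q V D) trace_mem_invariants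
      (fun o => arrowMatrix (tO o)) (fun o => arrowMatrix_mem_pathMatrices (tO o)) σ κ with
      h | ⟨q, hq, β, W, hW, h⟩
    · convert (goodSpan e).zero_mem using 1
      ext s
      refine Finset.sum_eq_zero fun τ _ => ?_
      rw [h s, smul_zero]
    · convert mul_mem_of_mem_invariants hq (framed_sum_mem_goodSpan e bb aa β W hW) using 1
      ext s
      rw [sum_ite_sum_ite, Finset.mul_sum]
      refine Finset.sum_congr rfl fun τ _ => ?_
      rw [h s, mul_smul_comm]
  -- The signed value of the framed form is the same for every pair in `S`; summing over `S` gives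
  -- the form times the cardinality of `S`.
  have hsum : ((S.card : ℂ) • fun s => φ fun x => elementaryRep Q D (Sum.map tO (Sum.map aa bb) x)
      (letterMatrix s (Sum.map tO (Sum.map aa bb) x))) = ∑ σ, ∑ κ, a σ κ • fun s => ∑ τ ∈ S,
      ((Perm.sign τ.1 : ℤ) * (Perm.sign τ.2 : ℤ)) •
      ∑ k : FramedIdx V m O A B → Option (BasisIdx V), if Option.map Sigma.fst ∘ k = κ then
        ∏ x, X s τ.1 τ.2 x (k x) (k (σ x)) else 0 := by
    ext s
    have : ∀ τ ∈ S, (φ fun x => elementaryRep Q D (Sum.map tO (Sum.map aa bb) x)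
        (letterMatrix s (Sum.map tO (Sum.map aa bb) x))) =
        ((Perm.sign τ.1 : ℤ) * (Perm.sign τ.2 : ℤ)) •
          framedForm m φ tO aa bb (X s τ.1 τ.2) := by
      intro τ hτ
      simp only [S, Finset.mem_product, Finset.mem_filter, Finset.mem_univ, true_and] at hτ
      rw [hX s τ.1 τ.2 hτ.1 hτ.2]
      rcases Int.units_eq_one_or (Perm.sign τ.1) with h1 | h1 <;>
        rcases Int.units_eq_one_or (Perm.sign τ.2) with h2 | h2 <;> simp [h1, h2]
    rw [Pi.smul_apply, smul_eq_mul, ← nsmul_eq_mul, ← Finset.sum_const,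
      Finset.sum_congr rfl this]
    simp only [ha, Finset.sum_apply, Pi.smul_apply, smul_eq_mul, Finset.mul_sum, Finset.smul_sum]
    rw [Finset.sum_comm]
    refine Finset.sum_congr rfl fun σ _ => ?_
    rw [Finset.sum_comm]
    refine Finset.sum_congr rfl fun κ _ => Finset.sum_congr rfl fun τ _ =>
      Finset.sum_congr rfl fun k _ => ?_
    rw [mul_smul_comm]
  have := const_smul_mem (S.card : ℂ)⁻¹ (P := goodSpan e) (hsum ▸ Submodule.sum_mem _ fun σ _ =>
    Submodule.sum_mem _ fun κ _ => const_smul_mem (a σ κ) (hpart σ κ))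
  rwa [smul_smul, inv_mul_cancel₀ hS, one_smul] at this

end Framed

/-! ### Homogeneous parts and their multilinear forms -/

section Forms

variable {E : Type*} [AddCommGroup E] [Module ℂ E]

variable (E) in
/-- The homogeneous polynomial functions of a given degree. -/
def homogeneousForms (d : ℕ) : Submodule ℂ (E → ℂ) where
  carrier := {f | ∃ φ : MultilinearMap ℂ (fun _ : Fin d => E) ℂ, ∀ s, f s = φ fun _ => s}
  zero_mem' := ⟨0, fun _ => rfl⟩
  add_mem' := by
    rintro _ _ ⟨φ, hφ⟩ ⟨ψ, hψ⟩
    exact ⟨φ + ψ, fun s => by simp [hφ, hψ]⟩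
  smul_mem' := by
    rintro c _ ⟨φ, hφ⟩
    exact ⟨c • φ, fun s => by simp [hφ]⟩

/-- The adjoined algebra is spanned by products of linear forms, and each product is a multilinear
form on the diagonal. -/
theorem adjoin_dual_le_iSup_homogeneousForms :
    Subalgebra.toSubmodule (Algebra.adjoin ℂ (Set.range fun φ : Module.Dual ℂ E =>
      (φ : E → ℂ))) ≤ ⨆ d, homogeneousForms E d := by
  rw [Algebra.adjoin_eq_span, Submodule.span_le]
  intro f hf
  suffices h : ∃ d, f ∈ homogeneousForms E d from
    h.elim fun d hd => Submodule.mem_iSup_of_mem d hd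
  induction hf using Submonoid.closure_induction with
  | mem f hf =>
    obtain ⟨φ, rfl⟩ := hf
    exact ⟨1, (MultilinearMap.mkPiAlgebra ℂ (Fin 1) ℂ).compLinearMap fun _ => φ, fun s => by simp⟩
  | one => exact ⟨0, MultilinearMap.mkPiAlgebra ℂ (Fin 0) ℂ |>.compLinearMap fun _ => 0,
      fun s => by simp⟩
  | mul f f' _ _ hf hf' =>
    obtain ⟨d, φ, hφ⟩ := hf
    obtain ⟨d', φ', hφ'⟩ := hf'
    refine ⟨d + d', ((LinearMap.mul' ℂ ℂ).compMultilinearMap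
      (φ.domCoprod φ')).domDomCongr finSumFinEquiv, fun s => ?_⟩
    simp [hφ, hφ']

theorem smul_of_mem_homogeneousForms {d : ℕ} {f : E → ℂ} (hf : f ∈ homogeneousForms E d) (t : ℂ)
    (s : E) : f (t • s) = t ^ d * f s := by
  obtain ⟨φ, hφ⟩ := hf
  rw [hφ, hφ, φ.map_smul_univ (fun _ => t) fun _ => s]
  simp

/-- The homogeneous parts of a semi-invariant are semi-invariant. -/
theorem homogeneous_parts_semiInvariant (F : ℕ →₀ (E → ℂ)) (hF : ∀ d, F d ∈ homogeneousForms E d)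
    (L : E →ₗ[ℂ] E) (c : ℂ) (h : ∀ s, F.sum (fun _ x => x) (L s) = c * F.sum (fun _ x => x) s)
    (d : ℕ) (s : E) : F d (L s) = c * F d s := by
  -- At `t • s` the defect of semi-invariance is this polynomial in `t`; it vanishes identically,
  -- and its coefficients are the defects of the homogeneous parts.
  let P : Polynomial ℂ := ∑ d ∈ F.support, Polynomial.monomial d (F d (L s) - c * F d s)
  have hP : P = 0 := by
    refine Polynomial.funext fun t => ?_
    have := h (t • s)
    simp only [Finsupp.sum, Finset.sum_apply, map_smul,
      smul_of_mem_homogeneousForms (hF _)] at this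
    rw [Finset.mul_sum, ← sub_eq_zero, ← Finset.sum_sub_distrib] at this
    simp only [P, Polynomial.eval_finsetSum, Polynomial.eval_monomial, Polynomial.eval_zero]
    rw [← this]
    exact Finset.sum_congr rfl fun d _ => by ring
  by_cases hd : d ∈ F.support
  · have := congrArg (fun p => p.coeff d) hP
    simp only [P, Polynomial.finsetSum_coeff, Polynomial.coeff_monomial, Polynomial.coeff_zero,
      Finset.sum_ite_eq', if_pos hd] at this
    exact sub_eq_zero.1 this
  · rw [Finsupp.notMem_support_iff.1 hd]
    simp

/-- The symmetrization of the form of a semi-invariant is semi-invariant. -/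
theorem exists_semiInvariant_form {d : ℕ} {f : E → ℂ} (hf : f ∈ homogeneousForms E d) :
    ∃ φ : MultilinearMap ℂ (fun _ : Fin d => E) ℂ, (∀ s, φ (fun _ => s) = (d.factorial : ℂ) * f s) ∧
      ∀ (L : E →ₗ[ℂ] E) (c : ℂ), (∀ s, f (L s) = c * f s) →
        ∀ x : Fin d → E, φ (fun i => L (x i)) = c * φ x := by
  obtain ⟨φ, hφ⟩ := hf
  refine ⟨∑ ν : Perm (Fin d), φ.domDomCongr ν, fun s => ?_, fun L c hL x => ?_⟩
  · simp [hφ, Fintype.card_perm]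
  · simp only [_root_.sum_apply, MultilinearMap.domDomCongr_apply]
    -- Polarization writes both sides as the same alternating combination of values of `f` at subset
    -- sums, where semi-invariance of `f` applies.
    rw [sum_perm_multilinear φ fun _ b => L (x b), sum_perm_multilinear φ fun _ b => x b,
      Finset.mul_sum]
    refine Finset.sum_congr rfl fun S _ => ?_
    rw [← map_sum, ← hφ, ← hφ, hL, mul_smul_comm]

end Forms

/-- Sorts the positions of a word by the type of their letters; applied twice, it separates
operators, vectors and covectors. -/
theorem exists_sum_splitting {E : Type} {T T' : Type*} (r : E → T ⊕ T') :
    ∃ (E₁ E₂ : Type) (ε : E₁ ⊕ E₂ ≃ E) (t : E₁ → T) (t' : E₂ → T'),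
      ∀ x, r (ε x) = Sum.map t t' x := by
  classical
  refine ⟨{x // (r x).isLeft}, {x // ¬ (r x).isLeft}, Equiv.sumCompl _,
    fun x => (r x.1).getLeft x.2, fun x => (r x.1).getRight (by simpa using x.2), ?_⟩
  rintro (x | x) <;> simp

/-! ### Every semi-invariant is generated by good determinants -/

section Final

universe uI uH uV uD

variable {I : Type uI} [Fintype I] [DecidableEq I] {H : Type uH} [DecidableEq H]
  {Q : DoubleQuiver I H}
  {V : I → Type uV} [∀ i, AddCommGroup (V i)] [∀ i, Module ℂ (V i)]
  {D : I → Type uD} [∀ i, AddCommGroup (D i)] [∀ i, Module ℂ (D i)]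
  [∀ i, FiniteDimensional ℂ (V i)] [∀ i, FiniteDimensional ℂ (D i)] {m : I → ℤ}

/-- The action of a group element as a linear map. -/
def actLinear (g : GV V) : Rep Q V D →ₗ[ℂ] Rep Q V D where
  toFun := act g
  map_add' s s' := by
    refine Prod.ext ?_ (Prod.ext ?_ ?_) <;> funext i <;> ext v <;> simp [act]
  map_smul' c s := by
    refine Prod.ext ?_ (Prod.ext ?_ ?_) <;> funext i <;> ext v <;> simp [act]

/-- The symmetrized form on the diagonal is `d!` times `f`. Expanding every argument into its
letters gives a sum over words, each of which is a semi-invariant form in operators, vectors and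
covectors. -/
theorem homogeneous_mem_goodSpan [Fintype H] (e : (Δ : ChiData Q V D m) → Δ.Z ≃ₗ[ℂ] Δ.Y) {d : ℕ}
    {f : Rep Q V D → ℂ} (hf : f ∈ homogeneousForms (Rep Q V D) d)
    (hinv : ∀ (g : GV V) s, f (act g s) = (chi m g : ℂˣ) * f s) : f ∈ goodSpan e := by
  obtain ⟨φ, h1, h2⟩ := exists_semiInvariant_form hf
  have hφ : ∀ (g : GV V) x, φ (fun i => act g (x i)) = (chi m g : ℂˣ) * φ x := fun g =>
    h2 (actLinear g) _ (hinv g)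
  have h3 : (d.factorial : ℂ) • f = ∑ r : Fin d → H ⊕ (BasisIdx D ⊕ BasisIdx D),
      fun s => φ fun i => elementaryRep Q D (r i) (letterMatrix s (r i)) := by
    ext s
    rw [Pi.smul_apply, smul_eq_mul, ← h1, Finset.sum_apply]
    refine Eq.trans ?_ (φ.map_sum fun _ t => elementaryRep Q D t (letterMatrix s t))
    simp only [sum_elementaryRep_letterMatrix]
  have h4 : (d.factorial : ℂ) • f ∈ goodSpan e := by
    rw [h3]
    refine Submodule.sum_mem _ fun r _ => ?_
    obtain ⟨O, E₂, ε, tO, t', hr⟩ := exists_sum_splitting r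
    obtain ⟨A, B, ε', aa, bb, ht'⟩ := exists_sum_splitting t'
    let η : O ⊕ (A ⊕ B) ≃ Fin d := (Equiv.sumCongr (Equiv.refl O) ε').trans ε
    have hη : ∀ x, r (η x) = Sum.map tO (Sum.map aa bb) x := by
      rintro (o | x)
      · exact hr (.inl o)
      · exact (hr (.inr (ε' x))).trans (congrArg Sum.inr (ht' x))
    classical
    have : Finite (O ⊕ (A ⊕ B)) := Finite.of_equiv _ η.symm
    have : Finite O := Finite.of_injective (Sum.inl : O → O ⊕ (A ⊕ B)) Sum.inl_injective
    have : Finite A := Finite.of_injective (fun a => (.inr (.inl a) : O ⊕ (A ⊕ B)))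
      fun a a' h => by simpa using h
    have : Finite B := Finite.of_injective (fun a => (.inr (.inr a) : O ⊕ (A ⊕ B)))
      fun a a' h => by simpa using h
    cases nonempty_fintype O
    cases nonempty_fintype A
    cases nonempty_fintype B
    convert multilinear_part_mem_goodSpan e (φ.domDomCongr η.symm)
      (fun g x => hφ g fun i => x (η.symm i)) tO aa bb using 1
    ext s
    rw [MultilinearMap.domDomCongr_apply]
    congr 1
    ext1 i
    rw [← hη, Equiv.apply_symm_apply]
  have h5 := const_smul_mem (d.factorial : ℂ)⁻¹ h4
  rwa [smul_smul, inv_mul_cancel₀ (Nat.cast_ne_zero.2 d.factorial_ne_zero), one_smul] at h5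

theorem semiInvariants_le_goodSpan [Fintype H] (e : (Δ : ChiData Q V D m) → Δ.Z ≃ₗ[ℂ] Δ.Y) :
    semiInvariants Q V D (chi m) 1 ≤ goodSpan e := by
  rintro f ⟨hf, hinv⟩
  have h1 : f ∈ ⨆ d, homogeneousForms (Rep Q V D) d := adjoin_dual_le_iSup_homogeneousForms hf
  obtain ⟨F, hF, rfl⟩ := (Submodule.mem_iSup_iff_exists_finsupp _ _).1 h1
  refine Submodule.sum_mem _ fun d _ => homogeneous_mem_goodSpan e (hF d) fun g s => ?_
  refine homogeneous_parts_semiInvariant F hF (actLinear g) _ (fun s => ?_) d s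
  have := hinv g s
  rwa [pow_one] at this

end Final

end QuiverVariety

end

theorem mainTheorem2 {I H : Type*} [Fintype I] [Fintype H]
    (Q : QuiverVariety.DoubleQuiver I H)
    (V : I → Type*) [∀ i, AddCommGroup (V i)] [∀ i, Module ℂ (V i)]
    [∀ i, FiniteDimensional ℂ (V i)]
    (D : I → Type*) [∀ i, AddCommGroup (D i)] [∀ i, Module ℂ (D i)]
    [∀ i, FiniteDimensional ℂ (D i)]
    (m : I → ℤ)
    (e : (Δ : QuiverVariety.ChiData Q V D m) → Δ.Z ≃ₗ[ℂ] Δ.Y) :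
    Submodule.span (QuiverVariety.invariants Q V D)
        {F : QuiverVariety.Rep Q V D → ℂ |
          ∃ Δ : QuiverVariety.ChiData Q V D m, Δ.IsGood ∧ F = Δ.f (e Δ)} =
      QuiverVariety.semiInvariants Q V D (QuiverVariety.chi m) 1 := by
  classical
  refine le_antisymm (Submodule.span_le.2 ?_) (QuiverVariety.semiInvariants_le_goodSpan e)
  rintro _ ⟨Δ, -, rfl⟩
  exact Δ.f_mem_semiInvariants (e Δ)
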